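/- Let $\gamma\subset\hat{\mathbb C}$ be a Jordan curve, let $\Omega,\Omega^*$ be the two connected components of $\hat{\mathbb C}\setminus\gamma$, and let $f:\mathbb D\to\Omega$, $g:\mathbb D\to\Omega^*$ be conformal maps (biholomorphisms from the unit disk). Write $\mathcal S(f)=(f''/f')'-\tfrac12(f''/f')^2$ for the Schwarzian derivative (at a pole of $f$ it is computed for $1/f$) and $$\|\mathcal S(f)\|_\infty=\sup_{\zeta\in\mathbb D}|\mathcal S(f)(\zeta)|\,\frac{(1-|\zeta|^2)^2}{4},$$ and similarly for $g$. Let $\mathbb H^3=\{(z,t):z\in\mathbb C,\ t>0\}$ be hyperbolic $3$-space, with boundary at infinity $\hat{\mathbb C}$. Let $\rho_\Omega=e^{\varphi}|dz|^2$ be the Poincaré metric (complete, curvature $-1$) of $\Omega$. The Epstein--Poincaré map $\mathrm{Ep}_\Omega:\Omega\to\mathbb H^3$ is the envelope of the horospheres $\{x\in\mathbb H^3:\nu_x(z)=\rho_\Omega(z)\}$, $z\in\Omega$, where $\nu_x$ is the visual metric on $\hat{\mathbb C}$ seen from $x$; explicitly, for $z\in\Omega\cap\mathbb C$, $$\mathrm{Ep}_\Omega(z)=\bigl(z+\xi\,\varphi_{\bar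 z}e^{-\varphi/2},\ \xi\bigr),\qquad \xi=\frac{2e^{-\varphi/2}}{1+|\varphi_{\bar z}|^2e^{-\varphi}},$$ and at $z=\infty$ it is given by the same formula in the coordinate $1/z$, carried back by the isometry of $\mathbb H^3$ that extends $z\mapsto 1/z$. Let $\Sigma_\Omega=\mathrm{Ep}_\Omega(\Omega)$ and $\Sigma_{\Omega^*}=\mathrm{Ep}_{\Omega^*}(\Omega^*)$ be the Epstein--Poincaré surfaces. Let $C(\gamma)\subset\mathbb H^3$ be the convex core of $\gamma$, i.e. its closed hyperbolic convex hull (the intersection of all closed half-spaces whose boundary at infinity contains $\gamma$), and for $\epsilon\ge 0$ let $C_\epsilon(\gamma)$ be the set of points at hyperbolic distance at most $\epsilon$ from $C(\gamma)$. Then $\|\mathcal S(f)\|_\infty$ and $\|\mathcal S(g)\|_\infty$ are finite and, with $$\epsilon=\log\max\{1,\ 2\|\mathcal S(f)\|_\infty-1,\ 2\|\mathcal S(g)\|_\infty-1\},$$ one has $\Sigma_\Omega\subseteq C_\epsilon(\gamma)$ and $\Sigma_{\Omega^*}\subseteq C_\epsilon(\gamma)$. In particular, if $\|\mathcal S(f)\|_\infty<1$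 and $\|\mathcal S(g)\|_\infty<1$, then $\Sigma_\Omega$ and $\Sigma_{\Omega^*}$ are contained in $C(\gamma)$. -/

import Mathlib

noncomputable section

namespace EpsteinPoincare

open Metric Set

/-! ### The Riemann sphere `OnePoint ℂ` with its two charts `z` and `1/z` -/

/-- The affine coordinate `z` (the value at `∞` is a dummy). -/
def affineCoord (p : OnePoint ℂ) : ℂ := OnePoint.elim p 0 id

open Classical in
/-- The Möbius transformation `z ↦ 1/z` of the Riemann sphere (`0 ↔ ∞`). -/
def sphereInv (p : OnePoint ℂ) : OnePoint ℂ :=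
  OnePoint.elim p ((0 : ℂ) : OnePoint ℂ)
    (fun z => if z = 0 then OnePoint.infty else ((z⁻¹ : ℂ) : OnePoint ℂ))

open Classical in
/-- A sphere-valued map `f` near `ζ`, read in the chart `z` if `f ζ ≠ ∞`, and in the chart `1/z`
if `f ζ = ∞`. -/
def localCoord (f : ℂ → OnePoint ℂ) (ζ : ℂ) : ℂ → ℂ :=
  if f ζ = OnePoint.infty then fun w => affineCoord (sphereInv (f w))
  else fun w => affineCoord (f w)

/-- `f` maps the unit disk conformally (bijectively and holomorphically, as a map into the Riemann
sphere) onto `Ω`. -/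
structure IsConformalOnto (f : ℂ → OnePoint ℂ) (Ω : Set (OnePoint ℂ)) : Prop where
  continuousAt : ∀ ζ ∈ ball (0 : ℂ) 1, ContinuousAt f ζ
  differentiableAt : ∀ ζ ∈ ball (0 : ℂ) 1, DifferentiableAt ℂ (localCoord f ζ) ζ
  bijOn : BijOn f (ball (0 : ℂ) 1) Ω

/-! ### The Schwarzian derivative and its hyperbolic sup norm -/

/-- `S(h) = (h''/h')' - (1/2) (h''/h')²`. -/
def schwarzian (h : ℂ → ℂ) (ζ : ℂ) : ℂ :=
  deriv (fun w => deriv (deriv h) w / deriv h w) ζ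
    - 1 / 2 * (deriv (deriv h) ζ / deriv h ζ) ^ 2

/-- The density `4 / (1 - |ζ|²)²` of the Poincaré metric of the unit disk. -/
def diskDensity (ζ : ℂ) : ℝ := 4 / (1 - ‖ζ‖ ^ 2) ^ 2

/-- `|S(f)(ζ)| / ρ_𝔻(ζ)` for a sphere-valued map `f`. At a pole of `f` the chart `1/z` is used:
`S(1/h) = S(h)`. -/
def schwarzianSize (f : ℂ → OnePoint ℂ) (ζ : ℂ) : ℝ :=
  ‖schwarzian (localCoord f ζ) ζ‖ / diskDensity ζ

/-- `‖S(f)‖_∞`, the supremum of `|S(f)| / ρ_𝔻` over the unit disk. -/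
def schwarzianNorm (f : ℂ → OnePoint ℂ) : ℝ :=
  ⨆ ζ : ball (0 : ℂ) 1, schwarzianSize f ζ

/-! ### Jordan curves -/

/-- A Jordan curve in the Riemann sphere. -/
def IsJordanCurve (γ : Set (OnePoint ℂ)) : Prop :=
  ∃ c : Circle → OnePoint ℂ, Continuous c ∧ Function.Injective c ∧ range c = γ

/-- `Ω` and `Ω'` are the two connected components of the complement of `γ`. -/
structure AreComplementaryComponents (γ Ω Ω' : Set (OnePoint ℂ)) : Prop where
  isOpen_left : IsOpen Ω
  isOpen_right : IsOpen Ω'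
  isConnected_left : IsConnected Ω
  isConnected_right : IsConnected Ω'
  disjoint : Disjoint Ω Ω'
  union_eq : Ω ∪ Ω' = γᶜ

/-! ### Hyperbolic 3-space -/

/-- The upper half-space model `{(z, t) : z ∈ ℂ, t > 0}` of hyperbolic 3-space. -/
@[ext]
structure H3 where
  z : ℂ
  t : ℝ
  t_pos : 0 < t

/-- The hyperbolic distance (of the metric `(|dz|² + dt²) / t²`):
`2 arsinh (|p - q| / (2 √(p.t q.t)))`, with `|p - q|` the Euclidean distance. -/
def hypDist (p q : H3) : ℝ :=
  2 * Real.arsinh (√(‖p.z - q.z‖ ^ 2 + (p.t - q.t) ^ 2) / (2 * √(p.t * q.t)))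

/-- The isometry of hyperbolic 3-space that extends `z ↦ 1/z`. -/
def invIsometry (p : H3) : H3 where
  z := (starRingEnd ℂ) p.z / ((‖p.z‖ ^ 2 + p.t ^ 2 : ℝ) : ℂ)
  t := p.t / (‖p.z‖ ^ 2 + p.t ^ 2)
  t_pos := by
    have := p.t_pos
    positivity

/-- The closed `ε`-neighbourhood of a (closed) set. -/
def closedNhd (ε : ℝ) (C : Set H3) : Set H3 := {x | ∃ y ∈ C, hypDist x y ≤ ε}

/-! ### The convex core

A closed half-space of hyperbolic 3-space is given by real `A`, `C` and complex `B` with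
`|B|² > A C`; its boundary plane is a hemisphere (`A ≠ 0`) or a vertical half-plane (`A = 0`). -/

/-- The closed half-space `A (|z|² + t²) + 2 Re (conj B z) + C ≤ 0`. -/
def halfSpace (A : ℝ) (B : ℂ) (C : ℝ) : Set H3 :=
  {x | A * (‖x.z‖ ^ 2 + x.t ^ 2) + 2 * ((starRingEnd ℂ) B * x.z).re + C ≤ 0}

/-- The boundary at infinity of `halfSpace A B C`, a closed round disk in the Riemann sphere. -/
def idealDisk (A : ℝ) (B : ℂ) (C : ℝ) : Set (OnePoint ℂ) :=
  {p | OnePoint.elim p (A ≤ 0)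
    (fun z => A * ‖z‖ ^ 2 + 2 * ((starRingEnd ℂ) B * z).re + C ≤ 0)}

/-- The convex core of `γ`: the hyperbolic closed convex hull of `γ`, i.e. the intersection of all
closed half-spaces whose boundary at infinity contains `γ`. -/
def convexCore (γ : Set (OnePoint ℂ)) : Set H3 :=
  {x | ∀ (A : ℝ) (B : ℂ) (C : ℝ), A * C < ‖B‖ ^ 2 → γ ⊆ idealDisk A B C → x ∈ halfSpace A B C}

/-! ### Epstein maps -/

/-- The density at `w` of the visual metric `ν_x` on the sphere at infinity seen from `x`. -/
def visualDensity (x : H3) (w : ℂ) : ℝ := (2 * x.t / (‖w - x.z‖ ^ 2 + x.t ^ 2)) ^ 2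

/-- The horosphere based at `w` of the points `x` with `ν_x(w) = r`. -/
def horosphere (w : ℂ) (r : ℝ) : Set H3 := {x | visualDensity x w = r}

/-- `∂φ/∂z̄` of a real function `φ`. -/
def dbar (φ : ℂ → ℝ) (w : ℂ) : ℂ :=
  (((fderiv ℝ φ w 1 : ℝ) : ℂ) + Complex.I * ((fderiv ℝ φ w Complex.I : ℝ) : ℂ)) / 2

/-- The height `ξ = 2 e^{-φ/2} / (1 + |φ_z̄|² e^{-φ})` of the Epstein map of `e^φ |dz|²`. -/
def epsteinHeight (φ : ℂ → ℝ) (w : ℂ) : ℝ :=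
  2 * Real.exp (-φ w / 2) / (1 + ‖dbar φ w‖ ^ 2 * Real.exp (-φ w))

/-- The Epstein map of the conformal metric `e^φ |dz|²`:
`(Z, ξ)` with `Z = w + ξ φ_z̄ e^{-φ/2}`. It is the envelope of the horospheres
`horosphere w (e^{φ w})`, see `eq_epsteinMap_iff`. -/
def epsteinMap (φ : ℂ → ℝ) (w : ℂ) : H3 where
  z := w + (epsteinHeight φ w : ℂ) * (dbar φ w * (Real.exp (-φ w / 2) : ℂ))
  t := epsteinHeight φ w
  t_pos := by unfold epsteinHeight; positivity

lemma hasFDerivAt_log_visualDensity (x : H3) (w : ℂ) :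
    HasFDerivAt (fun u => Real.log (visualDensity x u))
      ((-(4 / (‖w - x.z‖ ^ 2 + x.t ^ 2))) • innerSL ℝ (w - x.z)) w := by
  have ht := x.t_pos
  have h1 : HasFDerivAt (fun u : ℂ => ‖u - x.z‖ ^ 2 + x.t ^ 2)
      ((2 : ℝ) • innerSL ℝ (w - x.z)) w := by
    have := ((hasFDerivAt_id (𝕜 := ℝ) w).sub_const x.z).norm_sq
    refine (this.add_const (x.t ^ 2)).congr_fderiv ?_
    ext v
    simp
  have h2 := h1.log (by positivity)
  have h3 := (h2.const_mul (-2)).const_add (2 * Real.log (2 * x.t))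
  have h4 : (fun u => Real.log (visualDensity x u)) =
      fun u => 2 * Real.log (2 * x.t) + -2 * Real.log (‖u - x.z‖ ^ 2 + x.t ^ 2) := by
    funext u
    unfold visualDensity
    rw [Real.log_pow, Real.log_div (by positivity) (by positivity)]
    push_cast
    ring
  rw [h4]
  refine h3.congr_fderiv ?_
  rw [smul_smul, smul_smul]
  congr 1
  ring

/-- The point `epsteinMap φ w` is the only solution of the envelope equation at `w`, i.e. the only
`x` on the horosphere `ν_x(w) = e^{φ w}` for which `log ν_x - φ` is stationary at `w`. -/
theorem eq_epsteinMap_iff (φ : ℂ → ℝ) (w : ℂ) (x : H3) :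
    x = epsteinMap φ w ↔
      x ∈ horosphere w (Real.exp (φ w)) ∧
        fderiv ℝ (fun u => Real.log (visualDensity x u)) w = fderiv ℝ φ w := by
  have hx := x.t_pos
  set s : ℝ := Real.exp (-φ w / 2) with hs
  have hs0 : 0 < s := Real.exp_pos _
  have hs2 : Real.exp (-φ w) = s ^ 2 := by
    rw [hs, ← Real.exp_nat_mul]; congr 1; push_cast; ring
  have he : Real.exp (φ w) = (1 / s) ^ 2 := by
    rw [one_div, inv_pow, ← hs2, Real.exp_neg, inv_inv]
  set N : ℝ := ‖w - x.z‖ ^ 2 + x.t ^ 2 with hN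
  have hN0 : 0 < N := by positivity
  set ψ : ℂ := dbar φ w * (s : ℂ) with hψ
  have hψn : ‖dbar φ w‖ ^ 2 * s ^ 2 = ‖ψ‖ ^ 2 := by
    rw [hψ, norm_mul, mul_pow, Complex.norm_real, Real.norm_eq_abs, sq_abs]
  have hA : x ∈ horosphere w (Real.exp (φ w)) ↔ N = 2 * x.t * s := by
    have : visualDensity x w = (2 * x.t / N) ^ 2 := rfl
    rw [horosphere, mem_ofPred_eq, this, he, pow_left_inj₀ (by positivity) (by positivity) (by simp),
      div_eq_div_iff (by positivity) (by positivity)]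
    constructor <;> intro h <;> linarith
  have hB : fderiv ℝ (fun u => Real.log (visualDensity x u)) w = fderiv ℝ φ w ↔
      dbar φ w = -(2 / N : ℝ) * (w - x.z) := by
    rw [(hasFDerivAt_log_visualDensity x w).fderiv, ← hN]
    have e1 : ((-(4 / N)) • innerSL ℝ (w - x.z)) (1 : ℂ) = -(4 / N) * (w - x.z).re := by
      simp [Complex.inner]
    have e2 : ((-(4 / N)) • innerSL ℝ (w - x.z)) Complex.I = -(4 / N) * (w - x.z).im := by
      simp [Complex.inner]
    constructor
    · intro h
      rw [h] at e1 e2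
      unfold dbar
      rw [e1, e2]
      apply Complex.ext <;> simp <;> ring
    · intro h
      have h1 := congrArg Complex.re h
      have h2 := congrArg Complex.im h
      simp [dbar] at h1 h2
      have hL : ∀ L M : ℂ →L[ℝ] ℝ, L 1 = M 1 → L Complex.I = M Complex.I → L = M := by
        intro L M a b
        ext v
        · have : v = v.re • (1 : ℂ) + v.im • Complex.I := by
            apply Complex.ext <;> simp
          rw [this, map_add, map_add, map_smul, map_smul, map_smul, map_smul, a, b]
      apply hL
      · rw [e1]; simp; linear_combination (-2) * h1
      · rw [e2]; simp; linear_combination (-2) * h2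
  rw [hA, hB]
  have hξ : epsteinHeight φ w = 2 * s / (1 + ‖ψ‖ ^ 2) := by
    unfold epsteinHeight; rw [hs2, hψn]
  constructor
  · intro h
    have ht : x.t = 2 * s / (1 + ‖ψ‖ ^ 2) := by rw [← hξ, h]; rfl
    have hz : w - x.z = -((x.t : ℂ) * ψ) := by
      have h1 : x.t = epsteinHeight φ w := by rw [h]; rfl
      have h2 : x.z = w + (epsteinHeight φ w : ℂ) * ψ := by rw [h]; rfl
      rw [h1, h2]; ring
    have hN1 : N = 2 * x.t * s := by
      have : N = x.t ^ 2 * (1 + ‖ψ‖ ^ 2) := by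
        rw [hN, hz, norm_neg, norm_mul, Complex.norm_real, Real.norm_eq_abs, mul_pow, sq_abs]; ring
      rw [this]
      have h3 : x.t * (1 + ‖ψ‖ ^ 2) = 2 * s := by rw [ht]; field_simp
      linear_combination x.t * h3
    refine ⟨hN1, ?_⟩
    have ht' : (x.t : ℂ) ≠ 0 := by exact_mod_cast hx.ne'
    have hs' : (s : ℂ) ≠ 0 := by exact_mod_cast hs0.ne'
    rw [hz, hN1, hψ]
    push_cast
    field_simp
  · rintro ⟨h1, h2⟩
    have ht' : (x.t : ℂ) ≠ 0 := by exact_mod_cast hx.ne'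
    have hs' : (s : ℂ) ≠ 0 := by exact_mod_cast hs0.ne'
    have hz : w - x.z = -((x.t : ℂ) * ψ) := by
      rw [hψ, h2, h1]
      push_cast
      field_simp
    have h3 : N = x.t ^ 2 * (1 + ‖ψ‖ ^ 2) := by
      rw [hN, hz, norm_neg, norm_mul, Complex.norm_real, Real.norm_eq_abs, mul_pow, sq_abs]; ring
    have ht : x.t = epsteinHeight φ w := by
      rw [hξ, eq_div_iff (by positivity)]
      have : x.t * (x.t * (1 + ‖ψ‖ ^ 2)) = x.t * (2 * s) := by
        linear_combination h1 - h3
      exact mul_left_cancel₀ hx.ne' this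
    ext1
    · change x.z = w + (epsteinHeight φ w : ℂ) * ψ
      rw [← ht]
      linear_combination -hz
    · exact ht

/-! ### The Epstein–Poincaré surface of a domain in the Riemann sphere -/

open Classical in
/-- The density at `w ∈ Ω ∩ ℂ` of the Poincaré metric of a simply connected domain `Ω`:
`4 / |h'(0)|²`, where `h : 𝔻 → Ω` is a conformal map with `h(0) = w`. (Any two such maps differ by
a rotation of `𝔻`.) -/
def poincareDensity (Ω : Set (OnePoint ℂ)) (w : ℂ) : ℝ :=
  if H : ∃ h : ℂ → OnePoint ℂ, IsConformalOnto h Ω ∧ h 0 = (w : OnePoint ℂ) then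
    4 / ‖deriv (localCoord H.choose 0) 0‖ ^ 2
  else 0

/-- The Epstein–Poincaré map `Ω → ℍ³`: the Epstein map of the Poincaré metric of `Ω`. At `∞` it is
computed in the chart `1/z` and carried back by the isometry that extends `z ↦ 1/z`. -/
def epsteinPoincareMap (Ω : Set (OnePoint ℂ)) (p : OnePoint ℂ) : H3 :=
  OnePoint.elim p
    (invIsometry (epsteinMap (fun u => Real.log (poincareDensity (sphereInv ⁻¹' Ω) u)) 0))
    (fun w => epsteinMap (fun u => Real.log (poincareDensity Ω u)) w)

/-- The Epstein–Poincaré surface `Σ_Ω`. -/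
def epsteinPoincareSurface (Ω : Set (OnePoint ℂ)) : Set H3 := epsteinPoincareMap Ω '' Ω

end EpsteinPoincare

end

open EpsteinPoincare

noncomputable section

namespace EpsteinPoincare

open Metric Set Filter Topology
open scoped ComplexConjugate

/-! Write a conformal map of the disk as `f = a / b` with Wronskian `a' b - a b' = 1`. Then `a` and
`b` solve `y'' = λ y`, and `S(f) = -2 λ`; with `w = 1 - |z|²`, a bound `K` on the Schwarzian norm
reads `|λ| w² ≤ 2 K`. A half-space is an indefinite Hermitian form `Q` on `ℂ²`; put `d = √(|B|² - A
C)`. Along `v = (a, b)` let `u = Q(v, v) / w` (`horoDepth`), and let `s` (`epsteinDepth`) be the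
value of `Q` at the Epstein point, seen as a positive Hermitian matrix of determinant 1. By
`epsteinPoincareMap_depth`, `s` is the half-space functional at the Epstein point divided by the
height of that point, so the task is to bound `s` by `2 d sinh ε` for every `Q` that is nonpositive
on `γ`.

Two formulas drive the estimate. The first is `(s - u) u = w² |∂u|² - d²`
(`epsteinDepth_mul_horoDepth_re`). The second is `∂(s + c u) = (2 + c) ∂u + λ w² conj(∂u)`
(`hasDerivAt_depth_line`). If `|λ| w² < 2 + c`, a local maximum of `s + c u` is therefore a critical
point of `u`. There the second derivatives of `u` are `∂²u = λ u` and `∂∂̄u = s / w²`, and the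
second-derivative test in two perpendicular directions gives `s ± |λ| w² u ≤ 0`, whence `s ≤ 0`
(`epsteinDepth_nonpos_of_isLocalMax`). The first formula then forces `u ≤ d` at the maximum, so `s +
c u ≤ c d` everywhere. Letting `c` decrease to `E - 1`, where `2 K - 1 ≤ E`, and comparing with `(s
- u) u ≥ -d²` yields `s ≤ d (E - 1 / E) = 2 d sinh (log E)`. If `Q` is negative on all of `Ω`, then
`u < 0`, the same argument gives `u ≤ -d` at the maximum, and the conclusion is `s ≤ 0`.

The maximum exists after two perturbations: `Q` is shifted slightly so that it becomes strictly
negative near `γ`, and `f` is replaced by `z ↦ f (r z)`, for which `s + c u` tends to `-∞` at the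
circle. Only the two cases above occur, because the complement of a closed round disk is connected
and so lies in `Ω` or in `Ω'` (`IsLift.epsteinDepth_le`).

Depth bounds become a distance bound by convexity in the hyperboloid model
(`mem_closedNhd_convexCore`): the support plane at the point of the hull of `γ` nearest to `x`
bounds a half-space that measures the distance from `x`. Finiteness of the Schwarzian norms follows
from a crude Koebe-type bound (`norm_le_of_univalent`) and Cauchy's estimates. -/

/-! ### Univalent functions -/

/-- An injective holomorphic function has no critical points. -/
lemma deriv_ne_zero_of_injOn {f : ℂ → ℂ} {U : Set ℂ} (hU : IsOpen U)
    (hf : DifferentiableOn ℂ f U) (hinj : InjOn f U) {z : ℂ} (hz : z ∈ U) : deriv f z ≠ 0 := by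
  intro h0
  have hzU : U ∈ 𝓝 z := hU.mem_nhds hz
  have hfa : AnalyticAt ℂ f z := hf.analyticAt hzU
  have hga : AnalyticAt ℂ (fun w => f w - f z) z := hfa.sub analyticAt_const
  have hnc : ¬ ∀ᶠ w in 𝓝 z, f w - f z = 0 := by
    intro h
    have h1 : ∀ᶠ w in 𝓝[≠] z, f w - f z = 0 ∧ w ∈ U :=
      (h.and hzU).filter_mono nhdsWithin_le_nhds
    obtain ⟨w, ⟨hw1, hw2⟩, hw3⟩ := (h1.and self_mem_nhdsWithin).exists
    exact hw3 (hinj hw2 hz (sub_eq_zero.mp hw1))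
  obtain ⟨n, g, hg, hg0, hfg⟩ := hga.exists_eventuallyEq_pow_smul_nonzero_iff.mpr hnc
  have hn0 : n ≠ 0 := by
    rintro rfl
    have := hfg.self_of_nhds
    simp at this
    exact hg0 this.symm
  have hn1 : n ≠ 1 := by
    rintro rfl
    have h1 : HasDerivAt (fun w => (w - z) ^ 1 • g w) (g z) z := by
      have := ((hasDerivAt_id' z).sub_const z).fun_mul hg.differentiableAt.hasDerivAt
      simpa [smul_eq_mul] using this
    have h2 : HasDerivAt (fun w => f w - f z) (g z) z := h1.congr_of_eventuallyEq hfg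
    have h3 := hfa.differentiableAt.hasDerivAt.sub_const (f z)
    exact hg0 (h2.unique h3 ▸ h0)
  have hnC : (n : ℂ) ≠ 0 := by exact_mod_cast hn0
  -- An `n`-th root of `(f - f z) / g z`; the principal logarithm is holomorphic there because `g w
  -- / g z` is near 1.
  set k : ℂ → ℂ := fun w => (w - z) * Complex.exp (Complex.log (g w / g z) / n) with hk
  have hka : AnalyticAt ℂ k z := by
    refine (analyticAt_id.sub analyticAt_const).mul ?_
    refine AnalyticAt.cexp (AnalyticAt.div_const ?_)
    refine (hg.div_const).clog ?_
    simp [hg0]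
  have hkd : HasDerivAt k 1 z := by
    have h1 : DifferentiableAt ℂ (fun w => Complex.exp (Complex.log (g w / g z) / n)) z := by
      refine AnalyticAt.differentiableAt (AnalyticAt.cexp (AnalyticAt.div_const ?_))
      refine (hg.div_const).clog ?_
      simp [hg0]
    have := ((hasDerivAt_id' z).sub_const z).fun_mul h1.hasDerivAt
    simpa [hk, hg0] using this
  have hks : HasStrictDerivAt k 1 z := by
    have := hka.hasStrictDerivAt
    rwa [hkd.deriv] at this
  have hkz : k z = 0 := by simp [hk]
  have hpow : ∀ᶠ w in 𝓝 z, f w - f z = k w ^ n * g z := by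
    have hgn : ∀ᶠ w in 𝓝 z, g w ≠ 0 := hg.continuousAt.eventually_ne hg0
    filter_upwards [hfg, hgn] with w hw hgw
    rw [hw, hk, mul_pow, ← Complex.exp_nat_mul, mul_div_cancel₀ _ hnC,
      Complex.exp_log (div_ne_zero hgw hg0), smul_eq_mul]
    field_simp
  have hn2 : 2 ≤ n := by omega
  set κ := hks.localInverse k 1 z one_ne_zero
  have hr : ∀ᶠ y in 𝓝 0, k (κ y) = y := by
    have := hks.eventually_right_inverse one_ne_zero
    rwa [hkz] at this
  have hκ0 : κ 0 = z := by
    have := (hks.eventually_left_inverse one_ne_zero).self_of_nhds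
    rwa [hkz] at this
  have hκc : ContinuousAt κ 0 := by
    have := (hks.to_localInverse one_ne_zero).hasDerivAt.continuousAt
    rwa [hkz] at this
  have hgood : ∀ᶠ y in 𝓝 0, k (κ y) = y ∧ κ y ∈ U ∧ f (κ y) - f z = y ^ n * g z := by
    have h1 : Tendsto κ (𝓝 0) (𝓝 z) := by have := hκc.tendsto; rwa [hκ0] at this
    filter_upwards [hr, h1 hzU, h1.eventually hpow] with y h1 h2 h3
    exact ⟨h1, h2, by rw [h3, h1]⟩
  -- In the coordinate `k` the function is an `n`-th power, so `y` and `ω * y` are sent to the same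
  -- value, against injectivity once `2 ≤ n`.
  set ω : ℂ := Complex.exp (2 * Real.pi * Complex.I / n)
  have hω : IsPrimitiveRoot ω n := Complex.isPrimitiveRoot_exp n hn0
  have hω1 : ω ≠ 1 := hω.ne_one (by omega)
  have hrot : Tendsto (fun y => ω * y) (𝓝 0) (𝓝 0) := by
    have : Continuous fun y : ℂ => ω * y := by fun_prop
    simpa using this.tendsto 0
  have hall : ∀ᶠ y in 𝓝[≠] (0 : ℂ), (k (κ y) = y ∧ κ y ∈ U ∧ f (κ y) - f z = y ^ n * g z) ∧
      (k (κ (ω * y)) = ω * y ∧ κ (ω * y) ∈ U ∧ f (κ (ω * y)) - f z = (ω * y) ^ n * g z) :=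
    (hgood.and (hrot.eventually hgood)).filter_mono nhdsWithin_le_nhds
  obtain ⟨y, ⟨⟨a1, a2, a3⟩, b1, b2, b3⟩, hy⟩ := (hall.and self_mem_nhdsWithin).exists
  have h4 : f (κ y) = f (κ (ω * y)) := by
    rw [mul_pow, hω.pow_eq_one, one_mul, ← a3] at b3
    exact (sub_left_inj.mp b3).symm
  have h5 := hinj a2 b2 h4
  rw [← h5, a1] at b1
  have hy0 : y ≠ 0 := hy
  exact hω1 (mul_right_cancel₀ hy0 (by rw [one_mul]; exact b1.symm))

/-- A zero-free holomorphic function on the disk has a holomorphic square root. -/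
lemma exists_sq_eq_of_ne_zero {g : ℂ → ℂ} (hg : DifferentiableOn ℂ g (ball 0 1))
    (h0 : ∀ z ∈ ball (0 : ℂ) 1, g z ≠ 0) {c : ℂ} (hc : c ^ 2 = g 0) :
    ∃ h : ℂ → ℂ, DifferentiableOn ℂ h (ball 0 1) ∧ (∀ z ∈ ball (0 : ℂ) 1, h z ^ 2 = g z) ∧
      h 0 = c := by
  have hz0 : (0 : ℂ) ∈ ball (0 : ℂ) 1 := by simp
  have hc0 : c ≠ 0 := by
    rintro rfl
    exact h0 0 hz0 (by rw [← hc]; simp)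
  have hd : DifferentiableOn ℂ (fun z => deriv g z / g z) (ball 0 1) :=
    (hg.deriv isOpen_ball).div hg h0
  obtain ⟨L, hL⟩ := hd.isExactOn_ball
  -- Half of a primitive of `g' / g` is half a logarithm of `g`; the factor `c` makes `M ^ 2 / g`
  -- equal to 1 at the origin, and this quotient is constant.
  set M : ℂ → ℂ := fun z => c * Complex.exp ((L z - L 0) / 2) with hM
  have hMd : ∀ z ∈ ball (0 : ℂ) 1, HasDerivAt M (M z * (deriv g z / g z / 2)) z := by
    intro z hz
    have h1 : HasDerivAt L (deriv g z / g z) z := hL z hz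
    have := (((h1.sub_const (L 0)).div_const 2).cexp).const_mul c
    convert! this using 1
    simp only [hM]; ring
  refine ⟨M, fun z hz => (hMd z hz).differentiableAt.differentiableWithinAt, ?_, by simp [hM]⟩
  have hconst : ∀ z ∈ ball (0 : ℂ) 1, M z ^ 2 / g z = M 0 ^ 2 / g 0 := by
    intro z hz
    refine (convex_ball (0 : ℂ) 1).is_const_of_fderivWithin_eq_zero (𝕜 := ℂ)
      (f := fun z => M z ^ 2 / g z) ?_ ?_ hz hz0
    · intro x hx
      exact (((hMd x hx).differentiableAt.pow 2).div (hg.differentiableAt (isOpen_ball.mem_nhds hx))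
        (h0 x hx)).differentiableWithinAt
    · intro x hx
      rw [fderivWithin_of_isOpen isOpen_ball hx]
      have h1 := ((hMd x hx).pow 2).div
        (hg.differentiableAt (isOpen_ball.mem_nhds hx)).hasDerivAt (h0 x hx)
      have h2 : HasDerivAt (fun z => M z ^ 2 / g z) 0 x := by
        convert! h1 using 1
        have := h0 x hx
        simp only [Pi.pow_apply]
        field_simp
        push_cast
        ring
      rw [h2.hasFDerivAt.fderiv]
      ext
      simp
  intro z hz
  have h1 := hconst z hz
  have h2 : M 0 ^ 2 / g 0 = 1 := by
    simp only [hM, sub_self, zero_div, Complex.exp_zero, mul_one, hc]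
    exact div_self (h0 0 hz0)
  rw [h2, div_eq_one_iff_eq (h0 z hz)] at h1
  exact h1

/-- The automorphism `z ↦ (z + c) / (1 + c̄ z)` of the unit disk. -/
def diskAut (c z : ℂ) : ℂ := (z + c) / (1 + (starRingEnd ℂ) c * z)

lemma diskAut_denom_ne_zero {c z : ℂ} (hc : ‖c‖ < 1) (hz : ‖z‖ < 1) :
    1 + (starRingEnd ℂ) c * z ≠ 0 := by
  intro h
  have h1 : (starRingEnd ℂ) c * z = -1 := by linear_combination h
  have h2 : ‖c‖ * ‖z‖ = 1 := by
    have := congrArg norm h1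
    simpa using this
  nlinarith [norm_nonneg c, norm_nonneg z]

lemma one_sub_norm_sq_diskAut {c z : ℂ} (hc : ‖c‖ < 1) (hz : ‖z‖ < 1) :
    1 - ‖diskAut c z‖ ^ 2 =
      (1 - ‖c‖ ^ 2) * (1 - ‖z‖ ^ 2) / ‖1 + (starRingEnd ℂ) c * z‖ ^ 2 := by
  have h0 := diskAut_denom_ne_zero hc hz
  have h1 : ‖1 + (starRingEnd ℂ) c * z‖ ^ 2 ≠ 0 := by simpa using h0
  rw [diskAut, norm_div, div_pow, eq_div_iff h1, sub_mul, div_mul_cancel₀ _ h1]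
  simp only [← Complex.normSq_eq_norm_sq, Complex.normSq_apply]
  simp
  ring

lemma norm_diskAut_lt {c z : ℂ} (hc : ‖c‖ < 1) (hz : ‖z‖ < 1) : ‖diskAut c z‖ < 1 := by
  have h := one_sub_norm_sq_diskAut hc hz
  have h0 := diskAut_denom_ne_zero hc hz
  have h1 : 0 < (1 - ‖c‖ ^ 2) * (1 - ‖z‖ ^ 2) / ‖1 + (starRingEnd ℂ) c * z‖ ^ 2 := by
    have hp : 0 < ‖1 + (starRingEnd ℂ) c * z‖ := norm_pos_iff.mpr h0
    have a : 0 < 1 - ‖c‖ ^ 2 := by nlinarith [norm_nonneg c]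
    have b : 0 < 1 - ‖z‖ ^ 2 := by nlinarith [norm_nonneg z]
    positivity
  nlinarith [norm_nonneg (diskAut c z)]

lemma mapsTo_diskAut {c : ℂ} (hc : c ∈ ball (0 : ℂ) 1) :
    MapsTo (diskAut c) (ball 0 1) (ball 0 1) := fun z hz => by
  rw [mem_ball_zero_iff] at *
  exact norm_diskAut_lt hc hz

lemma hasDerivAt_diskAut {c z : ℂ} (hc : ‖c‖ < 1) (hz : ‖z‖ < 1) :
    HasDerivAt (diskAut c) (((1 - ‖c‖ ^ 2 : ℝ) : ℂ) / (1 + (starRingEnd ℂ) c * z) ^ 2) z := by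
  have h0 := diskAut_denom_ne_zero hc hz
  have h1 := ((hasDerivAt_id z).add_const c).div
    (((hasDerivAt_id z).const_mul ((starRingEnd ℂ) c)).const_add 1) h0
  refine h1.congr_deriv ?_
  congr 1
  have : ((‖c‖ ^ 2 : ℝ) : ℂ) = c * (starRingEnd ℂ) c := by
    rw [Complex.mul_conj, Complex.normSq_eq_norm_sq]
  push_cast at this ⊢
  rw [this]
  simp
  ring

lemma diskAut_zero (c : ℂ) : diskAut c 0 = c := by simp [diskAut]

lemma diskAut_neg_diskAut {c z : ℂ} (hc : ‖c‖ < 1) (hz : ‖z‖ < 1) :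
    diskAut (-c) (diskAut c z) = z := by
  have h0 := diskAut_denom_ne_zero hc hz
  have h1 := diskAut_denom_ne_zero (c := -c) (by simpa using hc) (norm_diskAut_lt hc hz)
  rw [diskAut, div_eq_iff h1]
  have h2 : diskAut c z * (1 + (starRingEnd ℂ) c * z) = z + c := div_mul_cancel₀ _ h0
  simp only [map_neg]
  linear_combination h2

lemma bijOn_diskAut {c : ℂ} (hc : c ∈ ball (0 : ℂ) 1) :
    BijOn (diskAut c) (ball 0 1) (ball 0 1) := by
  have hc' : ‖c‖ < 1 := by simpa using hc
  refine ⟨mapsTo_diskAut hc, ?_, ?_⟩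
  · intro x hx y hy h
    rw [← diskAut_neg_diskAut hc' (z := x) (by simpa using hx), h,
      diskAut_neg_diskAut hc' (by simpa using hy)]
  · intro y hy
    have hm : -c ∈ ball (0 : ℂ) 1 := by simpa using hc
    refine ⟨diskAut (-c) y, mapsTo_diskAut hm hy, ?_⟩
    have := diskAut_neg_diskAut (c := -c) (z := y) (by simpa using hc) (by simpa using hy)
    simpa using this

/-- The Schwarz–Pick lemma. -/
lemma schwarzPick {φ : ℂ → ℂ} (hφ : DifferentiableOn ℂ φ (ball 0 1))
    (hm : MapsTo φ (ball 0 1) (ball 0 1)) {z : ℂ} (hz : z ∈ ball (0 : ℂ) 1) :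
    ‖deriv φ z‖ * (1 - ‖z‖ ^ 2) ≤ 1 - ‖φ z‖ ^ 2 := by
  have hz' : ‖z‖ < 1 := by simpa using hz
  have hw : ‖φ z‖ < 1 := by simpa using hm hz
  have hw' : -φ z ∈ ball (0 : ℂ) 1 := by simpa using hw
  -- Automorphisms move both `z` and `φ z` to the origin, where the Schwarz lemma applies.
  set ψ : ℂ → ℂ := fun x => diskAut (-φ z) (φ (diskAut z x)) with hψ
  have hmψ : MapsTo ψ (ball 0 1) (ball 0 1) :=
    (mapsTo_diskAut hw').comp (hm.comp (mapsTo_diskAut hz))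
  have hφd : ∀ x ∈ ball (0 : ℂ) 1, HasDerivAt φ (deriv φ x) x := fun x hx =>
    (hφ.differentiableAt (isOpen_ball.mem_nhds hx)).hasDerivAt
  have hψd : ∀ x ∈ ball (0 : ℂ) 1, DifferentiableAt ℂ ψ x := by
    intro x hx
    have hx1 := mapsTo_diskAut hz hx
    have hx2 := hm hx1
    have d1 := (hasDerivAt_diskAut hz' (z := x) (by simpa using hx)).differentiableAt
    have d2 := (hφd _ hx1).differentiableAt
    have d3 := (hasDerivAt_diskAut (c := -φ z) (by simpa using hw)
      (by simpa using hx2)).differentiableAt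
    exact d3.comp x (d2.comp x d1)
  have hψ0 : ψ 0 = 0 := by simp [hψ, diskAut]
  have hle : ‖deriv ψ 0‖ ≤ 1 := by
    refine Complex.norm_deriv_le_one_of_mapsTo_ball
      (fun x hx => (hψd x hx).differentiableWithinAt) ?_ one_pos
    rw [hψ0]
    exact hmψ.mono_right ball_subset_closedBall
  have hd : HasDerivAt ψ (((1 - ‖-φ z‖ ^ 2 : ℝ) : ℂ) / (1 + (starRingEnd ℂ) (-φ z) * φ z) ^ 2 *
      (deriv φ z * (((1 - ‖z‖ ^ 2 : ℝ) : ℂ) / (1 + (starRingEnd ℂ) z * 0) ^ 2))) 0 := by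
    have d1 := hasDerivAt_diskAut hz' (z := 0) (by simp)
    have d2 : HasDerivAt φ (deriv φ z) (diskAut z 0) := by rw [diskAut_zero]; exact hφd z hz
    have d3 : HasDerivAt (diskAut (-φ z))
        (((1 - ‖-φ z‖ ^ 2 : ℝ) : ℂ) / (1 + (starRingEnd ℂ) (-φ z) * φ z) ^ 2)
        (φ (diskAut z 0)) := by
      rw [diskAut_zero]
      exact hasDerivAt_diskAut (by simpa using hw) hw
    exact d3.comp (0 : ℂ) (d2.comp (0 : ℂ) d1)
  rw [hd.deriv] at hle
  have e1 : (1 + (starRingEnd ℂ) (-φ z) * φ z) = ((1 - ‖φ z‖ ^ 2 : ℝ) : ℂ) := by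
    have : ((‖φ z‖ ^ 2 : ℝ) : ℂ) = φ z * (starRingEnd ℂ) (φ z) := by
      rw [Complex.mul_conj, Complex.normSq_eq_norm_sq]
    push_cast at this ⊢
    rw [this]; simp; ring
  have p1 : 0 < 1 - ‖φ z‖ ^ 2 := by nlinarith [norm_nonneg (φ z)]
  have p2 : 0 < 1 - ‖z‖ ^ 2 := by nlinarith [norm_nonneg z]
  rw [e1] at hle
  simp only [mul_zero, add_zero, one_pow, div_one, norm_mul, norm_div, norm_pow, Complex.norm_real,
    Real.norm_eq_abs, norm_neg, abs_of_pos p1, abs_of_pos p2] at hle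
  have : (1 - ‖φ z‖ ^ 2) / (1 - ‖φ z‖ ^ 2) ^ 2 * (‖deriv φ z‖ * (1 - ‖z‖ ^ 2)) =
      ‖deriv φ z‖ * (1 - ‖z‖ ^ 2) / (1 - ‖φ z‖ ^ 2) := by field_simp
  rwa [this, div_le_one p1] at hle

/-- A function subordinate to a univalent function factors through it holomorphically. -/
lemma exists_subordination {F G : ℂ → ℂ} (hF : DifferentiableOn ℂ F (ball 0 1))
    (hG : DifferentiableOn ℂ G (ball 0 1)) (hGi : InjOn G (ball 0 1))
    (hFG : F '' ball 0 1 ⊆ G '' ball 0 1) :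
    ∃ φ : ℂ → ℂ, MapsTo φ (ball 0 1) (ball 0 1) ∧ (∀ x ∈ ball (0 : ℂ) 1, G (φ x) = F x) ∧
      ∀ x ∈ ball (0 : ℂ) 1, HasDerivAt φ ((deriv G (φ x))⁻¹ * deriv F x) x := by
  have hex : ∀ x ∈ ball (0 : ℂ) 1, ∃ y ∈ ball (0 : ℂ) 1, G y = F x :=
    fun x hx => hFG (mem_image_of_mem F hx)
  choose! φ hφm hφ using hex
  refine ⟨φ, hφm, hφ, fun x hx => ?_⟩
  have hy := hφm x hx
  have hGs : HasStrictDerivAt G (deriv G (φ x)) (φ x) :=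
    (hG.analyticAt (isOpen_ball.mem_nhds hy)).hasStrictDerivAt
  have hne := deriv_ne_zero_of_injOn isOpen_ball hG hGi hy
  have hFd : HasDerivAt F (deriv F x) x :=
    (hF.differentiableAt (isOpen_ball.mem_nhds hx)).hasDerivAt
  have hκ := (hGs.to_localInverse hne).hasDerivAt
  have hr := hGs.eventually_right_inverse hne
  have hl := (hGs.eventually_left_inverse hne).self_of_nhds
  set κ := hGs.localInverse G (deriv G (φ x)) (φ x) hne
  rw [hφ x hx] at hκ hr hl
  -- Injectivity of `G` identifies the chosen preimage with the local inverse of `G` near `F x`,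
  -- which is where holomorphy of `φ` comes from.
  refine (hκ.comp x hFd).congr_of_eventuallyEq ?_
  have hκt : Tendsto κ (𝓝 (F x)) (𝓝 (φ x)) := by
    have := hκ.continuousAt.tendsto
    rwa [hl] at this
  have hm : ∀ᶠ u in 𝓝 (F x), κ u ∈ ball (0 : ℂ) 1 := hκt (isOpen_ball.mem_nhds hy)
  filter_upwards [isOpen_ball.mem_nhds hx, hFd.continuousAt.tendsto.eventually hr,
    hFd.continuousAt.tendsto.eventually hm] with u h1 h2 h3
  exact hGi (hφm u h1) h3 (by rw [hφ u h1, Function.comp_apply, h2])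

/-- A holomorphic function subordinate to a univalent one has the smaller hyperbolic
derivative. -/
lemma subordination {F G : ℂ → ℂ} (hF : DifferentiableOn ℂ F (ball 0 1))
    (hG : DifferentiableOn ℂ G (ball 0 1)) (hGi : InjOn G (ball 0 1))
    (hFG : F '' ball 0 1 ⊆ G '' ball 0 1) {z w : ℂ} (hz : z ∈ ball (0 : ℂ) 1)
    (hw : w ∈ ball (0 : ℂ) 1) (hzw : F z = G w) :
    ‖deriv F z‖ * (1 - ‖z‖ ^ 2) ≤ ‖deriv G w‖ * (1 - ‖w‖ ^ 2) := by
  obtain ⟨φ, hφm, hφ, hφd⟩ := exists_subordination hF hG hGi hFG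
  have hφz : φ z = w := hGi (hφm hz) hw (by rw [hφ z hz, hzw])
  have h1 := schwarzPick (fun x hx => (hφd x hx).differentiableAt.differentiableWithinAt) hφm hz
  have hne := deriv_ne_zero_of_injOn isOpen_ball hG hGi hw
  rw [(hφd z hz).deriv, hφz, norm_mul, norm_inv] at h1
  have hp : 0 < ‖deriv G w‖ := norm_pos_iff.mpr hne
  calc ‖deriv F z‖ * (1 - ‖z‖ ^ 2)
      = ‖deriv G w‖ * (‖deriv G w‖⁻¹ * ‖deriv F z‖ * (1 - ‖z‖ ^ 2)) := by field_simp
    _ ≤ _ := by gcongr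

/-! ### Homogeneous coordinates on the sphere -/

open Classical in
/-- The point `[x : y]` of the Riemann sphere. -/
def proj (x y : ℂ) : OnePoint ℂ := if y = 0 then OnePoint.infty else ((x / y : ℂ) : OnePoint ℂ)

lemma proj_of_ne {x y : ℂ} (hy : y ≠ 0) : proj x y = ((x / y : ℂ) : OnePoint ℂ) := by
  simp [proj, hy]

lemma proj_zero (x : ℂ) : proj x 0 = OnePoint.infty := by simp [proj]

lemma proj_one (x : ℂ) : proj x 1 = (x : OnePoint ℂ) := by simp [proj]

lemma proj_eq_infty_iff {x y : ℂ} : proj x y = OnePoint.infty ↔ y = 0 := by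
  by_cases h : y = 0 <;> simp [proj, h]

lemma affineCoord_coe (z : ℂ) : affineCoord (z : OnePoint ℂ) = z := rfl

lemma affineCoord_infty : affineCoord OnePoint.infty = 0 := rfl

lemma affineCoord_proj (x y : ℂ) : affineCoord (proj x y) = x / y := by
  by_cases h : y = 0
  · simp [h, proj_zero, affineCoord_infty]
  · rw [proj_of_ne h, affineCoord_coe]

lemma sphereInv_infty : sphereInv OnePoint.infty = ((0 : ℂ) : OnePoint ℂ) := rfl

lemma sphereInv_zero : sphereInv ((0 : ℂ) : OnePoint ℂ) = OnePoint.infty := by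
  simp [sphereInv]

lemma sphereInv_coe {z : ℂ} (hz : z ≠ 0) :
    sphereInv (z : OnePoint ℂ) = ((z⁻¹ : ℂ) : OnePoint ℂ) := by
  simp [sphereInv, hz]

lemma sphereInv_proj {x y : ℂ} (h : x ≠ 0 ∨ y ≠ 0) : sphereInv (proj x y) = proj y x := by
  by_cases hy : y = 0
  · have hx : x ≠ 0 := by tauto
    rw [hy, proj_zero, sphereInv_infty, proj_of_ne hx, zero_div]
  · rw [proj_of_ne hy]
    by_cases hx : x = 0
    · rw [hx, zero_div, sphereInv_zero, proj_zero]
    · rw [sphereInv_coe (div_ne_zero hx hy), proj_of_ne hx, inv_div]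

lemma sphereInv_sphereInv (p : OnePoint ℂ) : sphereInv (sphereInv p) = p := by
  induction p using OnePoint.rec with
  | infty => rw [sphereInv_infty, sphereInv_zero]
  | coe z =>
    by_cases hz : z = 0
    · rw [hz, sphereInv_zero, sphereInv_infty]
    · rw [sphereInv_coe hz, sphereInv_coe (inv_ne_zero hz), inv_inv]

lemma continuousAt_sphereInv_coe {z : ℂ} (hz : z ≠ 0) :
    ContinuousAt sphereInv (z : OnePoint ℂ) := by
  rw [OnePoint.continuousAt_coe]
  have h1 : ContinuousAt (fun w : ℂ => ((w⁻¹ : ℂ) : OnePoint ℂ)) z :=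
    OnePoint.continuous_coe.continuousAt.comp (continuousAt_inv₀ hz)
  refine h1.congr ?_
  filter_upwards [isOpen_ne.mem_nhds hz] with w hw
  exact (sphereInv_coe hw).symm

lemma continuous_sphereInv : Continuous sphereInv := by
  rw [continuous_iff_continuousAt]
  intro p
  induction p using OnePoint.rec with
  | infty =>
    rw [OnePoint.continuousAt_infty', sphereInv_infty, Filter.coclosedCompact_eq_cocompact,
      ← Metric.cobounded_eq_cocompact]
    have h1 : Tendsto (fun w : ℂ => ((w⁻¹ : ℂ) : OnePoint ℂ)) (Bornology.cobounded ℂ)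
        (𝓝 ((0 : ℂ) : OnePoint ℂ)) :=
      (OnePoint.continuous_coe.tendsto 0).comp tendsto_inv₀_cobounded
    refine h1.congr' ?_
    have : ∀ᶠ w : ℂ in Bornology.cobounded ℂ, w ≠ 0 := by
      exact Bornology.eventually_ne_cobounded 0
    filter_upwards [this] with w hw
    exact (sphereInv_coe hw).symm
  | coe z =>
    by_cases hz : z = 0
    · subst hz
      rw [OnePoint.continuousAt_coe]
      unfold ContinuousAt
      rw [Function.comp_apply, sphereInv_zero, ← nhdsNE_sup_pure, tendsto_sup]
      constructor
      · have h1 : Tendsto (fun w : ℂ => ((w⁻¹ : ℂ) : OnePoint ℂ)) (𝓝[≠] (0 : ℂ))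
            (𝓝 OnePoint.infty) := by
          have h2 : Tendsto ((↑) : ℂ → OnePoint ℂ) (Bornology.cobounded ℂ)
              (𝓝 OnePoint.infty) := by
            have := OnePoint.tendsto_coe_infty (X := ℂ)
            rw [Filter.coclosedCompact_eq_cocompact, ← Metric.cobounded_eq_cocompact] at this
            exact this
          exact h2.comp tendsto_inv₀_nhdsNE_zero
        refine h1.congr' ?_
        filter_upwards [self_mem_nhdsWithin] with w hw
        exact (sphereInv_coe hw).symm
      · rw [tendsto_pure_left]
        intro s hs
        simpa [sphereInv_zero] using mem_of_mem_nhds hs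
    · exact continuousAt_sphereInv_coe hz

lemma continuousAt_proj {x : ℂ × ℂ} (hx : x.1 ≠ 0 ∨ x.2 ≠ 0) :
    ContinuousAt (fun q : ℂ × ℂ => proj q.1 q.2) x := by
  have key : ∀ x : ℂ × ℂ, x.2 ≠ 0 → ContinuousAt (fun q : ℂ × ℂ => proj q.1 q.2) x := by
    intro x hx
    have h1 : ContinuousAt (fun q : ℂ × ℂ => ((q.1 / q.2 : ℂ) : OnePoint ℂ)) x :=
      OnePoint.continuous_coe.continuousAt.comp (continuousAt_fst.div continuousAt_snd hx)
    refine h1.congr ?_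
    filter_upwards [continuousAt_snd.eventually_ne hx] with q hq
    exact (proj_of_ne hq).symm
  by_cases h2 : x.2 = 0
  · have h1 : x.1 ≠ 0 := by tauto
    have h3 := continuous_sphereInv.continuousAt.comp
      ((key x.swap h1).comp (continuous_swap.continuousAt (x := x)))
    refine h3.congr ?_
    filter_upwards [continuousAt_fst.eventually_ne h1] with q hq
    simp only [Function.comp_apply, Prod.fst_swap, Prod.snd_swap]
    exact sphereInv_proj (Or.inr hq)
  · exact key x h2

/-! ### Holomorphic lifts -/

/-- A pair of holomorphic functions on the disk with Wronskian `1`. -/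
structure IsUnimodular (a b : ℂ → ℂ) : Prop where
  left : DifferentiableOn ℂ a (ball 0 1)
  right : DifferentiableOn ℂ b (ball 0 1)
  wronskian : ∀ z ∈ ball (0 : ℂ) 1, deriv a z * b z - a z * deriv b z = 1

/-- The coefficient `λ` of the equation `y'' = λ y` solved by `a` and `b`. -/
def potential (a b : ℂ → ℂ) (z : ℂ) : ℂ :=
  deriv (deriv b) z * deriv a z - deriv (deriv a) z * deriv b z

/-- `(a, b)` is a lift of the sphere-valued map `f`, with Wronskian `1`. -/
structure IsLift (f : ℂ → OnePoint ℂ) (a b : ℂ → ℂ) : Prop extends IsUnimodular a b where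
  eq_proj : ∀ z ∈ ball (0 : ℂ) 1, f z = proj (a z) (b z)

namespace IsUnimodular

variable {a b : ℂ → ℂ} {z : ℂ}

lemma hasDerivAt_left (h : IsUnimodular a b) (hz : z ∈ ball (0 : ℂ) 1) :
    HasDerivAt a (deriv a z) z :=
  (h.left.differentiableAt (isOpen_ball.mem_nhds hz)).hasDerivAt

lemma hasDerivAt_right (h : IsUnimodular a b) (hz : z ∈ ball (0 : ℂ) 1) :
    HasDerivAt b (deriv b z) z :=
  (h.right.differentiableAt (isOpen_ball.mem_nhds hz)).hasDerivAt

/-- Differentiate the constant Wronskian: the products of first derivatives cancel. This relation is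
what makes `a` and `b` solve one common equation `y'' = λ y`. -/
lemma deriv_wronskian (h : IsUnimodular a b) (hz : z ∈ ball (0 : ℂ) 1) :
    deriv (deriv a) z * b z = a z * deriv (deriv b) z := by
  have ha := ((h.left.deriv isOpen_ball).differentiableAt (isOpen_ball.mem_nhds hz)).hasDerivAt
  have hb := ((h.right.deriv isOpen_ball).differentiableAt (isOpen_ball.mem_nhds hz)).hasDerivAt
  have h1 := (ha.mul (h.hasDerivAt_right hz)).sub ((h.hasDerivAt_left hz).mul hb)
  have h2 : deriv a * b - a * deriv b =ᶠ[𝓝 z] fun _ => (1 : ℂ) := by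
    filter_upwards [isOpen_ball.mem_nhds hz] with w hw
    exact h.wronskian w hw
  have h3 := (h1.congr_of_eventuallyEq h2.symm).unique (hasDerivAt_const z (1 : ℂ))
  linear_combination h3

lemma hasDerivAt_deriv_left (h : IsUnimodular a b) (hz : z ∈ ball (0 : ℂ) 1) :
    HasDerivAt (deriv a) (potential a b z * a z) z := by
  have ha := ((h.left.deriv isOpen_ball).differentiableAt (isOpen_ball.mem_nhds hz)).hasDerivAt
  refine ha.congr_deriv ?_
  have h1 := h.wronskian z hz
  have h2 := h.deriv_wronskian hz
  unfold potential
  linear_combination -(deriv (deriv a) z) * h1 + deriv a z * h2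

lemma hasDerivAt_deriv_right (h : IsUnimodular a b) (hz : z ∈ ball (0 : ℂ) 1) :
    HasDerivAt (deriv b) (potential a b z * b z) z := by
  have hb := ((h.right.deriv isOpen_ball).differentiableAt (isOpen_ball.mem_nhds hz)).hasDerivAt
  refine hb.congr_deriv ?_
  have h1 := h.wronskian z hz
  have h2 := h.deriv_wronskian hz
  unfold potential
  linear_combination -(deriv (deriv b) z) * h1 + deriv b z * h2

lemma differentiableOn_potential (h : IsUnimodular a b) :
    DifferentiableOn ℂ (potential a b) (ball 0 1) :=
  (((h.right.deriv isOpen_ball).deriv isOpen_ball).mul (h.left.deriv isOpen_ball)).sub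
    (((h.left.deriv isOpen_ball).deriv isOpen_ball).mul (h.right.deriv isOpen_ball))

lemma ne_zero (h : IsUnimodular a b) (hz : z ∈ ball (0 : ℂ) 1) : a z ≠ 0 ∨ b z ≠ 0 := by
  by_contra! hc
  have := h.wronskian z hz
  simp [hc.1, hc.2] at this

/-- The pair `(p a + q b, r a + s b)` for a matrix of determinant `1`. -/
lemma linear (h : IsUnimodular a b) {p q r s : ℂ} (hdet : p * s - q * r = 1) :
    IsUnimodular (fun z => p * a z + q * b z) (fun z => r * a z + s * b z) where
  left := (h.left.const_mul p).add (h.right.const_mul q)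
  right := (h.left.const_mul r).add (h.right.const_mul s)
  wronskian z hz := by
    have h1 := ((h.hasDerivAt_left hz).const_mul p).add ((h.hasDerivAt_right hz).const_mul q)
    have h2 := ((h.hasDerivAt_left hz).const_mul r).add ((h.hasDerivAt_right hz).const_mul s)
    have e1 : deriv (fun z => p * a z + q * b z) z = p * deriv a z + q * deriv b z := h1.deriv
    have e2 : deriv (fun z => r * a z + s * b z) z = r * deriv a z + s * deriv b z := h2.deriv
    rw [e1, e2]
    linear_combination (deriv a z * b z - a z * deriv b z) * hdet + h.wronskian z hz

lemma hasDerivAt_div (h : IsUnimodular a b) (hz : z ∈ ball (0 : ℂ) 1) (hb : b z ≠ 0) :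
    HasDerivAt (fun w => a w / b w) (1 / b z ^ 2) z := by
  refine ((h.hasDerivAt_left hz).fun_div (h.hasDerivAt_right hz) hb).congr_deriv ?_
  rw [h.wronskian z hz]

/-- The quotient has derivative `1 / b²`, so `h'' / h'` is `-2 b' / b`; in the Schwarzian the
squares of `b' / b` cancel and `b'' / b` is the potential. -/
lemma schwarzian_div (h : IsUnimodular a b) (hz : z ∈ ball (0 : ℂ) 1) (hb : b z ≠ 0) :
    schwarzian (fun w => a w / b w) z = -2 * potential a b z := by
  have hbn : ∀ᶠ w in 𝓝 z, b w ≠ 0 := (h.hasDerivAt_right hz).continuousAt.eventually_ne hb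
  have hn : ∀ᶠ w in 𝓝 z, w ∈ ball (0 : ℂ) 1 ∧ b w ≠ 0 :=
    (isOpen_ball.eventually_mem hz).and hbn
  have h1 : deriv (fun w => a w / b w) =ᶠ[𝓝 z] fun w => 1 / b w ^ 2 := by
    filter_upwards [hn] with w hw
    exact (h.hasDerivAt_div hw.1 hw.2).deriv
  have h2 : deriv (deriv fun w => a w / b w) =ᶠ[𝓝 z] fun w => -2 * deriv b w / b w ^ 3 := by
    filter_upwards [h1.eventuallyEq_nhds, hn] with w hw hw'
    rw [hw.deriv_eq]
    refine (((hasDerivAt_const w (1 : ℂ)).fun_div ((h.hasDerivAt_right hw'.1).fun_pow 2)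
      (pow_ne_zero 2 hw'.2)).congr_deriv ?_).deriv
    have := hw'.2
    field_simp
    push_cast
    ring
  have h3 : (fun w => deriv (deriv fun w => a w / b w) w / deriv (fun w => a w / b w) w)
      =ᶠ[𝓝 z] fun w => -2 * (deriv b w / b w) := by
    filter_upwards [h1, h2, hn] with w w1 w2 w3
    rw [w1, w2]
    have := w3.2
    field_simp
  have h4 : HasDerivAt (fun w => -2 * (deriv b w / b w))
      (-2 * ((potential a b z * b z * b z - deriv b z * deriv b z) / b z ^ 2)) z :=
    ((h.hasDerivAt_deriv_right hz).fun_div (h.hasDerivAt_right hz) hb).const_mul (-2)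
  have h5 := h3.self_of_nhds
  simp only at h5
  rw [schwarzian, h3.deriv_eq, h4.deriv, h5]
  field_simp
  ring

end IsUnimodular

namespace IsLift

variable {f : ℂ → OnePoint ℂ} {a b : ℂ → ℂ} {z : ℂ}

/-- Exchanging the components changes the sign of the Wronskian; the factor `I` on both restores it.
The zero terms keep the shape of `linear`. -/
lemma swap (h : IsLift f a b) : IsLift (fun z => sphereInv (f z))
    (fun z => 0 * a z + Complex.I * b z) (fun z => Complex.I * a z + 0 * b z) where
  toIsUnimodular := h.toIsUnimodular.linear (by simp)
  eq_proj z hz := by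
    rw [h.eq_proj z hz, sphereInv_proj (h.ne_zero hz), zero_mul, zero_add, zero_mul, add_zero]
    by_cases ha : a z = 0
    · simp [ha, proj_zero]
    · rw [proj_of_ne ha, proj_of_ne (mul_ne_zero Complex.I_ne_zero ha),
        mul_div_mul_left _ _ Complex.I_ne_zero]

lemma apply_eq_infty_iff (h : IsLift f a b) (hz : z ∈ ball (0 : ℂ) 1) :
    f z = OnePoint.infty ↔ b z = 0 := by
  rw [h.eq_proj z hz, proj_eq_infty_iff]

lemma localCoord_eq_div (h : IsLift f a b) (hz : z ∈ ball (0 : ℂ) 1) (hb : b z ≠ 0) :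
    localCoord f z =ᶠ[𝓝 z] fun w => a w / b w := by
  rw [localCoord, if_neg (by rwa [h.apply_eq_infty_iff hz])]
  filter_upwards [isOpen_ball.mem_nhds hz] with w hw
  rw [h.eq_proj w hw, affineCoord_proj]

lemma localCoord_eq_div' (h : IsLift f a b) (hz : z ∈ ball (0 : ℂ) 1) (hb : b z = 0) :
    localCoord f z =ᶠ[𝓝 z] fun w => b w / a w := by
  rw [localCoord, if_pos (by rwa [h.apply_eq_infty_iff hz])]
  filter_upwards [isOpen_ball.mem_nhds hz] with w hw
  rw [h.eq_proj w hw, sphereInv_proj (h.ne_zero hw), affineCoord_proj]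

/-- In both charts the Schwarzian is `-2 λ`: at a pole the swapped lift represents `1/f`, and it
solves the same second-order equation, hence has the same potential. -/
lemma schwarzianSize_eq (h : IsLift f a b) (hz : z ∈ ball (0 : ℂ) 1) :
    schwarzianSize f z = ‖potential a b z‖ * (1 - ‖z‖ ^ 2) ^ 2 / 2 := by
  have key : schwarzian (localCoord f z) z = -2 * potential a b z := by
    have hcongr : ∀ {g k : ℂ → ℂ}, g =ᶠ[𝓝 z] k → schwarzian g z = schwarzian k z := by
      intro g k hgk
      have h1 := hgk.deriv
      have h2 := h1.deriv
      have h3 : (fun w => deriv (deriv g) w / deriv g w) =ᶠ[𝓝 z]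
          fun w => deriv (deriv k) w / deriv k w := h2.div h1
      rw [schwarzian, schwarzian, h3.deriv_eq, h2.self_of_nhds, h1.self_of_nhds]
    by_cases hb : b z = 0
    · have ha : a z ≠ 0 := (h.ne_zero hz).resolve_right (by simpa using hb)
      have h2 : localCoord f z =ᶠ[𝓝 z] fun w =>
          (0 * a w + Complex.I * b w) / (Complex.I * a w + 0 * b w) := by
        filter_upwards [h.localCoord_eq_div' hz hb] with w hw
        rw [hw, zero_mul, zero_add, zero_mul, add_zero, mul_div_mul_left _ _ Complex.I_ne_zero]
      have hs := h.toIsUnimodular.linear (p := 0) (q := Complex.I) (r := Complex.I) (s := 0)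
        (by simp)
      rw [hcongr h2, hs.schwarzian_div hz (by simpa [Complex.I_ne_zero] using ha)]
      congr 1
      have h3 := hs.hasDerivAt_deriv_right hz
      have e1 : deriv (fun z => Complex.I * a z + 0 * b z) = fun z => Complex.I * deriv a z := by
        ext w; simp
      rw [e1] at h3
      have h4 := h3.unique ((h.hasDerivAt_deriv_left hz).const_mul Complex.I)
      have hI := Complex.I_ne_zero
      have h5 : Complex.I * a z * (potential (fun z => 0 * a z + Complex.I * b z)
          (fun z => Complex.I * a z + 0 * b z) z - potential a b z) = 0 := by
        linear_combination h4
      exact sub_eq_zero.mp ((mul_eq_zero.mp h5).resolve_left (mul_ne_zero hI ha))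
    · rw [hcongr (h.localCoord_eq_div hz hb), h.schwarzian_div hz hb]
  rw [schwarzianSize, key, diskDensity, norm_mul, div_div_eq_mul_div]
  norm_num
  ring

end IsLift

/-- An omitted point gives a lift without common zeros of the linear form vanishing there. -/
lemma IsConformalOnto.exists_lift {f : ℂ → OnePoint ℂ} {Ω : Set (OnePoint ℂ)}
    (hf : IsConformalOnto f Ω) {p : OnePoint ℂ} (hp : p ∉ Ω) : ∃ a b, IsLift f a b := by
  have hmem : ∀ z ∈ ball (0 : ℂ) 1, f z ≠ p := fun z hz h => hp (h ▸ hf.bijOn.mapsTo hz)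
  -- For a finite univalent `F`, take `β` a square root of `1 / F'` and `α = F β`; the Wronskian is
  -- then `F' β² = 1`.
  have lift_of : ∀ F : ℂ → ℂ, DifferentiableOn ℂ F (ball 0 1) → InjOn F (ball 0 1) →
      ∃ α β : ℂ → ℂ, IsUnimodular α β ∧ ∀ z ∈ ball (0 : ℂ) 1, β z ≠ 0 ∧ α z = F z * β z := by
    intro F hF hFi
    have hne : ∀ z ∈ ball (0 : ℂ) 1, deriv F z ≠ 0 := fun z hz =>
      deriv_ne_zero_of_injOn isOpen_ball hF hFi hz
    obtain ⟨c, hc⟩ := IsAlgClosed.exists_pow_nat_eq ((deriv F 0)⁻¹) two_pos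
    obtain ⟨β, hβ, hβ2, -⟩ := exists_sq_eq_of_ne_zero (g := fun z => (deriv F z)⁻¹)
      ((hF.deriv isOpen_ball).inv hne) (fun z hz => inv_ne_zero (hne z hz)) hc
    have hβ0 : ∀ z ∈ ball (0 : ℂ) 1, β z ≠ 0 := by
      intro z hz h0
      have := hβ2 z hz
      rw [h0] at this
      simp only [ne_eq, OfNat.ofNat_ne_zero, not_false_eq_true, zero_pow] at this
      exact inv_ne_zero (hne z hz) this.symm
    refine ⟨fun z => F z * β z, β, ⟨hF.mul hβ, hβ, ?_⟩, fun z hz => ⟨hβ0 z hz, rfl⟩⟩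
    intro z hz
    have h1 := (hF.differentiableAt (isOpen_ball.mem_nhds hz)).hasDerivAt
    have h2 := (hβ.differentiableAt (isOpen_ball.mem_nhds hz)).hasDerivAt
    have e1 : deriv (fun z => F z * β z) z = _ := (h1.fun_mul h2).deriv
    rw [e1]
    have h3 : deriv F z * β z ^ 2 = 1 := by rw [hβ2 z hz]; exact mul_inv_cancel₀ (hne z hz)
    linear_combination h3
  induction p using OnePoint.rec with
  | infty =>
    have hcoe : ∀ z ∈ ball (0 : ℂ) 1, ((affineCoord (f z) : ℂ) : OnePoint ℂ) = f z := by
      intro z hz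
      obtain ⟨y, hy⟩ := OnePoint.ne_infty_iff_exists.mp (hmem z hz)
      rw [← hy, affineCoord_coe]
    obtain ⟨α, β, hu, hαβ⟩ := lift_of (fun z => affineCoord (f z)) (fun z hz => by
        have := hf.differentiableAt z hz
        rw [localCoord, if_neg (hmem z hz)] at this
        exact this.differentiableWithinAt) (fun x hx y hy hxy => by
        refine hf.bijOn.injOn hx hy ?_
        rw [← hcoe x hx, ← hcoe y hy]
        exact congrArg _ hxy)
    refine ⟨α, β, hu, fun z hz => ?_⟩
    rw [proj_of_ne (hαβ z hz).1, (hαβ z hz).2, mul_div_cancel_right₀ _ (hαβ z hz).1, hcoe z hz]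
  | coe p =>
    -- The Möbius map `1 / (q - p)` sends the omitted point to infinity, so `m ∘ f` is finite. The
    -- value 0 at infinity is the true one, not a dummy.
    set m : OnePoint ℂ → ℂ := fun q => OnePoint.elim q 0 (fun z => (z - p)⁻¹) with hm
    have hproj : ∀ q : OnePoint ℂ, q ≠ p → q = proj (p * m q + 1) (m q) := by
      intro q hq
      induction q using OnePoint.rec with
      | infty => simp [hm, proj_zero]
      | coe y =>
        have hy : y - p ≠ 0 := sub_ne_zero.mpr (fun h => hq (by rw [h]))
        have : m y = (y - p)⁻¹ := rfl
        rw [this, proj_of_ne (inv_ne_zero hy)]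
        congr 1
        field_simp
        ring
    obtain ⟨α, β, hu, hαβ⟩ := lift_of (fun z => m (f z)) (fun z hz => by
        have hd := hf.differentiableAt z hz
        by_cases hi : f z = OnePoint.infty
        · rw [localCoord, if_pos hi] at hd
          have hk0 : affineCoord (sphereInv (f z)) = 0 := by rw [hi]; rfl
          have hne0 : ∀ᶠ w in 𝓝 z, f w ≠ ((0 : ℂ) : OnePoint ℂ) :=
            (hf.continuousAt z hz).eventually_ne (by rw [hi]; exact OnePoint.infty_ne_coe 0)
          have h1 : DifferentiableAt ℂ (fun w => affineCoord (sphereInv (f w)) /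
              (1 - p * affineCoord (sphereInv (f w)))) z := by
            refine hd.div ((hd.const_mul p).const_sub 1) ?_
            rw [hk0]; simp
          refine (h1.congr_of_eventuallyEq ?_).differentiableWithinAt
          filter_upwards [hne0, isOpen_ball.mem_nhds hz] with w hw hwb
          have hwp := hmem w hwb
          generalize f w = q at hw hwp
          induction q using OnePoint.rec with
          | infty => simp [hm, sphereInv_infty, affineCoord_coe]
          | coe y =>
            have hy : y ≠ 0 := fun h => hw (by rw [h])
            have hyp : y - p ≠ 0 := sub_ne_zero.mpr (fun h => hwp (by rw [h]))
            rw [sphereInv_coe hy, affineCoord_coe]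
            have : m y = (y - p)⁻¹ := rfl
            have h3 : 1 - p * y⁻¹ = (y - p) / y := by field_simp
            rw [this, h3]
            field_simp
        · rw [localCoord, if_neg hi] at hd
          have hni : ∀ᶠ w in 𝓝 z, f w ≠ OnePoint.infty :=
            (hf.continuousAt z hz).eventually_ne hi
          have hpz : affineCoord (f z) - p ≠ 0 := by
            obtain ⟨y, hy⟩ := OnePoint.ne_infty_iff_exists.mp hi
            have := hmem z hz
            rw [← hy] at this ⊢
            exact sub_ne_zero.mpr (fun h => this (by rw [affineCoord_coe] at h; rw [h]))
          have h1 : DifferentiableAt ℂ (fun w => (affineCoord (f w) - p)⁻¹) z :=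
            (hd.sub_const p).inv hpz
          refine (h1.congr_of_eventuallyEq ?_).differentiableWithinAt
          filter_upwards [hni] with w hw
          obtain ⟨y, hy⟩ := OnePoint.ne_infty_iff_exists.mp hw
          rw [← hy]
          rfl) (fun x hx y hy hxy => by
        refine hf.bijOn.injOn hx hy ?_
        rw [hproj _ (hmem x hx), hproj _ (hmem y hy)]
        simp only at hxy
        rw [hxy])
    -- This matrix undoes `m`, since `q = (p m + 1) / m`; the factor `I` gives it determinant 1.
    refine ⟨_, _, hu.linear (p := Complex.I * p) (q := Complex.I) (r := Complex.I) (s := 0) ?_,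
      fun z hz => ?_⟩
    · linear_combination -Complex.I_sq
    · conv_lhs => rw [hproj _ (hmem z hz)]
      rw [(hαβ z hz).2]
      have hβ := (hαβ z hz).1
      by_cases hF : m (f z) = 0
      · simp [hF, proj_zero]
      · have hI := Complex.I_ne_zero
        rw [proj_of_ne hF, proj_of_ne (by simp [hF, hβ])]
        congr 1
        field_simp
        ring

lemma proj_eq_proj_iff {x y x' y' : ℂ} (h : x ≠ 0 ∨ y ≠ 0) (h' : x' ≠ 0 ∨ y' ≠ 0) :
    proj x y = proj x' y' ↔ x * y' = x' * y := by
  by_cases hy : y = 0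
  · have hx : x ≠ 0 := by tauto
    subst hy
    rw [proj_zero, eq_comm, proj_eq_infty_iff]
    simp [hx]
  · by_cases hy' : y' = 0
    · have hx' : x' ≠ 0 := by tauto
      subst hy'
      rw [proj_zero, proj_eq_infty_iff]
      simp [hx', hy]
    · rw [proj_of_ne hy, proj_of_ne hy', OnePoint.coe_eq_coe, div_eq_div_iff hy hy']

lemma IsLift.isConformalOnto {f : ℂ → OnePoint ℂ} {a b : ℂ → ℂ} {Ω : Set (OnePoint ℂ)}
    (h : IsLift f a b) (hb : BijOn f (ball 0 1) Ω) : IsConformalOnto f Ω where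
  bijOn := hb
  continuousAt z hz := by
    have h1 : ContinuousAt (fun w => proj (a w) (b w)) z :=
      ContinuousAt.comp (g := fun q : ℂ × ℂ => proj q.1 q.2) (f := fun w => (a w, b w))
        (continuousAt_proj (h.ne_zero hz))
        ((h.hasDerivAt_left hz).continuousAt.prodMk (h.hasDerivAt_right hz).continuousAt)
    refine h1.congr ?_
    filter_upwards [isOpen_ball.mem_nhds hz] with w hw
    exact (h.eq_proj w hw).symm
  differentiableAt z hz := by
    have da := (h.hasDerivAt_left hz).differentiableAt
    have db := (h.hasDerivAt_right hz).differentiableAt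
    by_cases hb : b z = 0
    · have ha : a z ≠ 0 := (h.ne_zero hz).resolve_right (by simpa using hb)
      exact (db.div da ha).congr_of_eventuallyEq (h.localCoord_eq_div' hz hb)
    · exact (da.div db hb).congr_of_eventuallyEq (h.localCoord_eq_div hz hb)

/-- The inversion of the sphere is an involution on conformal parametrizations. -/
lemma IsConformalOnto.sphereInv {f : ℂ → OnePoint ℂ} {a b : ℂ → ℂ} {Ω : Set (OnePoint ℂ)}
    (hf : IsConformalOnto f Ω) (h : IsLift f a b) :
    IsConformalOnto (fun z => sphereInv (f z)) (EpsteinPoincare.sphereInv ⁻¹' Ω) := by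
  refine h.swap.isConformalOnto ⟨?_, ?_, ?_⟩
  · intro z hz
    rw [mem_preimage, sphereInv_sphereInv]
    exact hf.bijOn.mapsTo hz
  · intro x hx y hy hxy
    refine hf.bijOn.injOn hx hy ?_
    rw [← sphereInv_sphereInv (f x), ← sphereInv_sphereInv (f y)]
    exact congrArg _ hxy
  · intro p hp
    obtain ⟨z, hz, hzp⟩ := hf.bijOn.surjOn hp
    exact ⟨z, hz, by simp only [hzp, sphereInv_sphereInv]⟩

/-! ### Precomposition with an automorphism of the disk -/

/-- The lift of `f ∘ diskAut c` induced by a lift component of `f`. -/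
def autLift (c : ℂ) (a : ℂ → ℂ) (z : ℂ) : ℂ :=
  (1 + (starRingEnd ℂ) c * z) / (√(1 - ‖c‖ ^ 2) : ℝ) * a (diskAut c z)

lemma one_sub_norm_sq_pos {z : ℂ} (hz : z ∈ ball (0 : ℂ) 1) : 0 < 1 - ‖z‖ ^ 2 := by
  have : ‖z‖ < 1 := by simpa using hz
  nlinarith [norm_nonneg z]

lemma sqrt_sq_ofReal {r : ℝ} (hr : 0 < r) : ((√r : ℝ) : ℂ) ^ 2 = (r : ℂ) := by
  rw [← Complex.ofReal_pow, Real.sq_sqrt hr.le]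

lemma hasDerivAt_autLift {c z d : ℂ} {a : ℂ → ℂ} (hc : c ∈ ball (0 : ℂ) 1)
    (hz : z ∈ ball (0 : ℂ) 1) (ha : HasDerivAt a d (diskAut c z)) :
    HasDerivAt (autLift c a) ((starRingEnd ℂ) c / (√(1 - ‖c‖ ^ 2) : ℝ) * a (diskAut c z) +
      (√(1 - ‖c‖ ^ 2) : ℝ) / (1 + (starRingEnd ℂ) c * z) * d) z := by
  have hc' : ‖c‖ < 1 := by simpa using hc
  have hz' : ‖z‖ < 1 := by simpa using hz
  have h0 := diskAut_denom_ne_zero hc' hz'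
  have hs := sqrt_sq_ofReal (one_sub_norm_sq_pos hc)
  have hs0 : ((√(1 - ‖c‖ ^ 2) : ℝ) : ℂ) ≠ 0 := by
    have := Real.sqrt_pos.mpr (one_sub_norm_sq_pos hc)
    exact_mod_cast this.ne'
  have h1 := ((((hasDerivAt_id' z).const_mul ((starRingEnd ℂ) c)).const_add 1).div_const
    ((√(1 - ‖c‖ ^ 2) : ℝ) : ℂ)).fun_mul (ha.comp z (hasDerivAt_diskAut hc' hz'))
  refine h1.congr_deriv ?_
  rw [← hs, Function.comp_apply]
  field_simp

/-- The factor in `autLift` is the inverse square root of the derivative of `diskAut c`, which keeps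
the Wronskian equal to 1. -/
lemma IsUnimodular.autLift {a b : ℂ → ℂ} {c : ℂ} (h : IsUnimodular a b)
    (hc : c ∈ ball (0 : ℂ) 1) : IsUnimodular (autLift c a) (autLift c b) where
  left z hz := (hasDerivAt_autLift hc hz
    (h.hasDerivAt_left (mapsTo_diskAut hc hz))).differentiableAt.differentiableWithinAt
  right z hz := (hasDerivAt_autLift hc hz
    (h.hasDerivAt_right (mapsTo_diskAut hc hz))).differentiableAt.differentiableWithinAt
  wronskian z hz := by
    have hm := mapsTo_diskAut hc hz
    rw [(hasDerivAt_autLift hc hz (h.hasDerivAt_left hm)).deriv,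
      (hasDerivAt_autLift hc hz (h.hasDerivAt_right hm)).deriv, EpsteinPoincare.autLift,
      EpsteinPoincare.autLift]
    have h0 := diskAut_denom_ne_zero (c := c) (z := z) (by simpa using hc) (by simpa using hz)
    have hs0 : ((√(1 - ‖c‖ ^ 2) : ℝ) : ℂ) ≠ 0 := by
      have := Real.sqrt_pos.mpr (one_sub_norm_sq_pos hc)
      exact_mod_cast this.ne'
    have hw := h.wronskian _ hm
    field_simp
    linear_combination ((√(1 - ‖c‖ ^ 2) : ℝ) : ℂ) ^ 2 * hw

/-- Chain rule for the Schwarzian: a Möbius map `σ` contributes none of its own, so only the factor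
`σ'(0)²` appears, with `σ'(0) = 1 - |c|²`. -/
lemma potential_autLift_zero {a b : ℂ → ℂ} {c : ℂ} (h : IsUnimodular a b)
    (hc : c ∈ ball (0 : ℂ) 1) :
    potential (autLift c a) (autLift c b) 0 = potential a b c * ((1 - ‖c‖ ^ 2 : ℝ) : ℂ) ^ 2 := by
  have h00 : (0 : ℂ) ∈ ball (0 : ℂ) 1 := by simp
  have hs := sqrt_sq_ofReal (one_sub_norm_sq_pos hc)
  have hs0 : ((√(1 - ‖c‖ ^ 2) : ℝ) : ℂ) ≠ 0 := by
    have := Real.sqrt_pos.mpr (one_sub_norm_sq_pos hc)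
    exact_mod_cast this.ne'
  set s : ℂ := ((√(1 - ‖c‖ ^ 2) : ℝ) : ℂ) with hsdef
  have key : ∀ y : ℂ → ℂ, (∀ z ∈ ball (0 : ℂ) 1, HasDerivAt y (deriv y z) z) →
      HasDerivAt (deriv y) (potential a b c * y c) c →
      HasDerivAt (deriv (autLift c y)) (potential a b c * s ^ 4 * (autLift c y 0)) 0 := by
    intro y hy hy2
    have e : deriv (autLift c y) =ᶠ[𝓝 0] fun z => (starRingEnd ℂ) c / s * y (diskAut c z) +
        s / (1 + (starRingEnd ℂ) c * z) * deriv y (diskAut c z) := by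
      filter_upwards [isOpen_ball.mem_nhds h00] with z hz
      exact (hasDerivAt_autLift hc hz (hy _ (mapsTo_diskAut hc hz))).deriv
    refine HasDerivAt.congr_of_eventuallyEq ?_ e
    have hσ := hasDerivAt_diskAut (c := c) (z := 0) (by simpa using hc) (by simp)
    have d1 : HasDerivAt y (deriv y c) (diskAut c 0) := by rw [diskAut_zero]; exact hy c hc
    have d2 : HasDerivAt (deriv y) (potential a b c * y c) (diskAut c 0) := by
      rwa [diskAut_zero]
    have h1 := ((d1.comp (0 : ℂ) hσ).const_mul ((starRingEnd ℂ) c / s)).fun_add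
      ((((hasDerivAt_const (0 : ℂ) s).fun_div
        (((hasDerivAt_id' (0 : ℂ)).const_mul ((starRingEnd ℂ) c)).const_add 1)
        (by simp)).fun_mul (d2.comp (0 : ℂ) hσ)))
    refine h1.congr_deriv ?_
    rw [autLift, ← hsdef, ← hs]
    simp only [diskAut_zero, Function.comp_apply, mul_zero, add_zero]
    field_simp
    ring
  have hu := h.autLift hc
  have k1 := key a (fun z hz => h.hasDerivAt_left hz) (h.hasDerivAt_deriv_left hc)
  have k2 := key b (fun z hz => h.hasDerivAt_right hz) (h.hasDerivAt_deriv_right hc)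
  rw [← hs, potential, k1.deriv, k2.deriv]
  linear_combination potential a b c * s ^ 4 * hu.wronskian 0 h00

lemma IsLift.autLift {f : ℂ → OnePoint ℂ} {a b : ℂ → ℂ} {c : ℂ} (h : IsLift f a b)
    (hc : c ∈ ball (0 : ℂ) 1) :
    IsLift (fun z => f (diskAut c z)) (autLift c a) (autLift c b) where
  toIsUnimodular := h.toIsUnimodular.autLift hc
  eq_proj z hz := by
    have hm := mapsTo_diskAut hc hz
    rw [h.eq_proj _ hm, proj_eq_proj_iff (h.ne_zero hm)
      ((h.toIsUnimodular.autLift hc).ne_zero hz), EpsteinPoincare.autLift, EpsteinPoincare.autLift]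
    ring

lemma IsConformalOnto.comp_diskAut {f : ℂ → OnePoint ℂ} {a b : ℂ → ℂ} {Ω : Set (OnePoint ℂ)}
    {c : ℂ} (hf : IsConformalOnto f Ω) (h : IsLift f a b) (hc : c ∈ ball (0 : ℂ) 1) :
    IsConformalOnto (fun z => f (diskAut c z)) Ω :=
  (h.autLift hc).isConformalOnto (hf.bijOn.comp (bijOn_diskAut hc))

/-! ### The Poincaré density -/

/-- Every point of the sphere is the zero of the second row of a matrix of determinant `1`. -/
lemma exists_linear_form_of_point (p : OnePoint ℂ) :
    ∃ c₁ c₂ c₃ c₄ : ℂ, c₁ * c₄ - c₂ * c₃ = 1 ∧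
      ∀ x y : ℂ, (x ≠ 0 ∨ y ≠ 0) → c₃ * x + c₄ * y = 0 → proj x y = p := by
  induction p using OnePoint.rec with
  | infty =>
    refine ⟨1, 0, 0, 1, by simp, fun x y _ h => ?_⟩
    simp only [zero_mul, one_mul, zero_add] at h
    rw [h, proj_zero]
  | coe p =>
    refine ⟨0, -1, 1, -p, by simp, fun x y hxy h => ?_⟩
    rw [← proj_one, proj_eq_proj_iff hxy (by simp)]
    linear_combination h

/-- Monotonicity of the Poincaré density, in terms of lifts. -/
lemma IsLift.norm_sq_mul_le {f g : ℂ → OnePoint ℂ} {a b α β : ℂ → ℂ} (hf : IsLift f a b)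
    (hg : IsLift g α β) (hgi : InjOn g (ball 0 1)) (hfg : f '' ball 0 1 ⊆ g '' ball 0 1)
    {p : OnePoint ℂ} (hp : p ∉ g '' ball 0 1) {z w : ℂ} (hz : z ∈ ball (0 : ℂ) 1)
    (hw : w ∈ ball (0 : ℂ) 1) (hzw : f z = g w) :
    ‖β w‖ ^ 2 * (1 - ‖z‖ ^ 2) ≤ ‖b z‖ ^ 2 * (1 - ‖w‖ ^ 2) := by
  -- A determinant 1 change of coordinates moves the omitted point to infinity; both maps become
  -- finite-valued and `subordination` applies.
  obtain ⟨c₁, c₂, c₃, c₄, hdet, hpc⟩ := exists_linear_form_of_point p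
  have hgp : ∀ x ∈ ball (0 : ℂ) 1, c₃ * α x + c₄ * β x ≠ 0 := fun x hx h0 =>
    hp ⟨x, hx, by rw [hg.eq_proj x hx]; exact hpc _ _ (hg.ne_zero hx) h0⟩
  have hfp : ∀ x ∈ ball (0 : ℂ) 1, c₃ * a x + c₄ * b x ≠ 0 := fun x hx h0 =>
    hp (hfg ⟨x, hx, by rw [hf.eq_proj x hx]; exact hpc _ _ (hf.ne_zero hx) h0⟩)
  have uf := hf.toIsUnimodular.linear hdet
  have ug := hg.toIsUnimodular.linear hdet
  have cross : ∀ x y x' y' : ℂ, c₃ * x + c₄ * y ≠ 0 → c₃ * x' + c₄ * y' ≠ 0 →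
      (x ≠ 0 ∨ y ≠ 0) → (x' ≠ 0 ∨ y' ≠ 0) →
      (proj x y = proj x' y' ↔ (c₁ * x + c₂ * y) / (c₃ * x + c₄ * y) =
        (c₁ * x' + c₂ * y') / (c₃ * x' + c₄ * y')) := by
    intro x y x' y' h1 h2 h3 h4
    rw [proj_eq_proj_iff h3 h4, div_eq_div_iff h1 h2]
    constructor
    · intro h; linear_combination (c₁ * c₄ - c₂ * c₃) * h
    · intro h
      linear_combination h - (x * y' - x' * y) * hdet
  have hsub := subordination
    (F := fun x => (c₁ * a x + c₂ * b x) / (c₃ * a x + c₄ * b x))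
    (G := fun x => (c₁ * α x + c₂ * β x) / (c₃ * α x + c₄ * β x))
    (fun x hx => (uf.hasDerivAt_div hx (hfp x hx)).differentiableAt.differentiableWithinAt)
    (fun x hx => (ug.hasDerivAt_div hx (hgp x hx)).differentiableAt.differentiableWithinAt)
    (fun x hx y hy hxy => hgi hx hy (by
      rw [hg.eq_proj x hx, hg.eq_proj y hy,
        cross _ _ _ _ (hgp x hx) (hgp y hy) (hg.ne_zero hx) (hg.ne_zero hy)]
      exact hxy))
    (by
      rintro _ ⟨x, hx, rfl⟩
      obtain ⟨y, hy, hyx⟩ := hfg ⟨x, hx, rfl⟩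
      refine ⟨y, hy, ?_⟩
      rw [hg.eq_proj y hy, hf.eq_proj x hx,
        cross _ _ _ _ (hgp y hy) (hfp x hx) (hg.ne_zero hy) (hf.ne_zero hx)] at hyx
      exact hyx) hz hw
    (by
      rw [hf.eq_proj z hz, hg.eq_proj w hw,
        cross _ _ _ _ (hfp z hz) (hgp w hw) (hf.ne_zero hz) (hg.ne_zero hw)] at hzw
      exact hzw)
  rw [(uf.hasDerivAt_div hz (hfp z hz)).deriv, (ug.hasDerivAt_div hw (hgp w hw)).deriv] at hsub
  -- The two lifts are proportional over the common point, so the auxiliary coordinates drop out of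
  -- the inequality.
  have hl : ‖β w‖ * ‖c₃ * a z + c₄ * b z‖ = ‖b z‖ * ‖c₃ * α w + c₄ * β w‖ := by
    rw [hf.eq_proj z hz, hg.eq_proj w hw,
      proj_eq_proj_iff (hf.ne_zero hz) (hg.ne_zero hw)] at hzw
    rw [← norm_mul, ← norm_mul]
    congr 1
    linear_combination c₃ * hzw
  have n1 : 0 < ‖c₃ * a z + c₄ * b z‖ := norm_pos_iff.mpr (hfp z hz)
  have n2 : 0 < ‖c₃ * α w + c₄ * β w‖ := norm_pos_iff.mpr (hgp w hw)
  rw [norm_div, norm_div, norm_pow, norm_pow, norm_one, one_div_mul_eq_div, one_div_mul_eq_div,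
    div_le_div_iff₀ (by positivity) (by positivity)] at hsub
  have hβ : ‖β w‖ = ‖b z‖ * ‖c₃ * α w + c₄ * β w‖ / ‖c₃ * a z + c₄ * b z‖ := by
    rw [eq_div_iff n1.ne']; exact hl
  rw [hβ, div_pow, mul_pow, div_mul_eq_mul_div, div_le_iff₀ (by positivity)]
  calc _ = ‖b z‖ ^ 2 * ((1 - ‖z‖ ^ 2) * ‖c₃ * α w + c₄ * β w‖ ^ 2) := by ring
    _ ≤ ‖b z‖ ^ 2 * ((1 - ‖w‖ ^ 2) * ‖c₃ * a z + c₄ * b z‖ ^ 2) := by gcongr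
    _ = _ := by ring

/-- The parametrization chosen in `poincareDensity` is compared with `f` by monotonicity in both
directions, since the images coincide; so the choice is immaterial. -/
lemma poincareDensity_eq {f : ℂ → OnePoint ℂ} {a b : ℂ → ℂ} {Ω : Set (OnePoint ℂ)}
    (hf : IsConformalOnto f Ω) (h : IsLift f a b) {p : OnePoint ℂ} (hp : p ∉ Ω) {z : ℂ}
    (hz : z ∈ ball (0 : ℂ) 1) (hb : b z ≠ 0) :
    poincareDensity Ω (a z / b z) = (2 * ‖b z‖ ^ 2 / (1 - ‖z‖ ^ 2)) ^ 2 := by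
  have h00 : (0 : ℂ) ∈ ball (0 : ℂ) 1 := by simp
  have hex : ∃ k : ℂ → OnePoint ℂ, IsConformalOnto k Ω ∧
      k 0 = ((a z / b z : ℂ) : OnePoint ℂ) :=
    ⟨_, hf.comp_diskAut h hz, by
      simp only [diskAut_zero]
      rw [h.eq_proj z hz, proj_of_ne hb]⟩
  rw [poincareDensity, dif_pos hex]
  obtain ⟨hk, hk0⟩ := hex.choose_spec
  set k := hex.choose
  obtain ⟨α, β, hl⟩ := hk.exists_lift hp
  have hβ : β 0 ≠ 0 := by
    rw [Ne, ← hl.apply_eq_infty_iff h00, hk0]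
    exact OnePoint.coe_ne_infty _
  rw [(hl.localCoord_eq_div h00 hβ).deriv_eq, (hl.hasDerivAt_div h00 hβ).deriv]
  have hfz : f z = k 0 := by rw [hk0, h.eq_proj z hz, proj_of_ne hb]
  have h1 := h.norm_sq_mul_le hl hk.bijOn.injOn
    (by rw [hf.bijOn.image_eq, hk.bijOn.image_eq]) (p := p)
    (by rwa [hk.bijOn.image_eq]) hz h00 hfz
  have h2 := hl.norm_sq_mul_le h hf.bijOn.injOn
    (by rw [hf.bijOn.image_eq, hk.bijOn.image_eq]) (p := p)
    (by rwa [hf.bijOn.image_eq]) h00 hz hfz.symm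
  have h3 : ‖β 0‖ ^ 2 = ‖b z‖ ^ 2 / (1 - ‖z‖ ^ 2) := by
    rw [eq_div_iff (one_sub_norm_sq_pos hz).ne']
    simp only [norm_zero] at h1 h2
    linarith
  have hn : ‖β 0‖ ≠ 0 := norm_ne_zero_iff.mpr hβ
  rw [norm_div, norm_one, norm_pow, mul_div_assoc, ← h3]
  field_simp
  ring

/-! ### Hermitian forms along a lift -/

/-- The Hermitian form with matrix `(A, B; B̄, C)`, as a sesquilinear form. -/
def sesq (A : ℝ) (B : ℂ) (C : ℝ) (x y x' y' : ℂ) : ℂ :=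
  A * x * conj x' + conj B * x * conj y' + B * y * conj x' + C * y * conj y'

lemma conj_sesq (A : ℝ) (B : ℂ) (C : ℝ) (x y x' y' : ℂ) :
    conj (sesq A B C x y x' y') = sesq A B C x' y' x y := by
  simp only [sesq, map_add, map_mul, Complex.conj_conj, Complex.conj_ofReal]
  ring

/-- The form `Q(v, v)` along `v = (a, b)`. -/
def quad (A : ℝ) (B : ℂ) (C : ℝ) (a b : ℂ → ℂ) (z : ℂ) : ℂ :=
  sesq A B C (a z) (b z) (a z) (b z)

/-- The form `Q(v', v)` along `v = (a, b)`. -/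
def quadD (A : ℝ) (B : ℂ) (C : ℝ) (a b : ℂ → ℂ) (z : ℂ) : ℂ :=
  sesq A B C (deriv a z) (deriv b z) (a z) (b z)

/-- The form `Q(v', v')` along `v = (a, b)`. -/
def quadDD (A : ℝ) (B : ℂ) (C : ℝ) (a b : ℂ → ℂ) (z : ℂ) : ℂ :=
  sesq A B C (deriv a z) (deriv b z) (deriv a z) (deriv b z)

/-- `1 - |z|²`, as a complex number. -/
def discW (z : ℂ) : ℂ := 1 - z * conj z

lemma discW_eq (z : ℂ) : discW z = ((1 - ‖z‖ ^ 2 : ℝ) : ℂ) := by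
  rw [discW, Complex.mul_conj, Complex.normSq_eq_norm_sq]
  push_cast
  ring

/-- `Q(v, v) / (1 - |z|²)`: the (signed exponential) distance of the horosphere of the Poincaré
metric to the plane of `Q`. -/
def horoDepth (A : ℝ) (B : ℂ) (C : ℝ) (a b : ℂ → ℂ) (z : ℂ) : ℂ :=
  quad A B C a b z / discW z

/-- The value of `Q` at the Epstein point. -/
def epsteinDepth (A : ℝ) (B : ℂ) (C : ℝ) (a b : ℂ → ℂ) (z : ℂ) : ℂ :=
  discW z * quadDD A B C a b z + z * quadD A B C a b z + conj (z * quadD A B C a b z)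
    + (1 + z * conj z) / discW z * quad A B C a b z

/-- `∂(horoDepth)`. -/
def horoDepthD (A : ℝ) (B : ℂ) (C : ℝ) (a b : ℂ → ℂ) (z : ℂ) : ℂ :=
  (quadD A B C a b z * discW z + conj z * quad A B C a b z) / discW z ^ 2

section

variable (A : ℝ) (B : ℂ) (C : ℝ) (a b : ℂ → ℂ) (z : ℂ)

lemma conj_quad : conj (quad A B C a b z) = quad A B C a b z := conj_sesq ..

lemma conj_quadDD : conj (quadDD A B C a b z) = quadDD A B C a b z := conj_sesq ..

lemma conj_discW : conj (discW z) = discW z := by simp [discW, mul_comm]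

lemma conj_horoDepth : conj (horoDepth A B C a b z) = horoDepth A B C a b z := by
  rw [horoDepth, map_div₀, conj_quad, conj_discW]

lemma conj_epsteinDepth : conj (epsteinDepth A B C a b z) = epsteinDepth A B C a b z := by
  simp only [epsteinDepth, map_add, map_mul, map_div₀, conj_quad, conj_discW, conj_quadDD,
    Complex.conj_conj, map_one]
  ring

lemma ofReal_re_horoDepth : ((horoDepth A B C a b z).re : ℂ) = horoDepth A B C a b z :=
  Complex.conj_eq_iff_re.mp (conj_horoDepth ..)

lemma ofReal_re_epsteinDepth : ((epsteinDepth A B C a b z).re : ℂ) = epsteinDepth A B C a b z :=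
  Complex.conj_eq_iff_re.mp (conj_epsteinDepth ..)

end

lemma discW_ne_zero {z : ℂ} (hz : z ∈ ball (0 : ℂ) 1) : discW z ≠ 0 := by
  rw [discW_eq]
  exact_mod_cast (one_sub_norm_sq_pos hz).ne'

/-- The relation `(2 s - u) u - |∇u|² = det Q`. -/
lemma epsteinDepth_mul_horoDepth {A : ℝ} {B : ℂ} {C : ℝ} {a b : ℂ → ℂ} {z : ℂ}
    (h : IsUnimodular a b) (hz : z ∈ ball (0 : ℂ) 1) :
    (epsteinDepth A B C a b z - horoDepth A B C a b z) * horoDepth A B C a b z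
      - discW z ^ 2 * (horoDepthD A B C a b z * conj (horoDepthD A B C a b z)) =
      A * C - B * conj B := by
  have hw := discW_ne_zero hz
  have h1 := h.wronskian z hz
  have h2 := congrArg conj h1
  simp only [map_sub, map_mul, map_one] at h2
  -- The Gram determinant of `Q` on the frame `(v', v)` is `det Q` times the squared modulus of the
  -- Wronskian, which is 1.
  have key : quadDD A B C a b z * quad A B C a b z -
      quadD A B C a b z * conj (quadD A B C a b z) = A * C - B * conj B := by
    rw [quadD, conj_sesq, quadDD, quad]
    simp only [sesq]
    linear_combination (A * C - B * conj B) * ((deriv a z * b z - a z * deriv b z) * h2 + h1)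
  rw [← key]
  simp only [epsteinDepth, horoDepth, horoDepthD, map_div₀, map_add, map_mul, map_pow, conj_quad,
    conj_discW, Complex.conj_conj]
  have hzz : z * conj z = 1 - discW z := by rw [discW]; ring
  rw [hzz]
  field_simp
  linear_combination (quad A B C a b z) ^ 2 * (-1) * hzz

/-! ### Derivatives along lines -/

lemma hasDerivAt_line (z e : ℂ) (t : ℝ) : HasDerivAt (fun t : ℝ => z + t * e) e t := by
  have := ((Complex.ofRealCLM.hasDerivAt (x := t)).mul_const e).const_add z
  simpa using this

lemma hasDerivAt_comp_line {g : ℂ → ℂ} {d z e : ℂ} {t : ℝ} (hg : HasDerivAt g d (z + t * e)) :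
    HasDerivAt (fun t : ℝ => g (z + t * e)) (e * d) t := by
  have := hg.scomp t (hasDerivAt_line z e t)
  simpa [Function.comp_def] using this

lemma hasDerivAt_conj_comp {g : ℝ → ℂ} {d : ℂ} {t : ℝ} (hg : HasDerivAt g d t) :
    HasDerivAt (fun t => conj (g t)) (conj d) t := hg.star

lemma hasDerivAt_sesq {A : ℝ} {B : ℂ} {C : ℝ} {x y x' y' : ℝ → ℂ} {dx dy dx' dy' : ℂ} {t : ℝ}
    (hx : HasDerivAt x dx t) (hy : HasDerivAt y dy t) (hx' : HasDerivAt x' dx' t)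
    (hy' : HasDerivAt y' dy' t) :
    HasDerivAt (fun t => sesq A B C (x t) (y t) (x' t) (y' t))
      (sesq A B C dx dy (x' t) (y' t) + sesq A B C (x t) (y t) dx' dy') t := by
  have cx := hasDerivAt_conj_comp hx'
  have cy := hasDerivAt_conj_comp hy'
  have h1 := ((((hx.const_mul (A : ℂ)).fun_mul cx).fun_add
    ((hx.const_mul (conj B)).fun_mul cy)).fun_add
    ((hy.const_mul B).fun_mul cx)).fun_add ((hy.const_mul (C : ℂ)).fun_mul cy)
  refine h1.congr_deriv ?_
  simp only [sesq]
  ring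

section

variable {A : ℝ} {B : ℂ} {C : ℝ} {a b : ℂ → ℂ} {z e : ℂ} {t : ℝ}

lemma hasDerivAt_discW_line : HasDerivAt (fun t : ℝ => discW (z + t * e))
    (-(e * conj (z + t * e) + conj e * (z + t * e))) t := by
  have h := hasDerivAt_line z e t
  have := (h.fun_mul (hasDerivAt_conj_comp h)).const_sub 1
  refine this.congr_deriv ?_
  ring

lemma hasDerivAt_quad_line (h : IsUnimodular a b) (hz : z + t * e ∈ ball (0 : ℂ) 1) :
    HasDerivAt (fun t : ℝ => quad A B C a b (z + t * e))
      (e * quadD A B C a b (z + t * e) + conj (e * quadD A B C a b (z + t * e))) t := by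
  have ha := hasDerivAt_comp_line (h.hasDerivAt_left hz)
  have hb := hasDerivAt_comp_line (h.hasDerivAt_right hz)
  refine (hasDerivAt_sesq ha hb ha hb).congr_deriv ?_
  rw [map_mul, quadD, conj_sesq]
  simp only [sesq, map_mul]
  ring

/-- Because `v'' = λ v`, the term `Q(v'', v)` is `λ Q(v, v)`; hence differentiating `quad`, `quadD`
and `quadDD` produces no new forms. -/
lemma hasDerivAt_quadD_line (h : IsUnimodular a b) (hz : z + t * e ∈ ball (0 : ℂ) 1) :
    HasDerivAt (fun t : ℝ => quadD A B C a b (z + t * e))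
      (e * potential a b (z + t * e) * quad A B C a b (z + t * e) +
        conj e * quadDD A B C a b (z + t * e)) t := by
  have ha := hasDerivAt_comp_line (h.hasDerivAt_left hz)
  have hb := hasDerivAt_comp_line (h.hasDerivAt_right hz)
  have ha' := hasDerivAt_comp_line (h.hasDerivAt_deriv_left hz)
  have hb' := hasDerivAt_comp_line (h.hasDerivAt_deriv_right hz)
  refine (hasDerivAt_sesq ha' hb' ha hb).congr_deriv ?_
  simp only [quad, quadDD, sesq, map_mul]
  ring

lemma hasDerivAt_quadDD_line (h : IsUnimodular a b) (hz : z + t * e ∈ ball (0 : ℂ) 1) :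
    HasDerivAt (fun t : ℝ => quadDD A B C a b (z + t * e))
      (e * potential a b (z + t * e) * conj (quadD A B C a b (z + t * e)) +
        conj (e * potential a b (z + t * e)) * quadD A B C a b (z + t * e)) t := by
  have ha' := hasDerivAt_comp_line (h.hasDerivAt_deriv_left hz)
  have hb' := hasDerivAt_comp_line (h.hasDerivAt_deriv_right hz)
  refine (hasDerivAt_sesq ha' hb' ha' hb').congr_deriv ?_
  rw [quadD, conj_sesq]
  simp only [sesq, map_mul]
  ring

/-- `∂(2 s + c u) = (2 + c) ∂u + λ (1 - |z|²)² ∂̄u`. -/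
def depthGradient (A : ℝ) (B : ℂ) (C : ℝ) (a b : ℂ → ℂ) (c : ℝ) (z : ℂ) : ℂ :=
  (2 + c) * horoDepthD A B C a b z +
    potential a b z * discW z ^ 2 * conj (horoDepthD A B C a b z)

/-- No derivative of `λ` survives: all terms collect into `∂u` and its conjugate. This is why a
small weighted potential turns critical points of the combination into critical points of `u`. -/
lemma hasDerivAt_depth_line (h : IsUnimodular a b) (hz : z + t * e ∈ ball (0 : ℂ) 1) (c : ℝ) :
    HasDerivAt (fun t : ℝ => epsteinDepth A B C a b (z + t * e) +
        c * horoDepth A B C a b (z + t * e))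
      (e * depthGradient A B C a b c (z + t * e) +
        conj (e * depthGradient A B C a b c (z + t * e))) t := by
  have hw := discW_ne_zero hz
  have dz := hasDerivAt_line z e t
  have dw := hasDerivAt_discW_line (z := z) (e := e) (t := t)
  have dq := hasDerivAt_quad_line (A := A) (B := B) (C := C) h hz
  have dm := hasDerivAt_quadD_line (A := A) (B := B) (C := C) h hz
  have dn := hasDerivAt_quadDD_line (A := A) (B := B) (C := C) h hz
  have dzm := dz.fun_mul dm
  have h1 := (((dw.fun_mul dn).fun_add dzm).fun_add (hasDerivAt_conj_comp dzm)).fun_add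
    ((((dz.fun_mul (hasDerivAt_conj_comp dz)).const_add 1).fun_div dw hw).fun_mul dq)
  have h2 := h1.fun_add ((dq.fun_div dw hw).const_mul (c : ℂ))
  refine h2.congr_deriv ?_
  generalize z + t * e = x at hw ⊢
  simp only [depthGradient, horoDepthD, map_add, map_mul, map_div₀, map_pow, conj_quad, conj_quadDD,
    conj_discW, Complex.conj_conj, Complex.conj_ofReal, map_ofNat]
  generalize quad A B C a b x = q
  generalize quadD A B C a b x = m
  generalize quadDD A B C a b x = n
  generalize potential a b x = l
  have hwx : discW x = 1 - x * conj x := rfl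
  generalize discW x = w at hw hwx ⊢
  generalize conj x = y at hwx ⊢
  field_simp
  rw [hwx]
  ring

/-- At a critical point `∂²u = λ u` and `∂∂̄u = s / w²`: the Epstein depth is, up to the weight, the
Laplacian of the horosphere depth. -/
lemma hasDerivAt_horoDepthD_line (h : IsUnimodular a b) (hz : z + t * e ∈ ball (0 : ℂ) 1)
    (hP : horoDepthD A B C a b (z + t * e) = 0) :
    HasDerivAt (fun t : ℝ => horoDepthD A B C a b (z + t * e))
      (e * (potential a b (z + t * e) * horoDepth A B C a b (z + t * e)) +
        conj e * (epsteinDepth A B C a b (z + t * e) / discW (z + t * e) ^ 2)) t := by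
  have hw := discW_ne_zero hz
  have dz := hasDerivAt_line z e t
  have dw := hasDerivAt_discW_line (z := z) (e := e) (t := t)
  have dq := hasDerivAt_quad_line (A := A) (B := B) (C := C) h hz
  have dm := hasDerivAt_quadD_line (A := A) (B := B) (C := C) h hz
  have h1 := ((dm.fun_mul dw).fun_add ((hasDerivAt_conj_comp dz).fun_mul dq)).fun_div
    (dw.fun_pow 2) (pow_ne_zero 2 hw)
  refine h1.congr_deriv ?_
  rw [horoDepthD, div_eq_zero_iff, or_iff_left (pow_ne_zero 2 hw)] at hP
  generalize z + t * e = x at hw hP ⊢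
  have hP' := congrArg conj hP
  simp only [epsteinDepth, horoDepth, map_add, map_mul, conj_quad,
    conj_discW, Complex.conj_conj, map_zero] at hP' ⊢
  have hm : quadD A B C a b x = -(conj x * quad A B C a b x) / discW x := by
    rw [eq_div_iff hw]; linear_combination hP
  have hm' : conj (quadD A B C a b x) = -(x * quad A B C a b x) / discW x := by
    rw [eq_div_iff hw]; linear_combination hP'
  rw [hm', hm]
  clear hm hm' hP hP'
  generalize quad A B C a b x = q
  generalize quadDD A B C a b x = n
  generalize potential a b x = l
  have hwx : discW x = 1 - x * conj x := rfl
  generalize discW x = w at hw hwx ⊢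
  generalize conj x = y at hwx ⊢
  field_simp
  rw [hwx]
  ring

/-- The derivatives of `λ` and of the weight are multiplied by `conj(∂u)`, which vanishes here. -/
lemma hasDerivAt_depthGradient_line (h : IsUnimodular a b) (hz : z + t * e ∈ ball (0 : ℂ) 1)
    (hP : horoDepthD A B C a b (z + t * e) = 0) (c : ℝ) :
    HasDerivAt (fun t : ℝ => depthGradient A B C a b c (z + t * e))
      ((2 + c) * (e * (potential a b (z + t * e) * horoDepth A B C a b (z + t * e)) +
        conj e * (epsteinDepth A B C a b (z + t * e) / discW (z + t * e) ^ 2)) +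
        potential a b (z + t * e) * discW (z + t * e) ^ 2 *
        (conj e * (conj (potential a b (z + t * e)) * horoDepth A B C a b (z + t * e)) +
        e * (epsteinDepth A B C a b (z + t * e) / discW (z + t * e) ^ 2))) t := by
  have dP := hasDerivAt_horoDepthD_line (A := A) (B := B) (C := C) h hz hP
  have dl := hasDerivAt_comp_line
    (h.differentiableOn_potential.differentiableAt (isOpen_ball.mem_nhds hz)).hasDerivAt
  have dw := hasDerivAt_discW_line (z := z) (e := e) (t := t)
  have h1 := (dP.const_mul (2 + c : ℂ)).fun_add
    ((dl.fun_mul (dw.fun_pow 2)).fun_mul (hasDerivAt_conj_comp dP))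
  refine h1.congr_deriv ?_
  rw [hP]
  simp only [map_add, map_mul, map_div₀, map_pow, conj_horoDepth, conj_epsteinDepth, conj_discW,
    Complex.conj_conj, map_zero]
  ring

end

/-! ### The maximum principle -/

/-- A positive second derivative would make 0 a local minimum as well; then `g` would be locally
constant and `g₂` would be 0. -/
lemma nonpos_of_isLocalMax {g g₁ : ℝ → ℝ} {g₂ : ℝ} (hmax : IsLocalMax g 0)
    (h1 : ∀ᶠ t in 𝓝 0, HasDerivAt g (g₁ t) t) (h2 : HasDerivAt g₁ g₂ 0) : g₂ ≤ 0 := by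
  by_contra! hpos
  have hd : deriv g =ᶠ[𝓝 0] g₁ := h1.mono fun t ht => ht.deriv
  have hdd : deriv (deriv g) 0 = g₂ := by rw [hd.deriv_eq, h2.deriv]
  have hmin : IsLocalMin g 0 := isLocalMin_of_deriv_deriv_pos (by rw [hdd]; exact hpos)
    hmax.deriv_eq_zero h1.self_of_nhds.continuousAt
  have hconst : g =ᶠ[𝓝 0] fun _ => g 0 := by
    filter_upwards [hmax, hmin] with t a1 a2
    exact le_antisymm a1 a2
  have h3 : deriv g =ᶠ[𝓝 0] fun _ => 0 := by
    refine hconst.deriv.trans ?_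
    simp
  have h4 : deriv (deriv g) 0 = 0 := by rw [h3.deriv_eq]; simp
  linarith

lemma exists_norm_one_sq_mul_eq (l : ℂ) : ∃ e : ℂ, ‖e‖ = 1 ∧ e ^ 2 * l = ‖l‖ := by
  by_cases hl : l = 0
  · exact ⟨1, by simp, by simp [hl]⟩
  · have hn : (‖l‖ : ℂ) ≠ 0 := by exact_mod_cast norm_ne_zero_iff.mpr hl
    obtain ⟨e, he⟩ := IsAlgClosed.exists_pow_nat_eq ((‖l‖ : ℂ) / l) two_pos
    refine ⟨e, ?_, by rw [he]; field_simp⟩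
    have h1 : ‖e‖ ^ 2 = 1 := by
      rw [← norm_pow, he, norm_div, Complex.norm_real, norm_norm,
        div_self (norm_ne_zero_iff.mpr hl)]
    exact (pow_eq_one_iff_of_nonneg (norm_nonneg e) two_ne_zero).mp h1

/-- At a local maximum of `2 s + c u` the Epstein depth `s` is nonpositive. -/
lemma epsteinDepth_nonpos_of_isLocalMax {A : ℝ} {B : ℂ} {C : ℝ} {a b : ℂ → ℂ} {z : ℂ} {c : ℝ}
    (h : IsUnimodular a b) (hz : z ∈ ball (0 : ℂ) 1)
    (hl : ‖potential a b z‖ * (1 - ‖z‖ ^ 2) ^ 2 < 2 + c)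
    (hmax : IsLocalMax
      (fun z => (epsteinDepth A B C a b z).re + c * (horoDepth A B C a b z).re) z) :
    horoDepthD A B C a b z = 0 ∧ (epsteinDepth A B C a b z).re ≤ 0 := by
  set G : ℂ → ℝ := fun z => (epsteinDepth A B C a b z).re + c * (horoDepth A B C a b z).re with hG
  set R := depthGradient A B C a b c with hR
  have hline : ∀ e : ℂ, ∀ᶠ t : ℝ in 𝓝 0, z + t * e ∈ ball (0 : ℂ) 1 := by
    intro e
    have : Tendsto (fun t : ℝ => z + t * e) (𝓝 0) (𝓝 z) := by
      have := (hasDerivAt_line z e 0).continuousAt.tendsto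
      simpa using this
    exact this (isOpen_ball.mem_nhds hz)
  have hd : ∀ e : ℂ, ∀ t : ℝ, z + t * e ∈ ball (0 : ℂ) 1 →
      HasDerivAt (fun t : ℝ => G (z + t * e)) (2 * (e * R (z + t * e)).re) t := by
    intro e t ht
    have h1 := hasDerivAt_depth_line (A := A) (B := B) (C := C) h ht c
    have h2 := Complex.reCLM.hasFDerivAt.comp_hasDerivAt t h1
    have h3 : (fun t : ℝ => G (z + t * e)) =ᶠ[𝓝 t] Complex.reCLM ∘ fun t : ℝ =>
        epsteinDepth A B C a b (z + t * e) + c * horoDepth A B C a b (z + t * e) :=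
      Eventually.of_forall fun s => by simp [hG]
    refine (h2.congr_of_eventuallyEq h3).congr_deriv ?_
    simp [← hR]
    ring
  have hmaxl : ∀ e : ℂ, IsLocalMax (fun t : ℝ => G (z + t * e)) 0 := by
    intro e
    have h1 : Tendsto (fun t : ℝ => z + t * e) (𝓝 0) (𝓝 z) := by
      have := (hasDerivAt_line z e 0).continuousAt.tendsto
      simpa using this
    have h2 := h1.eventually hmax
    simpa [IsLocalMax, IsMaxFilter] using h2
  have hR0 : R z = 0 := by
    have h1 : ∀ e : ℂ, (e * R z).re = 0 := by
      intro e
      have h2 := (hmaxl e).hasDerivAt_eq_zero (hd e 0 (by simpa using hz))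
      simpa using h2
    have h2 := h1 (conj (R z))
    rw [mul_comm, Complex.mul_conj] at h2
    simpa using h2
  have hw : discW z = ((1 - ‖z‖ ^ 2 : ℝ) : ℂ) := discW_eq z
  have hwp := one_sub_norm_sq_pos hz
  -- Vanishing of the gradient equates `|2 + c| |∂u|` with `|λ| w² |∂u|`, impossible for `∂u ≠ 0`
  -- since `|λ| w² < 2 + c`.
  have hP : horoDepthD A B C a b z = 0 := by
    by_contra hP
    have hPn : 0 < ‖horoDepthD A B C a b z‖ := norm_pos_iff.mpr hP
    have h1 : ((2 + c : ℝ) : ℂ) * horoDepthD A B C a b z =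
        -(potential a b z * discW z ^ 2 * conj (horoDepthD A B C a b z)) := by
      rw [hR, depthGradient] at hR0
      push_cast
      linear_combination hR0
    have h2 := congrArg norm h1
    rw [norm_neg, norm_mul, norm_mul, norm_mul, RCLike.norm_conj, hw, norm_pow, Complex.norm_real,
      Complex.norm_real, Real.norm_of_nonneg hwp.le] at h2
    have h3 := mul_right_cancel₀ hPn.ne' h2
    have h4 := le_abs_self (2 + c)
    rw [Real.norm_eq_abs] at h3
    linarith
  refine ⟨hP, ?_⟩
  set s := (epsteinDepth A B C a b z).re with hs
  set u := (horoDepth A B C a b z).re with hu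
  set l := ‖potential a b z‖ * (1 - ‖z‖ ^ 2) ^ 2 with hldef
  have hl0 : 0 ≤ l := by positivity
  -- In a direction with `e² λ = σ |λ|` the potential acts as a real scalar, and the second
  -- derivative factors into two real terms.
  have hsecond : ∀ e : ℂ, ‖e‖ = 1 → ∀ σ : ℝ, σ ^ 2 = 1 →
      e ^ 2 * potential a b z = (σ * ‖potential a b z‖ : ℝ) →
      (2 + c + σ * l) * (s + σ * l * u) ≤ 0 := by
    intro e he σ hσ heσ
    have h0 : z + ((0 : ℝ) : ℂ) * e = z := by simp
    have h1 := hasDerivAt_depthGradient_line (A := A) (B := B) (C := C) (e := e) (t := 0) h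
      (by rwa [h0]) (by rwa [h0]) c
    rw [h0] at h1
    have h2 := (Complex.reCLM.hasFDerivAt.comp_hasDerivAt (0 : ℝ) (h1.const_mul e)).const_mul 2
    have h3 := nonpos_of_isLocalMax (hmaxl e) ((hline e).mono fun t ht => hd e t ht) h2
    have hee : e * conj e = 1 := by
      rw [Complex.mul_conj, Complex.normSq_eq_norm_sq, he]; simp
    have hpp : potential a b z * conj (potential a b z) = ((‖potential a b z‖ ^ 2 : ℝ) : ℂ) := by
      rw [Complex.mul_conj, Complex.normSq_eq_norm_sq]
    rw [← ofReal_re_epsteinDepth, ← ofReal_re_horoDepth, ← hs, ← hu, hw] at h3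
    set w := 1 - ‖z‖ ^ 2 with hwdef
    have hwc : (w : ℂ) ≠ 0 := by exact_mod_cast hwp.ne'
    have h4 : e * ((2 + c) * (e * (potential a b z * u) + conj e * (s / (w : ℂ) ^ 2)) +
        potential a b z * (w : ℂ) ^ 2 * (conj e * (conj (potential a b z) * u) +
          e * (s / (w : ℂ) ^ 2))) =
        (((2 + c + σ * l) * (s + σ * l * u) / w ^ 2 : ℝ) : ℂ) := by
      have h5 : e * ((2 + c) * (e * (potential a b z * u) + conj e * (s / (w : ℂ) ^ 2)) +
        potential a b z * (w : ℂ) ^ 2 * (conj e * (conj (potential a b z) * u) +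
          e * (s / (w : ℂ) ^ 2))) =
        (2 + c) * ((e ^ 2 * potential a b z) * u + (e * conj e) * (s / (w : ℂ) ^ 2)) +
          (w : ℂ) ^ 2 * (e * conj e) * (potential a b z * conj (potential a b z)) * u +
          (e ^ 2 * potential a b z) * s := by
        have h6 : (w : ℂ) ^ 2 * (s / (w : ℂ) ^ 2) = s := by field_simp
        linear_combination e ^ 2 * potential a b z * h6
      rw [h5, hee, heσ, hpp, hldef]
      have hσ' : (σ : ℂ) ^ 2 = 1 := by exact_mod_cast hσ
      push_cast
      field_simp
      linear_combination -(w : ℂ) ^ 4 * ‖potential a b z‖ ^ 2 * u * hσ'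
    simp only [Complex.reCLM_apply] at h3
    rw [h4, Complex.ofReal_re] at h3
    have hw2 : 0 < w ^ 2 := by positivity
    have h6 : (2 + c + σ * l) * (s + σ * l * u) / w ^ 2 ≤ 0 := by linarith
    rwa [div_le_iff₀ hw2, zero_mul] at h6
  -- The directions `e` and `I * e` realise `σ = 1` and `σ = -1`; adding the two resulting
  -- inequalities eliminates `u`.
  obtain ⟨e, he, hel⟩ := exists_norm_one_sq_mul_eq (potential a b z)
  have p1 := hsecond e he 1 (by norm_num) (by rw [hel]; simp)
  have p2 := hsecond (Complex.I * e) (by simp [he]) (-1) (by norm_num) (by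
    rw [mul_pow, Complex.I_sq]
    push_cast
    linear_combination -hel)
  have q1 : s + l * u ≤ 0 := by
    by_contra! hc
    nlinarith
  have q2 : s - l * u ≤ 0 := by
    by_contra! hc
    have : 0 < 2 + c - l := by linarith
    nlinarith
  linarith

/-! ### Dilated lifts -/

/-- The lift of `z ↦ f (r z)` induced by a lift component of `f`. -/
def dilLift (r : ℝ) (a : ℂ → ℂ) (z : ℂ) : ℂ := a (r * z) / (√r : ℝ)

lemma mul_mem_ball {r : ℝ} (hr : r ∈ Ioo (0 : ℝ) 1) {z : ℂ} (hz : z ∈ closedBall (0 : ℂ) 1) :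
    (r : ℂ) * z ∈ ball (0 : ℂ) 1 := by
  rw [mem_closedBall_zero_iff] at hz
  rw [mem_ball_zero_iff, norm_mul, Complex.norm_real, Real.norm_of_nonneg hr.1.le]
  nlinarith [hr.1, hr.2, norm_nonneg z]

lemma hasDerivAt_dilLift {r : ℝ} (hr : r ∈ Ioo (0 : ℝ) 1) {a : ℂ → ℂ} {d z : ℂ}
    (ha : HasDerivAt a d (r * z)) : HasDerivAt (dilLift r a) ((√r : ℝ) * d) z := by
  have hs := sqrt_sq_ofReal hr.1
  have hs0 : ((√r : ℝ) : ℂ) ≠ 0 := by exact_mod_cast (Real.sqrt_pos.mpr hr.1).ne'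
  have h1 := (ha.comp z ((hasDerivAt_id' z).const_mul (r : ℂ))).div_const ((√r : ℝ) : ℂ)
  refine h1.congr_deriv ?_
  rw [← hs]
  field_simp

section

variable {r : ℝ} {a b : ℂ → ℂ} {z : ℂ}

lemma IsUnimodular.deriv_dilLift (h : IsUnimodular a b) (hr : r ∈ Ioo (0 : ℝ) 1)
    (hz : z ∈ closedBall (0 : ℂ) 1) : deriv (dilLift r a) z = (√r : ℝ) * deriv a (r * z) ∧
      deriv (dilLift r b) z = (√r : ℝ) * deriv b (r * z) :=
  ⟨(hasDerivAt_dilLift hr (h.hasDerivAt_left (mul_mem_ball hr hz))).deriv,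
    (hasDerivAt_dilLift hr (h.hasDerivAt_right (mul_mem_ball hr hz))).deriv⟩

lemma IsUnimodular.dilLift (h : IsUnimodular a b) (hr : r ∈ Ioo (0 : ℝ) 1) :
    IsUnimodular (dilLift r a) (dilLift r b) where
  left _ hz := (hasDerivAt_dilLift hr (h.hasDerivAt_left
    (mul_mem_ball hr (ball_subset_closedBall hz)))).differentiableAt.differentiableWithinAt
  right _ hz := (hasDerivAt_dilLift hr (h.hasDerivAt_right
    (mul_mem_ball hr (ball_subset_closedBall hz)))).differentiableAt.differentiableWithinAt
  wronskian z hz := by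
    have hz' := ball_subset_closedBall hz
    rw [(h.deriv_dilLift hr hz').1, (h.deriv_dilLift hr hz').2, EpsteinPoincare.dilLift,
      EpsteinPoincare.dilLift]
    have hs0 : ((√r : ℝ) : ℂ) ≠ 0 := by exact_mod_cast (Real.sqrt_pos.mpr hr.1).ne'
    have := h.wronskian _ (mul_mem_ball hr hz')
    field_simp
    linear_combination this

lemma potential_dilLift (h : IsUnimodular a b) (hr : r ∈ Ioo (0 : ℝ) 1)
    (hz : z ∈ ball (0 : ℂ) 1) :
    potential (dilLift r a) (dilLift r b) z = r ^ 2 * potential a b (r * z) := by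
  have hs := sqrt_sq_ofReal hr.1
  have key : ∀ y : ℂ → ℂ, (∀ x ∈ ball (0 : ℂ) 1, HasDerivAt y (deriv y x) x) →
      (∀ x ∈ ball (0 : ℂ) 1, HasDerivAt (deriv y) (potential a b x * y x) x) →
      deriv (deriv (dilLift r y)) z = (√r : ℝ) * (potential a b (r * z) * y (r * z) * r) ∧
      deriv (dilLift r y) z = (√r : ℝ) * deriv y (r * z) := by
    intro y hy hy2
    have e : ∀ x ∈ ball (0 : ℂ) 1, deriv (dilLift r y) x = (√r : ℝ) * deriv y (r * x) :=
      fun x hx => (hasDerivAt_dilLift hr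
        (hy _ (mul_mem_ball hr (ball_subset_closedBall hx)))).deriv
    refine ⟨?_, e z hz⟩
    have e' : deriv (dilLift r y) =ᶠ[𝓝 z] fun x => (√r : ℝ) * deriv y (r * x) := by
      filter_upwards [isOpen_ball.mem_nhds hz] with x hx
      exact e x hx
    rw [e'.deriv_eq]
    have h1 := ((hy2 _ (mul_mem_ball hr (ball_subset_closedBall hz))).comp z
      ((hasDerivAt_id' z).const_mul (r : ℂ))).const_mul ((√r : ℝ) : ℂ)
    refine (h1.congr_deriv ?_).deriv
    ring
  have k1 := key a (fun x hx => h.hasDerivAt_left hx) (fun x hx => h.hasDerivAt_deriv_left hx)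
  have k2 := key b (fun x hx => h.hasDerivAt_right hx) (fun x hx => h.hasDerivAt_deriv_right hx)
  rw [potential, k1.1, k1.2, k2.1, k2.2]
  have hw := h.wronskian _ (mul_mem_ball hr (ball_subset_closedBall hz))
  linear_combination ((√r : ℝ) : ℂ) ^ 2 * r * potential a b (r * z) * hw +
    r * potential a b (r * z) * hs

variable {A : ℝ} {B : ℂ} {C : ℝ}

lemma quad_dilLift (hr : r ∈ Ioo (0 : ℝ) 1) :
    quad A B C (dilLift r a) (dilLift r b) z = quad A B C a b (r * z) / r := by
  have hs := sqrt_sq_ofReal hr.1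
  have hs0 : ((√r : ℝ) : ℂ) ≠ 0 := by exact_mod_cast (Real.sqrt_pos.mpr hr.1).ne'
  rw [quad, quad]
  simp only [sesq, dilLift, map_div₀, Complex.conj_ofReal]
  generalize (r : ℂ) * z = x
  rw [← hs]
  field_simp

lemma quadD_dilLift (h : IsUnimodular a b) (hr : r ∈ Ioo (0 : ℝ) 1)
    (hz : z ∈ closedBall (0 : ℂ) 1) :
    quadD A B C (dilLift r a) (dilLift r b) z = quadD A B C a b (r * z) := by
  have hs0 : ((√r : ℝ) : ℂ) ≠ 0 := by exact_mod_cast (Real.sqrt_pos.mpr hr.1).ne'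
  rw [quadD, quadD, (h.deriv_dilLift hr hz).1, (h.deriv_dilLift hr hz).2]
  simp only [sesq, dilLift, map_div₀, Complex.conj_ofReal]
  field_simp

lemma quadDD_dilLift (h : IsUnimodular a b) (hr : r ∈ Ioo (0 : ℝ) 1)
    (hz : z ∈ closedBall (0 : ℂ) 1) :
    quadDD A B C (dilLift r a) (dilLift r b) z = r * quadDD A B C a b (r * z) := by
  have hs := sqrt_sq_ofReal hr.1
  rw [quadDD, quadDD, (h.deriv_dilLift hr hz).1, (h.deriv_dilLift hr hz).2]
  simp only [sesq, map_mul, Complex.conj_ofReal]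
  generalize (r : ℂ) * z = x
  rw [← hs]
  ring

lemma continuousOn_sesq {X : Type*} [TopologicalSpace X] {S : Set X} {x y x' y' : X → ℂ}
    (hx : ContinuousOn x S) (hy : ContinuousOn y S) (hx' : ContinuousOn x' S)
    (hy' : ContinuousOn y' S) :
    ContinuousOn (fun t => sesq A B C (x t) (y t) (x' t) (y' t)) S := by
  have c1 := Complex.continuous_conj.comp_continuousOn hx'
  have c2 := Complex.continuous_conj.comp_continuousOn hy'
  simp only [Function.comp_def] at c1 c2
  unfold sesq
  fun_prop

lemma IsUnimodular.continuousOn_quad (h : IsUnimodular a b) :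
    ContinuousOn (quad A B C a b) (ball 0 1) ∧ ContinuousOn (quadD A B C a b) (ball 0 1) ∧
      ContinuousOn (quadDD A B C a b) (ball 0 1) := by
  have c1 := h.left.continuousOn
  have c2 := h.right.continuousOn
  have c3 := (h.left.deriv isOpen_ball).continuousOn
  have c4 := (h.right.deriv isOpen_ball).continuousOn
  exact ⟨continuousOn_sesq c1 c2 c1 c2, continuousOn_sesq c3 c4 c1 c2,
    continuousOn_sesq c3 c4 c3 c4⟩

end

/-! ### The global estimate -/

/-- The dilated forms extend continuously to the closed disk with `Q(v, v)` negative on the circle,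
so `s + c u` falls to `-∞` there. If it exceeds `c M` somewhere it has an interior maximum, where `s
≤ 0` and `u ≤ M` give a contradiction. -/
lemma IsUnimodular.depth_dilLift_le {A : ℝ} {B : ℂ} {C : ℝ} {a b : ℂ → ℂ} {c r K M : ℝ}
    (h : IsUnimodular a b) (hr : r ∈ Ioo (0 : ℝ) 1) (hc : 0 ≤ c) (hKc : 2 * K < 2 + c)
    (hK : ∀ z ∈ ball (0 : ℂ) 1, ‖potential a b z‖ * (1 - ‖z‖ ^ 2) ^ 2 ≤ 2 * K)
    (hneg : ∀ z ∈ ball (0 : ℂ) 1, r ≤ ‖z‖ → (quad A B C a b z).re < 0)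
    (hM : ∀ z ∈ ball (0 : ℂ) 1, horoDepthD A B C (EpsteinPoincare.dilLift r a)
      (EpsteinPoincare.dilLift r b) z = 0 →
      (epsteinDepth A B C (EpsteinPoincare.dilLift r a) (EpsteinPoincare.dilLift r b) z).re ≤ 0 →
      (horoDepth A B C (EpsteinPoincare.dilLift r a) (EpsteinPoincare.dilLift r b) z).re ≤ M)
    {z : ℂ} (hz : z ∈ ball (0 : ℂ) 1) :
    (epsteinDepth A B C (EpsteinPoincare.dilLift r a) (EpsteinPoincare.dilLift r b) z).re +
      c * (horoDepth A B C (EpsteinPoincare.dilLift r a) (EpsteinPoincare.dilLift r b) z).re ≤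
      c * M := by
  set α := EpsteinPoincare.dilLift r a with hα
  set β := EpsteinPoincare.dilLift r b with hβ
  have hu : IsUnimodular α β := h.dilLift hr
  set G : ℂ → ℝ := fun z => (epsteinDepth A B C α β z).re + c * (horoDepth A B C α β z).re with hG
  -- This is `(1 - |z|²) (G - c M)` with denominators cleared, hence continuous up to the circle,
  -- where only the term `(2 + c) Q(v, v) / r` remains.
  set Φ : ℂ → ℝ := fun z => (discW z ^ 2 * (r * quadDD A B C a b (r * z)) +
    discW z * (z * quadD A B C a b (r * z) + conj (z * quadD A B C a b (r * z))) +
    (1 + z * conj z + c) * (quad A B C a b (r * z) / r) - c * M * discW z).re with hΦ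
  have hΦG : ∀ z ∈ ball (0 : ℂ) 1, Φ z = (1 - ‖z‖ ^ 2) * (G z - c * M) := by
    intro z hz
    have hz' := ball_subset_closedBall hz
    have hw := discW_ne_zero hz
    have e : (((1 - ‖z‖ ^ 2) * (G z - c * M) : ℝ) : ℂ) =
        discW z ^ 2 * (r * quadDD A B C a b (r * z)) +
      discW z * (z * quadD A B C a b (r * z) + conj (z * quadD A B C a b (r * z))) +
      (1 + z * conj z + c) * (quad A B C a b (r * z) / r) - c * M * discW z := by
      rw [Complex.ofReal_mul, ← discW_eq, hG]
      push_cast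
      rw [ofReal_re_epsteinDepth, ofReal_re_horoDepth, epsteinDepth, horoDepth, hα, hβ,
        quad_dilLift hr, quadD_dilLift h hr hz', quadDD_dilLift h hr hz']
      field_simp
      ring
    rw [hΦ]
    simp only
    rw [← e, Complex.ofReal_re]
  have hmaps : MapsTo (fun z : ℂ => (r : ℂ) * z) (closedBall 0 1) (ball 0 1) :=
    fun z hz => mul_mem_ball hr hz
  have hΦc : ContinuousOn Φ (closedBall 0 1) := by
    have hm : ContinuousOn (fun z : ℂ => (r : ℂ) * z) (closedBall 0 1) := by fun_prop
    obtain ⟨k1, k2, k3⟩ := h.continuousOn_quad (A := A) (B := B) (C := C)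
    have c1 := k1.comp hm hmaps
    have c2 := k2.comp hm hmaps
    have c3 := k3.comp hm hmaps
    have c4 := Complex.continuous_conj.comp_continuousOn (continuousOn_id.mul c2)
    have c5 := Complex.continuous_conj
    have cw : Continuous discW := by unfold discW; fun_prop
    simp only [Function.comp_def, Pi.mul_def, id] at c1 c2 c3 c4
    exact Complex.continuous_re.comp_continuousOn (by fun_prop)
  set S := closedBall (0 : ℂ) 1 ∩ Φ ⁻¹' Ici 0 with hS
  have hScompact : IsCompact S := by
    refine (isCompact_closedBall (0 : ℂ) 1).of_isClosed_subset ?_ inter_subset_left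
    exact hΦc.preimage_isClosed_of_isClosed isClosed_closedBall isClosed_Ici
  have hSball : S ⊆ ball 0 1 := by
    rintro x ⟨hx1, hx2⟩
    rw [mem_closedBall_zero_iff] at hx1
    rw [mem_ball_zero_iff]
    refine lt_of_le_of_ne hx1 fun hx => ?_
    have hw : discW x = 0 := by rw [discW_eq, hx]; simp
    have hxx : x * conj x = 1 := by rw [discW] at hw; linear_combination -hw
    have hq := hneg (r * x) (hmaps (by simpa using hx1)) (by
      rw [norm_mul, hx, Complex.norm_real, Real.norm_of_nonneg hr.1.le, mul_one])
    have hΦx : Φ x = (2 + c) / r * (quad A B C a b (r * x)).re := by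
      rw [hΦ]
      simp only
      rw [hw, hxx]
      have : (0 : ℂ) ^ 2 * (r * quadDD A B C a b (r * x)) +
        0 * (x * quadD A B C a b (r * x) + conj (x * quadD A B C a b (r * x))) +
        (1 + 1 + c) * (quad A B C a b (r * x) / r) - c * M * 0 =
        (((2 + c) / r : ℝ) : ℂ) * quad A B C a b (r * x) := by
        push_cast
        ring
      rw [this, Complex.re_ofReal_mul]
    have h0 : 0 ≤ Φ x := hx2
    rw [hΦx] at h0
    have : 0 < (2 + c) / r := div_pos (by linarith) hr.1
    nlinarith
  by_contra! hcon
  have hzS : z ∈ S := by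
    refine ⟨ball_subset_closedBall hz, ?_⟩
    rw [mem_preimage, hΦG z hz, mem_Ici]
    exact mul_nonneg (one_sub_norm_sq_pos hz).le (by rw [hG]; simp only; linarith)
  have hGc : ContinuousOn G S := by
    have : ContinuousOn (fun z => Φ z / (1 - ‖z‖ ^ 2) + c * M) S := by
      refine ((hΦc.mono inter_subset_left).div (by fun_prop) ?_).add continuousOn_const
      intro x hx
      exact (one_sub_norm_sq_pos (hSball hx)).ne'
    refine this.congr fun x hx => ?_
    have := (one_sub_norm_sq_pos (hSball hx)).ne'
    simp only [hΦG x (hSball hx)]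
    field_simp
    ring
  obtain ⟨z₀, hz₀S, hz₀⟩ := hScompact.exists_isMaxOn ⟨z, hzS⟩ hGc
  have hz₀b := hSball hz₀S
  have hle : G z ≤ G z₀ := hz₀ hzS
  have hmax : IsLocalMax G z₀ := by
    filter_upwards [isOpen_ball.mem_nhds hz₀b] with x hx
    by_cases hxS : x ∈ S
    · exact hz₀ hxS
    · have h1 : Φ x < 0 := by
        by_contra! h0
        exact hxS ⟨ball_subset_closedBall hx, h0⟩
      rw [hΦG x hx] at h1
      have h2 := one_sub_norm_sq_pos hx
      have h3 : G x - c * M < 0 := by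
        by_contra! h4
        exact absurd h1 (not_lt.mpr (mul_nonneg h2.le h4))
      have h5 : c * M < G z := hcon
      linarith
  have hl : ‖potential α β z₀‖ * (1 - ‖z₀‖ ^ 2) ^ 2 < 2 + c := by
    rw [hα, hβ, potential_dilLift h hr hz₀b, norm_mul, norm_pow, Complex.norm_real,
      Real.norm_of_nonneg hr.1.le]
    have h1 := hK _ (mul_mem_ball hr (ball_subset_closedBall hz₀b))
    have h2 := one_sub_norm_sq_pos hz₀b
    have h3 : 1 - ‖z₀‖ ^ 2 ≤ 1 - ‖(r : ℂ) * z₀‖ ^ 2 := by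
      rw [norm_mul, Complex.norm_real, Real.norm_of_nonneg hr.1.le, mul_pow]
      have : r ^ 2 ≤ 1 := by nlinarith [hr.1, hr.2]
      nlinarith [sq_nonneg ‖z₀‖]
    have h4 : r ^ 2 ≤ 1 := by nlinarith [hr.1, hr.2]
    calc r ^ 2 * ‖potential a b (r * z₀)‖ * (1 - ‖z₀‖ ^ 2) ^ 2
        ≤ 1 * ‖potential a b (r * z₀)‖ * (1 - ‖(r : ℂ) * z₀‖ ^ 2) ^ 2 := by gcongr
      _ = ‖potential a b (r * z₀)‖ * (1 - ‖(r : ℂ) * z₀‖ ^ 2) ^ 2 := by ring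
      _ ≤ 2 * K := h1
      _ < 2 + c := hKc
  obtain ⟨hP, hs⟩ := epsteinDepth_nonpos_of_isLocalMax hu hz₀b hl hmax
  have h1 := hM z₀ hz₀b hP hs
  have h2 : c * M < G z₀ := lt_of_lt_of_le hcon hle
  have h3 : G z₀ ≤ c * M := by
    rw [hG]
    simp only
    nlinarith [mul_le_mul_of_nonneg_left h1 hc]
  linarith

lemma epsteinDepth_mul_horoDepth_re {A : ℝ} {B : ℂ} {C : ℝ} {a b : ℂ → ℂ} {z : ℂ}
    (h : IsUnimodular a b) (hz : z ∈ ball (0 : ℂ) 1) :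
    ((epsteinDepth A B C a b z).re - (horoDepth A B C a b z).re) * (horoDepth A B C a b z).re =
      ‖horoDepthD A B C a b z‖ ^ 2 * (1 - ‖z‖ ^ 2) ^ 2 - (‖B‖ ^ 2 - A * C) := by
  have h1 := epsteinDepth_mul_horoDepth (A := A) (B := B) (C := C) h hz
  rw [← ofReal_re_epsteinDepth, ← ofReal_re_horoDepth, Complex.mul_conj, Complex.mul_conj,
    Complex.normSq_eq_norm_sq, Complex.normSq_eq_norm_sq, discW_eq] at h1
  have h2 : ((epsteinDepth A B C a b z).re - (horoDepth A B C a b z).re) *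
      (horoDepth A B C a b z).re - (1 - ‖z‖ ^ 2) ^ 2 * ‖horoDepthD A B C a b z‖ ^ 2 =
      A * C - ‖B‖ ^ 2 := by exact_mod_cast h1
  linarith

/-- The estimate of `depth_dilLift_le` for the lift itself. -/
lemma IsUnimodular.depth_le {A : ℝ} {B : ℂ} {C : ℝ} {a b : ℂ → ℂ} {c K M r₀ : ℝ}
    (h : IsUnimodular a b) (hc : 0 ≤ c) (hKc : 2 * K < 2 + c)
    (hK : ∀ z ∈ ball (0 : ℂ) 1, ‖potential a b z‖ * (1 - ‖z‖ ^ 2) ^ 2 ≤ 2 * K)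
    (hr₀ : r₀ < 1)
    (hneg : ∀ z ∈ ball (0 : ℂ) 1, r₀ ≤ ‖z‖ → (quad A B C a b z).re < 0)
    (hM : ∀ r ∈ Ioo (0 : ℝ) 1, ∀ z ∈ ball (0 : ℂ) 1, ∀ s ≤ 0,
      (s - (horoDepth A B C (EpsteinPoincare.dilLift r a) (EpsteinPoincare.dilLift r b) z).re) *
        (horoDepth A B C (EpsteinPoincare.dilLift r a) (EpsteinPoincare.dilLift r b) z).re =
        -(‖B‖ ^ 2 - A * C) →
      (horoDepth A B C (EpsteinPoincare.dilLift r a) (EpsteinPoincare.dilLift r b) z).re ≤ M)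
    {z : ℂ} (hz : z ∈ ball (0 : ℂ) 1) :
    (epsteinDepth A B C a b z).re + c * (horoDepth A B C a b z).re ≤ c * M := by
  have hz' := ball_subset_closedBall hz
  obtain ⟨k1, k2, k3⟩ := h.continuousOn_quad (A := A) (B := B) (C := C)
  -- The left side for the dilated lift as an explicit function of `r`, continuous at `r = 1`, so
  -- the estimate passes to the limit.
  set F : ℝ → ℝ := fun r => (discW z * (r * quadDD A B C a b (r * z)) +
    z * quadD A B C a b (r * z) + conj (z * quadD A B C a b (r * z)) +
    (1 + z * conj z) / discW z * (quad A B C a b (r * z) / r)).re +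
    c * (quad A B C a b (r * z) / r / discW z).re with hF
  have hF1 : F 1 = (epsteinDepth A B C a b z).re + c * (horoDepth A B C a b z).re := by
    simp [hF, epsteinDepth, horoDepth]
  have hFc : ContinuousAt F 1 := by
    have hm : ContinuousAt (fun r : ℝ => (r : ℂ) * z) 1 := by fun_prop
    have hz1 : ((1 : ℝ) : ℂ) * z ∈ ball (0 : ℂ) 1 := by simpa using hz
    have c1 : ContinuousAt (fun r : ℝ => quad A B C a b (r * z)) 1 :=
      ContinuousAt.comp (f := fun r : ℝ => (r : ℂ) * z)
        (k1.continuousAt (isOpen_ball.mem_nhds hz1)) hm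
    have c2 : ContinuousAt (fun r : ℝ => quadD A B C a b (r * z)) 1 :=
      ContinuousAt.comp (f := fun r : ℝ => (r : ℂ) * z)
        (k2.continuousAt (isOpen_ball.mem_nhds hz1)) hm
    have c3 : ContinuousAt (fun r : ℝ => quadDD A B C a b (r * z)) 1 :=
      ContinuousAt.comp (f := fun r : ℝ => (r : ℂ) * z)
        (k3.continuousAt (isOpen_ball.mem_nhds hz1)) hm
    have cr : ContinuousAt (fun r : ℝ => (r : ℂ)) 1 := Complex.continuous_ofReal.continuousAt
    have c4 : ContinuousAt (fun r : ℝ => conj (z * quadD A B C a b (r * z))) 1 :=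
      Complex.continuous_conj.continuousAt.comp (continuousAt_const.mul c2)
    have c5 : ContinuousAt (fun r : ℝ => quad A B C a b (r * z) / r) 1 :=
      c1.div cr (by simp)
    have d1 : ContinuousAt (fun r : ℝ => discW z * (r * quadDD A B C a b (r * z)) +
      z * quadD A B C a b (r * z) + conj (z * quadD A B C a b (r * z)) +
      (1 + z * conj z) / discW z * (quad A B C a b (r * z) / r)) 1 :=
      (((continuousAt_const.mul (cr.mul c3)).add (continuousAt_const.mul c2)).add c4).add
        (continuousAt_const.mul c5)
    have d2 : ContinuousAt (fun r : ℝ => quad A B C a b (r * z) / r / discW z) 1 :=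
      c5.div_const _
    exact (Complex.continuous_re.continuousAt.comp d1).add
      (continuousAt_const.mul (Complex.continuous_re.continuousAt.comp d2))
  rw [← hF1]
  refine le_of_tendsto (hFc.tendsto.mono_left (nhdsWithin_le_nhds (s := Iio 1))) ?_
  have hev : ∀ᶠ r : ℝ in 𝓝[<] 1, max r₀ 0 < r ∧ r < 1 := by
    filter_upwards [Ioo_mem_nhdsLT (show max r₀ 0 < 1 from max_lt hr₀ one_pos)] with r hr
    exact hr
  filter_upwards [hev] with r hr
  have hr' : r ∈ Ioo (0 : ℝ) 1 := ⟨lt_of_le_of_lt (le_max_right _ _) hr.1, hr.2⟩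
  have h1 := h.depth_dilLift_le (A := A) (B := B) (C := C) (M := M) hr' hc hKc hK
    (fun x hx hrx => hneg x hx (((le_max_left _ _).trans hr.1.le).trans hrx))
    -- At a critical point of `u` the gradient term drops out of `epsteinDepth_mul_horoDepth_re`.
    (fun x hx hP hs => hM r hr' x hx _ hs (by
      rw [epsteinDepth_mul_horoDepth_re (h.dilLift hr') hx, hP]; simp)) hz
  rw [epsteinDepth, horoDepth, quad_dilLift hr', quadD_dilLift h hr' hz',
    quadDD_dilLift h hr' hz'] at h1
  exact h1

/-! ### The Epstein point in terms of a lift -/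

/-- The Hermitian pairing of `√w (x' + z̄ x / w)`, `x / √w` with the same vector of `y`, where
`w = 1 - |z|²`. -/
def frameForm (z x x' y y' : ℂ) : ℂ :=
  discW z * x' * conj y' + z * x' * conj y + conj z * x * conj y'
    + (1 + z * conj z) / discW z * x * conj y

lemma conj_frameForm (z x x' y y' : ℂ) :
    conj (frameForm z x x' y y') = frameForm z y y' x x' := by
  simp only [frameForm, map_add, map_mul, map_div₀, map_one, conj_discW, Complex.conj_conj]
  ring

lemma epsteinDepth_eq_frameForm (A : ℝ) (B : ℂ) (C : ℝ) (a b : ℂ → ℂ) (z : ℂ) :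
    epsteinDepth A B C a b z =
      A * frameForm z (a z) (deriv a z) (a z) (deriv a z) +
      conj B * frameForm z (a z) (deriv a z) (b z) (deriv b z) +
      B * frameForm z (b z) (deriv b z) (a z) (deriv a z) +
      C * frameForm z (b z) (deriv b z) (b z) (deriv b z) := by
  rw [epsteinDepth, quadD, quad, quadDD, map_mul, conj_sesq]
  simp only [sesq, frameForm]
  ring

/-- The entries form a Gram matrix `M M*` where `M` has determinant equal to the Wronskian. With
`frameForm_self` this yields a positive matrix of determinant 1, that is, a point of the hyperboloid
model. -/
lemma frameForm_det {a b : ℂ → ℂ} {z : ℂ} (h : IsUnimodular a b) (hz : z ∈ ball (0 : ℂ) 1) :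
    frameForm z (a z) (deriv a z) (a z) (deriv a z) *
      frameForm z (b z) (deriv b z) (b z) (deriv b z) -
      frameForm z (a z) (deriv a z) (b z) (deriv b z) *
      frameForm z (b z) (deriv b z) (a z) (deriv a z) = 1 := by
  have hw := discW_ne_zero hz
  have h1 := h.wronskian z hz
  have h2 := congrArg conj h1
  simp only [map_sub, map_mul, map_one] at h2
  have h3 : (deriv a z * b z - a z * deriv b z) *
    (conj (deriv a z) * conj (b z) - conj (a z) * conj (deriv b z)) = 1 := by
    rw [h1, h2, mul_one]
  rw [← h3]
  simp only [frameForm]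
  have hwx : discW z = 1 - z * conj z := rfl
  generalize discW z = w at hw hwx ⊢
  field_simp
  rw [hwx]
  ring

lemma frameForm_self {z x x' : ℂ} (hz : z ∈ ball (0 : ℂ) 1) :
    frameForm z x x' x x' =
      (((‖discW z * x' + conj z * x‖ ^ 2 + ‖x‖ ^ 2) / (1 - ‖z‖ ^ 2) : ℝ) : ℂ) := by
  have hw := discW_ne_zero hz
  push_cast
  rw [← Complex.conj_mul', ← Complex.conj_mul', ← Complex.conj_mul',
    show (1 : ℂ) - conj z * z = discW z by rw [discW, mul_comm]]
  simp only [map_add, map_mul, conj_discW, Complex.conj_conj, frameForm]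
  field_simp
  ring

section

variable {A : ℝ} {B : ℂ} {C : ℝ} {a b : ℂ → ℂ} {z e : ℂ} {t : ℝ}

lemma hasDerivAt_horoDepth_line (h : IsUnimodular a b) (hz : z + t * e ∈ ball (0 : ℂ) 1) :
    HasDerivAt (fun t : ℝ => horoDepth A B C a b (z + t * e))
      (e * horoDepthD A B C a b (z + t * e) + conj (e * horoDepthD A B C a b (z + t * e))) t := by
  have hw := discW_ne_zero hz
  have h1 := (hasDerivAt_quad_line (A := A) (B := B) (C := C) h hz).fun_div
    (hasDerivAt_discW_line (z := z) (e := e) (t := t)) hw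
  refine h1.congr_deriv ?_
  generalize z + t * e = x at hw ⊢
  simp only [horoDepthD, map_add, map_mul, map_div₀, map_pow, conj_quad, conj_discW,
    Complex.conj_conj]
  field_simp
  ring

lemma differentiableAt_horoDepth (h : IsUnimodular a b) (hz : z ∈ ball (0 : ℂ) 1) :
    DifferentiableAt ℝ (fun y => (horoDepth A B C a b y).re) z := by
  have da : DifferentiableAt ℝ a z := (h.hasDerivAt_left hz).differentiableAt.restrictScalars ℝ
  have db : DifferentiableAt ℝ b z := (h.hasDerivAt_right hz).differentiableAt.restrictScalars ℝ
  have ca : DifferentiableAt ℝ (fun y => conj (a y)) z := da.star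
  have cb : DifferentiableAt ℝ (fun y => conj (b y)) z := db.star
  have h1 : DifferentiableAt ℝ (fun y => quad A B C a b y) z := by
    unfold quad sesq
    exact ((((da.const_mul (A : ℂ)).fun_mul ca).fun_add
      ((da.const_mul (conj B)).fun_mul cb)).fun_add
      ((db.const_mul B).fun_mul ca)).fun_add ((db.const_mul (C : ℂ)).fun_mul cb)
  have h2 : DifferentiableAt ℝ (fun y => (quad A B C a b y).re) z :=
    Complex.reCLM.differentiableAt.comp z h1
  have h3 : DifferentiableAt ℝ (fun y : ℂ => 1 - ‖y‖ ^ 2) z :=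
    (differentiableAt_fun_id.norm_sq ℝ).const_sub 1
  have h4 := h2.mul (h3.inv (one_sub_norm_sq_pos hz).ne')
  refine h4.congr_of_eventuallyEq (Eventually.of_forall fun y => ?_)
  simp only [horoDepth, discW_eq, Complex.div_ofReal_re]
  rfl

lemma hasFDerivAt_horoDepth_zero (h : IsUnimodular a b) (hz : z ∈ ball (0 : ℂ) 1)
    (hP : horoDepthD A B C a b z = 0) :
    HasFDerivAt (fun y => (horoDepth A B C a b y).re) (0 : ℂ →L[ℝ] ℝ) z := by
  have hd := (differentiableAt_horoDepth (A := A) (B := B) (C := C) h hz).hasFDerivAt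
  have h0 : fderiv ℝ (fun y => (horoDepth A B C a b y).re) z = 0 := by
    refine ContinuousLinearMap.ext fun e => ?_
    have hz0 : z + ((0 : ℝ) : ℂ) * e = z := by simp
    have h1 := hasDerivAt_horoDepth_line (A := A) (B := B) (C := C) (e := e) (t := 0) h
      (by rwa [hz0])
    have h2 := Complex.reCLM.hasFDerivAt.comp_hasDerivAt (0 : ℝ) h1
    have hd' := hd
    rw [← hz0] at hd'
    have h3 := hd'.comp_hasDerivAt (0 : ℝ) (hasDerivAt_line z e 0)
    have h4 := h3.unique h2
    rw [hz0, hP] at h4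
    simpa using h4
  rwa [h0] at hd

end

/-- The linear functional of a Hermitian form `Q` at a point of hyperbolic space. -/
def halfSpaceForm (A : ℝ) (B : ℂ) (C : ℝ) (x : H3) : ℝ :=
  A * (‖x.z‖ ^ 2 + x.t ^ 2) + 2 * (conj B * x.z).re + C

/-- The Gram matrix `(P, Z, T)` represents the point `(Z / T, 1 / T)`. The Poincaré density is the
visual density from that point times `ψ²`, where `ψ` has value 1 and differential 0 at `z`; by
`eq_epsteinMap_iff` the point is the Epstein point. -/
lemma epsteinMap_depth {f : ℂ → OnePoint ℂ} {a b : ℂ → ℂ} {Ω : Set (OnePoint ℂ)}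
    (hf : IsConformalOnto f Ω) (h : IsLift f a b) {p : OnePoint ℂ} (hp : p ∉ Ω) {z : ℂ}
    (hz : z ∈ ball (0 : ℂ) 1) (hb : b z ≠ 0) (A : ℝ) (B : ℂ) (C : ℝ) :
    halfSpaceForm A B C
      (epsteinMap (fun u => Real.log (poincareDensity Ω u)) (a z / b z)) =
    (epsteinMap (fun u => Real.log (poincareDensity Ω u)) (a z / b z)).t *
      (epsteinDepth A B C a b z).re := by
  have hu := h.toIsUnimodular
  have hwp := one_sub_norm_sq_pos hz
  set T : ℝ := (‖discW z * deriv b z + conj z * b z‖ ^ 2 + ‖b z‖ ^ 2) / (1 - ‖z‖ ^ 2) with hT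
  set P : ℝ := (‖discW z * deriv a z + conj z * a z‖ ^ 2 + ‖a z‖ ^ 2) / (1 - ‖z‖ ^ 2) with hPdef
  set Z : ℂ := frameForm z (a z) (deriv a z) (b z) (deriv b z) with hZ
  have hTp : 0 < T := by
    have : 0 < ‖b z‖ := norm_pos_iff.mpr hb
    positivity
  have fT : frameForm z (b z) (deriv b z) (b z) (deriv b z) = T := frameForm_self hz
  have fP : frameForm z (a z) (deriv a z) (a z) (deriv a z) = P := frameForm_self hz
  have fZ : frameForm z (b z) (deriv b z) (a z) (deriv a z) = conj Z := (conj_frameForm ..).symm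
  have hdet : P * T = ‖Z‖ ^ 2 + 1 := by
    have h1 := frameForm_det hu hz
    rw [fT, fP, fZ, ← hZ, Complex.mul_conj, Complex.normSq_eq_norm_sq] at h1
    have h2 : P * T - ‖Z‖ ^ 2 = 1 := by exact_mod_cast h1
    linarith
  -- Completing the square with `P T = |Z|² + 1`: the form `(T, -Z, P)` is definite and is the
  -- reciprocal square root of the visual density up to `2 |b|²`.
  have hquad : ∀ y, b y ≠ 0 → (quad T (-Z) P a b y).re =
      T * ‖b y‖ ^ 2 * (‖a y / b y - Z / T‖ ^ 2 + (1 / T) ^ 2) := by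
    intro y hy
    have hTc : (T : ℂ) ≠ 0 := by exact_mod_cast hTp.ne'
    have e : quad T (-Z) P a b y =
        ((T * ‖b y‖ ^ 2 * (‖a y / b y - Z / T‖ ^ 2 + (1 / T) ^ 2) : ℝ) : ℂ) := by
      have hdc : (P : ℂ) * T = Z * conj Z + 1 := by
        rw [Complex.mul_conj, Complex.normSq_eq_norm_sq]
        exact_mod_cast hdet
      have hP' : (P : ℂ) = (Z * conj Z + 1) / T := by rw [eq_div_iff hTc, hdc]
      push_cast
      rw [← Complex.mul_conj', ← Complex.mul_conj', quad]
      have hcy : conj (b y) ≠ 0 := by simpa using hy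
      simp only [sesq, map_sub, map_div₀, Complex.conj_ofReal, map_neg, hP']
      field_simp
      ring
    rw [e, Complex.ofReal_re]
  set x₀ : H3 := ⟨Z / T, 1 / T, by positivity⟩ with hx₀
  have hmem : ∀ᶠ y in 𝓝 z, y ∈ ball (0 : ℂ) 1 ∧ b y ≠ 0 :=
    (isOpen_ball.eventually_mem hz).and ((hu.hasDerivAt_right hz).continuousAt.eventually_ne hb)
  set ψ : ℂ → ℝ := fun y => (horoDepth T (-Z) P a b y).re with hψ
  have hψq : ∀ y, ψ y = (quad T (-Z) P a b y).re / (1 - ‖y‖ ^ 2) := by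
    intro y
    rw [hψ]
    simp only [horoDepth, discW_eq, Complex.div_ofReal_re]
  have hψpos : ∀ y ∈ ball (0 : ℂ) 1, b y ≠ 0 → 0 < ψ y := by
    intro y hy hby
    rw [hψq, hquad y hby]
    have h1 := one_sub_norm_sq_pos hy
    have h2 : 0 < ‖b y‖ := norm_pos_iff.mpr hby
    positivity
  have hlog : ∀ y ∈ ball (0 : ℂ) 1, b y ≠ 0 → Real.log (poincareDensity Ω (a y / b y)) =
      Real.log (visualDensity x₀ (a y / b y)) + 2 * Real.log (ψ y) := by
    intro y hy hby
    have h1 := one_sub_norm_sq_pos hy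
    have h2 : 0 < ‖b y‖ := norm_pos_iff.mpr hby
    have h3 := hψpos y hy hby
    rw [poincareDensity_eq hf h hp hy hby, ← Real.log_rpow h3, ← Real.log_mul]
    · congr 1
      rw [hψq, hquad y hby, visualDensity, hx₀]
      simp only
      norm_cast
      have h4 : 0 < ‖a y / b y - Z / T‖ ^ 2 + (1 / T) ^ 2 := by positivity
      field_simp
    · rw [visualDensity]
      have : 0 < x₀.t := x₀.t_pos
      positivity
    · positivity
  have hcz : quad T (-Z) P a b z = discW z ∧ horoDepthD T (-Z) P a b z = 0 := by
    have hw := discW_ne_zero hz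
    have h1 := hu.wronskian z hz
    have h2 := congrArg conj h1
    simp only [map_sub, map_mul, map_one] at h2
    have h3 : (deriv a z * b z - a z * deriv b z) *
      (conj (deriv a z) * conj (b z) - conj (a z) * conj (deriv b z)) = 1 := by
      rw [h1, h2, mul_one]
    have e1 : quad T (-Z) P a b z = discW z := by
      rw [quad]
      simp only [sesq, map_neg]
      rw [← fZ, ← fT, ← fP, hZ]
      simp only [frameForm]
      linear_combination discW z * h3
    have e2 : quadD T (-Z) P a b z = -conj z := by
      rw [quadD]
      simp only [sesq, map_neg]
      rw [← fZ, ← fT, ← fP, hZ]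
      simp only [frameForm]
      linear_combination (-conj z) * h3
    refine ⟨e1, ?_⟩
    rw [horoDepthD, e1, e2]
    ring
  have hψ1 : ψ z = 1 := by
    rw [hψ]
    simp only [horoDepth, hcz.1, div_self (discW_ne_zero hz), Complex.one_re]
  have hψd : HasFDerivAt ψ (0 : ℂ →L[ℝ] ℝ) z := hasFDerivAt_horoDepth_zero hu hz hcz.2
  have hx : x₀ = epsteinMap (fun u => Real.log (poincareDensity Ω u)) (a z / b z) := by
    rw [eq_epsteinMap_iff]
    have hv : 0 < visualDensity x₀ (a z / b z) := by
      rw [visualDensity]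
      have : 0 < x₀.t := x₀.t_pos
      positivity
    constructor
    · rw [hlog z hz hb, hψ1, Real.log_one, mul_zero, add_zero, Real.exp_log hv]
      rfl
    · have hn : (1 : ℂ) / b z ^ 2 ≠ 0 := by simpa using hb
      have hs : HasStrictDerivAt (fun y => a y / b y) (1 / b z ^ 2) z := by
        have hdiff : DifferentiableOn ℂ (fun y => a y / b y) (ball 0 1 ∩ {y | b y ≠ 0}) :=
          fun y hy => (hu.hasDerivAt_div hy.1 hy.2).differentiableAt.differentiableWithinAt
        have := (hdiff.analyticAt hmem).hasStrictDerivAt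
        rwa [(hu.hasDerivAt_div hz hb).deriv] at this
      -- The local inverse of `a / b` carries the stationarity of `ψ` from the disk to the affine
      -- coordinate of `Ω`.
      have hg := (hs.to_localInverse hn).hasDerivAt
      have hr := hs.eventually_right_inverse hn
      have hl := (hs.eventually_left_inverse hn).self_of_nhds
      set g := hs.localInverse (fun y => a y / b y) (1 / b z ^ 2) z hn
      have hψg : HasFDerivAt ψ (0 : ℂ →L[ℝ] ℝ) (g (a z / b z)) := by rw [hl]; exact hψd
      have hc := hψg.comp (a z / b z) (hg.hasFDerivAt.restrictScalars ℝ)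
      have hc2 := (hc.log (by rw [Function.comp_apply, hl, hψ1]; exact one_ne_zero)).const_mul 2
      have hν := hasFDerivAt_log_visualDensity x₀ (a z / b z)
      have hsum := hν.add hc2
      have hgt : Tendsto g (𝓝 (a z / b z)) (𝓝 z) := by
        have := hg.continuousAt.tendsto
        rwa [hl] at this
      have hφ : (fun u => Real.log (poincareDensity Ω u)) =ᶠ[𝓝 (a z / b z)]
          ((fun u => Real.log (visualDensity x₀ u)) + fun u => 2 * Real.log ((ψ ∘ g) u)) := by
        filter_upwards [hr, hgt.eventually hmem] with u hu1 hu2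
        have := hlog (g u) hu2.1 hu2.2
        simp only [Pi.add_apply, Function.comp_apply]
        rwa [hu1] at this
      rw [hν.fderiv, (hsum.congr_of_eventuallyEq hφ).fderiv]
      simp
  rw [← hx, halfSpaceForm, epsteinDepth_eq_frameForm, fT, fP, fZ, ← hZ, hx₀]
  simp only [Complex.add_re, Complex.re_ofReal_mul, Complex.ofReal_re, norm_div,
    Complex.norm_real, Real.norm_of_nonneg hTp.le]
  have e1 : (conj B * (Z / T)).re = (conj B * Z).re / T := by
    rw [← mul_div_assoc, Complex.div_ofReal_re]
  have e2 : (B * conj Z).re = (conj B * Z).re := by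
    rw [← Complex.conj_re (B * conj Z), map_mul, Complex.conj_conj]
  rw [e1, e2]
  field_simp
  rw [← hdet]
  ring

/-- The Epstein–Poincaré point of `f z` in terms of a lift of `f`. -/
lemma epsteinPoincareMap_depth {f : ℂ → OnePoint ℂ} {a b : ℂ → ℂ} {Ω : Set (OnePoint ℂ)}
    (hf : IsConformalOnto f Ω) (h : IsLift f a b) {p : OnePoint ℂ} (hp : p ∉ Ω) {z : ℂ}
    (hz : z ∈ ball (0 : ℂ) 1) (A : ℝ) (B : ℂ) (C : ℝ) :
    halfSpaceForm A B C (epsteinPoincareMap Ω (f z)) =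
      (epsteinPoincareMap Ω (f z)).t * (epsteinDepth A B C a b z).re := by
  by_cases hb : b z = 0
  · have ha : a z ≠ 0 := (h.ne_zero hz).resolve_right (by simpa using hb)
    rw [(h.apply_eq_infty_iff hz).mpr hb]
    -- At infinity work in the chart `1/z`: the lift is swapped and the form is transported by
    -- exchanging `A` with `C` and conjugating `B`.
    have h1 := epsteinMap_depth (hf.sphereInv h) h.swap (p := sphereInv p)
      (by rwa [mem_preimage, sphereInv_sphereInv]) hz
      (by simpa [Complex.I_ne_zero] using ha) C (conj B) A
    have h0 : (0 * a z + Complex.I * b z) / (Complex.I * a z + 0 * b z) = 0 := by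
      rw [hb]; simp
    rw [h0] at h1
    have hswap : epsteinDepth C (conj B) A (fun z => 0 * a z + Complex.I * b z)
        (fun z => Complex.I * a z + 0 * b z) z = epsteinDepth A B C a b z := by
      have d1 : deriv (fun z => 0 * a z + Complex.I * b z) z = Complex.I * deriv b z := by simp
      have d2 : deriv (fun z => Complex.I * a z + 0 * b z) z = Complex.I * deriv a z := by simp
      rw [epsteinDepth_eq_frameForm, epsteinDepth_eq_frameForm, d1, d2]
      simp only [frameForm, map_mul, map_add, Complex.conj_I, map_zero, Complex.conj_conj]
      generalize (1 + z * conj z) / discW z = k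
      ring_nf
      rw [Complex.I_sq]
      ring
    rw [hswap] at h1
    change halfSpaceForm A B C (invIsometry (epsteinMap
      (fun u => Real.log (poincareDensity (sphereInv ⁻¹' Ω) u)) 0)) = (invIsometry (epsteinMap
      (fun u => Real.log (poincareDensity (sphereInv ⁻¹' Ω) u)) 0)).t * _
    generalize epsteinMap (fun u => Real.log (poincareDensity (sphereInv ⁻¹' Ω) u)) 0 = x at h1 ⊢
    have ht := x.t_pos
    have hN : 0 < ‖x.z‖ ^ 2 + x.t ^ 2 := by positivity
    simp only [halfSpaceForm, invIsometry, Complex.conj_conj] at h1 ⊢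
    set N := ‖x.z‖ ^ 2 + x.t ^ 2 with hNdef
    have e1 : (conj B * (conj x.z / (N : ℂ))).re = (B * x.z).re / N := by
      rw [← mul_div_assoc, Complex.div_ofReal_re, ← map_mul, Complex.conj_re]
    have e2 : ‖conj x.z / (N : ℂ)‖ ^ 2 + (x.t / N) ^ 2 = 1 / N := by
      rw [norm_div, RCLike.norm_conj, Complex.norm_real, Real.norm_of_nonneg hN.le, div_pow,
        div_pow, ← add_div, ← hNdef]
      field_simp
    rw [e1, e2]
    have : x.t / N * (epsteinDepth A B C a b z).re =
      (x.t * (epsteinDepth A B C a b z).re) / N := by ring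
    rw [this, ← h1]
    field_simp
    ring
  · rw [h.eq_proj z hz, proj_of_ne hb]
    exact epsteinMap_depth hf h hp hz hb A B C

/-! ### A bound for the Schwarzian derivative of univalent functions -/

/-- The image of a normalized univalent function contains no disk about `0` of radius larger
than `1`. -/
lemma le_one_of_ball_subset_image {N : ℂ → ℂ} (hN : DifferentiableOn ℂ N (ball 0 1))
    (hi : InjOn N (ball 0 1)) (h0 : N 0 = 0) (h1 : deriv N 0 = 1) {d : ℝ} (hd : 0 < d)
    (hsub : ball 0 d ⊆ N '' ball 0 1) : d ≤ 1 := by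
  have h00 : (0 : ℂ) ∈ ball (0 : ℂ) 1 := by simp
  have hF : ∀ x : ℂ, HasDerivAt (fun z : ℂ => (d : ℂ) * z) d x := fun x => by
    simpa using (hasDerivAt_id' x).const_mul (d : ℂ)
  have h2 := subordination (F := fun z => (d : ℂ) * z)
    (fun x _ => (hF x).differentiableAt.differentiableWithinAt) hN hi (by
      rintro _ ⟨x, hx, rfl⟩
      refine hsub ?_
      rw [mem_ball_zero_iff] at hx ⊢
      rw [norm_mul, Complex.norm_real, Real.norm_of_nonneg hd.le]
      nlinarith) h00 h00 (by simp [h0])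
  rw [(hF 0).deriv, h1] at h2
  simpa [abs_of_pos hd] using h2

/-- A normalized univalent function is bounded near `0` by a universal constant. -/
lemma norm_le_of_univalent {N : ℂ → ℂ} (hN : DifferentiableOn ℂ N (ball 0 1))
    (hi : InjOn N (ball 0 1)) (h0 : N 0 = 0) (h1 : deriv N 0 = 1) {z : ℂ} (hz : ‖z‖ < 1 / 16) :
    ‖N z‖ ≤ 20 := by
  have h00 : (0 : ℂ) ∈ ball (0 : ℂ) 1 := by simp
  set V := N '' ball (0 : ℂ) 1 with hV
  have hVo : IsOpen V := by
    rw [isOpen_iff_mem_nhds]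
    rintro _ ⟨x, hx, rfl⟩
    have hs : HasStrictDerivAt N (deriv N x) x :=
      (hN.analyticAt (isOpen_ball.mem_nhds hx)).hasStrictDerivAt
    rw [← hs.map_nhds_eq (deriv_ne_zero_of_injOn isOpen_ball hN hi hx)]
    exact image_mem_map (isOpen_ball.mem_nhds hx)
  have hVne : Vᶜ.Nonempty := by
    by_contra hcon
    rw [not_nonempty_iff_eq_empty, compl_empty_iff] at hcon
    have := le_one_of_ball_subset_image hN hi h0 h1 (d := 2) (by norm_num)
      (by rw [← hV, hcon]; exact subset_univ _)
    norm_num at this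
  -- The omitted value nearest to 0: the disk of radius `‖w‖` lies in the image, so `‖w‖ ≤ 1`.
  obtain ⟨w, hwV, hw⟩ := hVo.isClosed_compl.exists_infDist_eq_dist hVne 0
  have hw0 : w ≠ 0 := by
    rintro rfl
    exact hwV ⟨0, h00, h0⟩
  set d := ‖w‖ with hd
  have hdp : 0 < d := norm_pos_iff.mpr hw0
  rw [dist_zero_left] at hw
  have hsub : ball 0 d ⊆ V := by
    intro y hy
    by_contra hyV
    have h2 := infDist_le_dist_of_mem (x := (0 : ℂ)) (show y ∈ Vᶜ from hyV)
    rw [hw, dist_zero_left] at h2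
    rw [mem_ball_zero_iff] at hy
    linarith
  have hd1 : d ≤ 1 := le_one_of_ball_subset_image hN hi h0 h1 hdp hsub
  have hNw : ∀ x ∈ ball (0 : ℂ) 1, 1 - N x / w ≠ 0 := by
    intro x hx h
    have h2 : N x = w := by
      field_simp at h
      linear_combination -h
    exact hwV ⟨x, hx, h2⟩
  obtain ⟨k, hk, hk2, hk0⟩ := exists_sq_eq_of_ne_zero (g := fun x => 1 - N x / w)
    ((hN.div_const w).const_sub 1) hNw (c := 1) (by simp [h0])
  have hdc : (d : ℂ) ≠ 0 := by exact_mod_cast hdp.ne'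
  obtain ⟨φ, hφm, hφ, hφd⟩ := exists_subordination (F := fun x => (d : ℂ) * x)
    (differentiableOn_id.const_mul (d : ℂ)) hN hi (by
      rintro _ ⟨x, hx, rfl⟩
      refine hsub ?_
      rw [mem_ball_zero_iff] at hx ⊢
      rw [norm_mul, Complex.norm_real, Real.norm_of_nonneg hdp.le]
      nlinarith)
  have hφ0 : φ 0 = 0 := hi (hφm h00) h00 (by rw [hφ 0 h00, h0, mul_zero])
  -- `φ` parametrizes the preimage of the disk of radius `d`. There `k²` lies within distance 1 of
  -- 1, so `k` avoids the imaginary axis, and `k 0 = 1`.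
  have hre : ∀ x ∈ ball (0 : ℂ) 1, 0 < (k (φ x)).re := by
    have hc : ContinuousOn (fun x => (k (φ x)).re) (ball 0 1) := by
      refine Complex.continuous_re.comp_continuousOn (hk.continuousOn.comp ?_ hφm)
      exact fun x hx => (hφd x hx).continuousAt.continuousWithinAt
    have hne : ∀ x ∈ ball (0 : ℂ) 1, (k (φ x)).re ≠ 0 := by
      intro x hx hre0
      have h2 := hk2 _ (hφm hx)
      rw [hφ x hx] at h2
      have h3 : ‖(d : ℂ) * x / w‖ < 1 := by
        rw [mem_ball_zero_iff] at hx
        rw [norm_div, norm_mul, Complex.norm_real, Real.norm_of_nonneg hdp.le, ← hd,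
          mul_div_assoc, mul_comm, div_mul_cancel₀ _ hdp.ne']
        exact hx
      have h4 := congrArg Complex.re h2
      rw [sq, Complex.mul_re, hre0, Complex.sub_re, Complex.one_re] at h4
      have h5 := Complex.re_le_norm ((d : ℂ) * x / w)
      nlinarith [mul_self_nonneg (k (φ x)).im]
    intro x hx
    by_contra! hcon
    obtain ⟨y, hy, hy0⟩ := (convex_ball (0 : ℂ) 1).isPreconnected.intermediate_value hx h00 hc
      (show (0 : ℝ) ∈ Icc _ _ from ⟨hcon, by simp only [hφ0, hk0]; simp⟩)
    exact hne y hy hy0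
  -- If `k x` were this close to `-1`, then `|N x / w| ≤ (2 / 5) (12 / 5) < 1` would put `x` in the
  -- region where `k` has positive real part, which forces `|1 + k x| > 1`.
  have homit : ∀ x ∈ ball (0 : ℂ) 1, 2 / 5 ≤ ‖1 + k x‖ := by
    intro x hx
    by_contra! hcon
    have h2 : N x / w = (1 + k x) * (1 - k x) := by linear_combination hk2 x hx
    have h3 : ‖1 - k x‖ ≤ 12 / 5 := by
      calc ‖1 - k x‖ = ‖2 - (1 + k x)‖ := by congr 1; ring
        _ ≤ ‖(2 : ℂ)‖ + ‖1 + k x‖ := norm_sub_le _ _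
        _ ≤ 2 + 2 / 5 := by
            gcongr
            simp
        _ = 12 / 5 := by norm_num
    have h4 : ‖N x / w‖ < 1 := by
      rw [h2, norm_mul]
      nlinarith [norm_nonneg (1 + k x), norm_nonneg (1 - k x)]
    have hNd : N x / d ∈ ball (0 : ℂ) 1 := by
      rw [norm_div, ← hd] at h4
      rw [mem_ball_zero_iff, norm_div, Complex.norm_real, Real.norm_of_nonneg hdp.le]
      exact h4
    have h5 : φ (N x / d) = x := hi (hφm hNd) hx (by rw [hφ _ hNd]; field_simp)
    have h6 := hre _ hNd
    rw [h5] at h6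
    have h7 := Complex.re_le_norm (1 + k x)
    rw [Complex.add_re, Complex.one_re] at h7
    linarith
  have hne : ∀ x ∈ ball (0 : ℂ) 1, 1 + k x ≠ 0 := by
    intro x hx h
    have := homit x hx
    rw [h, norm_zero] at this
    norm_num at this
  -- `T` is bounded by `5 / 2` and equals `1 / 2` at 0. The Schwarz lemma with radius 3 gives `|T z|
  -- ≥ 1 / 2 - 3 / 16 = 5 / 16`, which bounds `k z` and then `N z`.
  set T : ℂ → ℂ := fun x => (1 + k x)⁻¹ with hT
  have hTd : DifferentiableOn ℂ T (ball 0 1) := (hk.const_add 1).inv hne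
  have hT0 : T 0 = 1 / 2 := by
    simp only [hT, hk0]
    norm_num
  have hTm : MapsTo T (ball 0 1) (closedBall (T 0) 3) := by
    intro x hx
    rw [mem_closedBall, dist_eq_norm, hT0]
    have h2 : ‖T x‖ ≤ 5 / 2 := by
      rw [hT]
      simp only [norm_inv]
      rw [inv_le_comm₀ (by linarith [homit x hx]) (by norm_num)]
      linarith [homit x hx]
    calc ‖T x - 1 / 2‖ ≤ ‖T x‖ + ‖(1 / 2 : ℂ)‖ := norm_sub_le _ _
      _ ≤ 5 / 2 + 1 / 2 := by
          gcongr
          simp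
      _ = 3 := by norm_num
  have hz1 : z ∈ ball (0 : ℂ) 1 := by
    rw [mem_ball_zero_iff]
    linarith
  have h2 := Complex.dist_le_div_mul_dist_of_mapsTo_ball hTd hTm hz1
  rw [hT0, dist_eq_norm, dist_zero_right] at h2
  have h3 : 5 / 16 ≤ ‖T z‖ := by
    have h4 : ‖(1 / 2 : ℂ)‖ ≤ ‖T z‖ + ‖T z - 1 / 2‖ := by
      calc ‖(1 / 2 : ℂ)‖ = ‖T z - (T z - 1 / 2)‖ := by congr 1; ring
        _ ≤ _ := norm_sub_le _ _
    have h5 : ‖(1 / 2 : ℂ)‖ = 1 / 2 := by simp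
    rw [h5] at h4
    linarith
  have h4 : ‖1 + k z‖ ≤ 16 / 5 := by
    have h5 : ‖T z‖ = ‖1 + k z‖⁻¹ := by rw [hT]; simp
    rw [h5, le_inv_comm₀ (by norm_num) (by linarith [homit z hz1])] at h3
    linarith
  have h5 : ‖1 - k z‖ ≤ 26 / 5 := by
    calc ‖1 - k z‖ = ‖2 - (1 + k z)‖ := by congr 1; ring
      _ ≤ ‖(2 : ℂ)‖ + ‖1 + k z‖ := norm_sub_le _ _
      _ ≤ 2 + 16 / 5 := by
          gcongr
          simp
      _ = 26 / 5 := by norm_num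
  have h6 : N z = w * ((1 + k z) * (1 - k z)) := by
    have := hk2 z hz1
    field_simp at this
    linear_combination this
  rw [h6, norm_mul, norm_mul, ← hd]
  calc d * (‖1 + k z‖ * ‖1 - k z‖) ≤ 1 * (16 / 5 * (26 / 5)) := by gcongr
    _ ≤ 20 := by norm_num

/-- A unimodular change of basis among the solutions of `y'' = λ y` leaves `λ` unchanged: this is
the Möbius invariance of the Schwarzian. -/
lemma potential_linear {a b : ℂ → ℂ} {z : ℂ} (h : IsUnimodular a b) (hz : z ∈ ball (0 : ℂ) 1)
    {p q r s : ℂ} (hdet : p * s - q * r = 1) :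
    potential (fun z => p * a z + q * b z) (fun z => r * a z + s * b z) z = potential a b z := by
  have hu := h.linear hdet
  have key : ∀ p q : ℂ, deriv (fun z => p * a z + q * b z) =ᶠ[𝓝 z]
      fun z => p * deriv a z + q * deriv b z := by
    intro p q
    filter_upwards [isOpen_ball.mem_nhds hz] with x hx
    exact (((h.hasDerivAt_left hx).const_mul p).add ((h.hasDerivAt_right hx).const_mul q)).deriv
  have key2 : ∀ p q : ℂ, deriv (deriv fun z => p * a z + q * b z) z =
      p * (potential a b z * a z) + q * (potential a b z * b z) := by
    intro p q
    rw [(key p q).deriv_eq]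
    exact (((h.hasDerivAt_deriv_left hz).const_mul p).add
      ((h.hasDerivAt_deriv_right hz).const_mul q)).deriv
  rw [potential, key2, key2, (key p q).self_of_nhds, (key r s).self_of_nhds]
  linear_combination potential a b z * (deriv a z * b z - a z * deriv b z) * hdet +
    potential a b z * h.wronskian z hz

/-- The potential of a normalized univalent quotient is bounded by a universal constant. -/
lemma exists_norm_potential_zero_le : ∃ M : ℝ, ∀ α β : ℂ → ℂ, IsUnimodular α β →
    (∀ z ∈ ball (0 : ℂ) 1, β z ≠ 0) → InjOn (fun z => α z / β z) (ball 0 1) →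
    ‖potential α β 0‖ ≤ M := by
  -- Cauchy's estimates for `N'''` and `N''` on the circle of radius `1 / 32`, where `|N| ≤ 20`,
  -- inserted into `S(N)(0) = N''' - (3 / 2) N''²`; the potential is `-S / 2`.
  refine ⟨((6 * 20 / (1 / 32) ^ 3) + 3 / 2 * (2 * 20 / (1 / 32) ^ 2) ^ 2) / 2, ?_⟩
  intro a b hab hb hinj
  have h00 : (0 : ℂ) ∈ ball (0 : ℂ) 1 := by simp
  have hb0 := hb 0 h00
  -- This matrix normalises the quotient so that it vanishes at 0 with derivative 1.
  have hdet : b 0 * (1 / b 0) - (-a 0) * 0 = 1 := by field_simp; ring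
  have hu := hab.linear hdet
  rw [← potential_linear hab h00 hdet]
  set α := fun z => b 0 * a z + -a 0 * b z with hα
  set β := fun z => 0 * a z + 1 / b 0 * b z with hβ
  have hβne : ∀ z ∈ ball (0 : ℂ) 1, β z ≠ 0 := by
    intro z hz
    simp only [hβ]
    simpa using ⟨hb0, hb z hz⟩
  have hα0 : α 0 = 0 := by simp only [hα]; ring
  have hβ0 : β 0 = 1 := by simp only [hβ]; field_simp; ring
  set N : ℂ → ℂ := fun z => α z / β z with hN
  have hNd : ∀ z ∈ ball (0 : ℂ) 1, HasDerivAt N (1 / β z ^ 2) z :=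
    fun z hz => hu.hasDerivAt_div hz (hβne z hz)
  have hNdiff : DifferentiableOn ℂ N (ball 0 1) :=
    fun z hz => (hNd z hz).differentiableAt.differentiableWithinAt
  have hNinj : InjOn N (ball 0 1) := by
    intro x hx y hy hxy
    refine hinj hx hy ?_
    have hbx := hb x hx
    have hby := hb y hy
    have hx' : N x = b 0 * (b 0 * (a x / b x) - a 0) := by
      simp only [hN, hα, hβ, zero_mul, zero_add]
      field_simp
      ring
    have hy' : N y = b 0 * (b 0 * (a y / b y) - a 0) := by
      simp only [hN, hα, hβ, zero_mul, zero_add]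
      field_simp
      ring
    rw [hx', hy'] at hxy
    have h1 := mul_left_cancel₀ hb0 hxy
    exact mul_left_cancel₀ hb0 (sub_left_inj.mp h1)
  have hN0 : N 0 = 0 := by simp only [hN, hα0, zero_div]
  have hN1 : deriv N 0 = 1 := by rw [(hNd 0 h00).deriv, hβ0]; simp
  have hsub : closedBall (0 : ℂ) (1 / 32) ⊆ ball 0 1 :=
    closedBall_subset_ball (by norm_num)
  have hcauchy : ∀ n : ℕ, ‖iteratedDeriv n N 0‖ ≤ n.factorial * 20 / (1 / 32) ^ n := by
    intro n
    refine Complex.norm_iteratedDeriv_le_of_forall_mem_sphere_norm_le n (by norm_num) ?_ ?_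
    · refine DifferentiableOn.diffContOnCl ?_
      rw [closure_ball _ (by norm_num)]
      exact hNdiff.mono hsub
    · intro z hz
      refine norm_le_of_univalent hNdiff hNinj hN0 hN1 ?_
      rw [mem_sphere_zero_iff_norm] at hz
      rw [hz]; norm_num
  have hs : schwarzian N 0 = -2 * potential α β 0 := hu.schwarzian_div h00 (hβne 0 h00)
  have hd1 := hNdiff.deriv isOpen_ball
  have hd2 := hd1.deriv isOpen_ball
  have h2 := hcauchy 2
  have h3 := hcauchy 3
  rw [iteratedDeriv_succ, iteratedDeriv_succ, iteratedDeriv_succ, iteratedDeriv_zero] at h3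
  rw [iteratedDeriv_succ, iteratedDeriv_succ, iteratedDeriv_zero] at h2
  have e : deriv (fun w => deriv (deriv N) w / deriv N w) 0 =
      deriv (deriv (deriv N)) 0 - deriv (deriv N) 0 ^ 2 := by
    have k1 := (hd2.differentiableAt (isOpen_ball.mem_nhds h00)).hasDerivAt
    have k2 := (hd1.differentiableAt (isOpen_ball.mem_nhds h00)).hasDerivAt
    have k3 := k1.fun_div k2 (by rw [hN1]; exact one_ne_zero)
    rw [k3.deriv, hN1]
    ring
  rw [schwarzian, e, hN1] at hs
  have hp : potential α β 0 =
      -(deriv (deriv (deriv N)) 0 - 3 / 2 * deriv (deriv N) 0 ^ 2) / 2 := by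
    linear_combination (1 / 2) * hs
  rw [hp, norm_div, norm_neg]
  have h4 : ‖deriv (deriv (deriv N)) 0 - 3 / 2 * deriv (deriv N) 0 ^ 2‖ ≤
      ‖deriv (deriv (deriv N)) 0‖ + 3 / 2 * ‖deriv (deriv N) 0‖ ^ 2 := by
    refine (norm_sub_le _ _).trans (le_of_eq ?_)
    rw [norm_mul, norm_pow]
    norm_num
  simp only [Nat.factorial] at h2 h3
  norm_num at h2 h3 ⊢
  have h5 : ‖deriv (deriv N) 0‖ ^ 2 ≤ 40960 ^ 2 := by gcongr
  linarith

/-- The hyperbolic sup norm of the Schwarzian derivative of a univalent function is bounded by a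
universal constant. -/
lemma exists_norm_potential_le : ∃ M : ℝ, ∀ (f : ℂ → OnePoint ℂ) (a b : ℂ → ℂ), IsLift f a b →
    InjOn f (ball 0 1) → ∀ p ∉ f '' ball 0 1, ∀ z ∈ ball (0 : ℂ) 1,
    ‖potential a b z‖ * (1 - ‖z‖ ^ 2) ^ 2 ≤ M := by
  obtain ⟨M, hM⟩ := exists_norm_potential_zero_le
  refine ⟨M, fun f a b h hi p hp z hz => ?_⟩
  have h00 : (0 : ℂ) ∈ ball (0 : ℂ) 1 := by simp
  obtain ⟨c₁, c₂, c₃, c₄, hdet, hpc⟩ := exists_linear_form_of_point p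
  -- An automorphism moves `z` to the origin, and a linear change of lift then sends the omitted
  -- point to infinity.
  have hl := h.autLift hz
  have hne : ∀ x ∈ ball (0 : ℂ) 1, c₃ * autLift z a x + c₄ * autLift z b x ≠ 0 := fun x hx h0 =>
    hp ⟨diskAut z x, mapsTo_diskAut hz hx, by
      rw [show f (diskAut z x) = proj (autLift z a x) (autLift z b x) from hl.eq_proj x hx]
      exact hpc _ _ (hl.ne_zero hx) h0⟩
  have h1 := hM _ _ (hl.toIsUnimodular.linear hdet) hne (by
    intro x hx y hy hxy
    refine (bijOn_diskAut hz).injOn hx hy (hi (mapsTo_diskAut hz hx) (mapsTo_diskAut hz hy) ?_)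
    rw [show f (diskAut z x) = proj (autLift z a x) (autLift z b x) from hl.eq_proj x hx,
      show f (diskAut z y) = proj (autLift z a y) (autLift z b y) from hl.eq_proj y hy,
      proj_eq_proj_iff (hl.ne_zero hx) (hl.ne_zero hy)]
    simp only at hxy
    rw [div_eq_div_iff (hne x hx) (hne y hy)] at hxy
    linear_combination hxy - (autLift z a x * autLift z b y - autLift z a y * autLift z b x) * hdet)
  rw [potential_linear hl.toIsUnimodular h00 hdet, potential_autLift_zero h.toIsUnimodular hz,
    norm_mul, norm_pow, Complex.norm_real, Real.norm_of_nonneg (one_sub_norm_sq_pos hz).le] at h1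
  exact h1

/-! ### Round disks in the sphere -/

lemma sesq_self_re (A : ℝ) (B : ℂ) (C : ℝ) (x y : ℂ) :
    (sesq A B C x y x y).re = A * ‖x‖ ^ 2 + 2 * (conj B * (x * conj y)).re + C * ‖y‖ ^ 2 := by
  have h1 : A * x * conj x = ((A * ‖x‖ ^ 2 : ℝ) : ℂ) := by
    rw [mul_assoc, Complex.mul_conj, Complex.normSq_eq_norm_sq]; push_cast; ring
  have h2 : C * y * conj y = ((C * ‖y‖ ^ 2 : ℝ) : ℂ) := by
    rw [mul_assoc, Complex.mul_conj, Complex.normSq_eq_norm_sq]; push_cast; ring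
  have h3 : (B * y * conj x).re = (conj B * (x * conj y)).re := by
    rw [← Complex.conj_re]
    simp only [map_mul, Complex.conj_conj]
    congr 1
    ring
  rw [sesq, h1, h2, Complex.add_re, Complex.add_re, Complex.add_re, h3, Complex.ofReal_re,
    Complex.ofReal_re, mul_assoc (conj B)]
  ring

lemma proj_mem_idealDisk_iff {A : ℝ} {B : ℂ} {C : ℝ} {x y : ℂ} (h : x ≠ 0 ∨ y ≠ 0) :
    proj x y ∈ idealDisk A B C ↔ (sesq A B C x y x y).re ≤ 0 := by
  rw [sesq_self_re]
  by_cases hy : y = 0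
  · have hx : x ≠ 0 := h.resolve_right (by simpa using hy)
    have hxp : 0 < ‖x‖ ^ 2 := by positivity
    subst hy
    rw [proj_zero]
    change A ≤ 0 ↔ _
    simp only [map_zero, mul_zero, Complex.zero_re, norm_zero, add_zero]
    constructor <;> intro h <;> nlinarith
  · rw [proj_of_ne hy]
    change A * ‖x / y‖ ^ 2 + 2 * (conj B * (x / y)).re + C ≤ 0 ↔ _
    have hyp : 0 < ‖y‖ ^ 2 := by positivity
    have h1 : (conj B * (x * conj y)).re = (conj B * (x / y)).re * ‖y‖ ^ 2 := by
      rw [← Complex.re_mul_ofReal]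
      congr 1
      rw [← Complex.normSq_eq_norm_sq, ← Complex.mul_conj]
      field_simp
    have h2 : ‖x‖ ^ 2 = ‖x / y‖ ^ 2 * ‖y‖ ^ 2 := by
      rw [← mul_pow, ← norm_mul, div_mul_cancel₀ _ hy]
    rw [h1, h2, show
      A * (‖x / y‖ ^ 2 * ‖y‖ ^ 2) + 2 * ((conj B * (x / y)).re * ‖y‖ ^ 2) + C * ‖y‖ ^ 2
      = (A * ‖x / y‖ ^ 2 + 2 * (conj B * (x / y)).re + C) * ‖y‖ ^ 2 by ring]
    constructor <;> intro h <;> nlinarith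

lemma exists_eq_proj (p : OnePoint ℂ) : ∃ x y : ℂ, (x ≠ 0 ∨ y ≠ 0) ∧ p = proj x y := by
  induction p using OnePoint.rec with
  | infty => exact ⟨1, 0, by simp, (proj_zero 1).symm⟩
  | coe z => exact ⟨z, 1, by simp, (proj_one z).symm⟩

/-- The complement of a closed round disk is connected: two positive vectors of a Hermitian form
can be rotated so that the segment between them consists of positive vectors. -/
lemma isPreconnected_compl_idealDisk (A : ℝ) (B : ℂ) (C : ℝ) :
    IsPreconnected (idealDisk A B C)ᶜ := by
  refine isPreconnected_of_forall_pair fun p hp q hq => ?_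
  obtain ⟨x, y, hxy, rfl⟩ := exists_eq_proj p
  obtain ⟨x', y', hxy', rfl⟩ := exists_eq_proj q
  rw [mem_compl_iff, proj_mem_idealDisk_iff hxy, not_le] at hp
  rw [mem_compl_iff, proj_mem_idealDisk_iff hxy', not_le] at hq
  obtain ⟨e, he, hre⟩ : ∃ e : ℂ, ‖e‖ = 1 ∧ 0 ≤ (e * sesq A B C x' y' x y).re := by
    by_cases h0 : sesq A B C x' y' x y = 0
    · exact ⟨1, by simp, by simp [h0]⟩
    · refine ⟨conj (sesq A B C x' y' x y) / ‖sesq A B C x' y' x y‖, ?_, ?_⟩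
      · rw [norm_div, RCLike.norm_conj, Complex.norm_real, norm_norm, div_self]
        exact norm_ne_zero_iff.mpr h0
      · rw [div_mul_eq_mul_div, mul_comm, Complex.mul_conj, Complex.div_ofReal_re,
          Complex.ofReal_re]
        exact div_nonneg (Complex.normSq_nonneg _) (norm_nonneg _)
  have he0 : e ≠ 0 := by rw [← norm_ne_zero_iff, he]; exact one_ne_zero
  set F : ℝ → ℂ × ℂ := fun t => ((1 - t) * x + t * (e * x'), (1 - t) * y + t * (e * y')) with hF
  have hpos : ∀ t ∈ Icc (0 : ℝ) 1, 0 < (sesq A B C (F t).1 (F t).2 (F t).1 (F t).2).re := by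
    intro t ht
    have h1 : sesq A B C (F t).1 (F t).2 (F t).1 (F t).2 =
        ((1 - t) ^ 2 : ℝ) * sesq A B C x y x y +
        ((t * (1 - t) : ℝ) : ℂ) * (e * sesq A B C x' y' x y + conj (e * sesq A B C x' y' x y)) +
        ((t ^ 2 : ℝ) : ℂ) * (e * conj e) * sesq A B C x' y' x' y' := by
      rw [map_mul, conj_sesq]
      simp only [hF, sesq, map_add, map_mul, map_sub, map_one, Complex.conj_ofReal]
      push_cast
      ring
    have h2 : e * conj e = 1 := by
      rw [Complex.mul_conj, Complex.normSq_eq_norm_sq, he]; simp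
    rw [h1, h2, Complex.add_conj, mul_one, Complex.add_re, Complex.add_re,
      Complex.re_ofReal_mul, Complex.re_ofReal_mul, Complex.re_ofReal_mul, Complex.ofReal_re]
    have h3 : 0 ≤ t * (1 - t) * (2 * (e * sesq A B C x' y' x y).re) :=
      mul_nonneg (mul_nonneg ht.1 (by linarith [ht.2])) (by linarith)
    rcases eq_or_lt_of_le ht.1 with h | h
    · rw [← h] at h3 ⊢; simpa using hp
    · have h4 : 0 < t ^ 2 * (sesq A B C x' y' x' y').re := mul_pos (by positivity) hq
      have h5 : 0 ≤ (1 - t) ^ 2 * (sesq A B C x y x y).re := mul_nonneg (sq_nonneg _) hp.le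
      linarith
  have hne : ∀ t ∈ Icc (0 : ℝ) 1, (F t).1 ≠ 0 ∨ (F t).2 ≠ 0 := by
    intro t ht
    by_contra! h
    have := hpos t ht
    rw [h.1, h.2] at this
    simp [sesq] at this
  refine ⟨(fun t => proj (F t).1 (F t).2) '' Icc 0 1, ?_, ⟨0, by simp, by simp [hF]⟩,
    ⟨1, by simp, ?_⟩, ?_⟩
  · rintro _ ⟨t, ht, rfl⟩
    rw [mem_compl_iff, proj_mem_idealDisk_iff (hne t ht), not_le]
    exact hpos t ht
  · simp only [hF, Complex.ofReal_one, sub_self, zero_mul, zero_add, one_mul]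
    rw [proj_eq_proj_iff (by simpa [he0] using hxy') hxy']
    ring
  · refine isPreconnected_Icc.image _ fun t ht => ContinuousAt.continuousWithinAt ?_
    have hc : Continuous F := by fun_prop
    exact ContinuousAt.comp (f := F) (continuousAt_proj (hne t ht)) hc.continuousAt

lemma isClosed_idealDisk (A : ℝ) (B : ℂ) (C : ℝ) : IsClosed (idealDisk A B C) := by
  have hcl : IsClosed {z : ℂ | A * ‖z‖ ^ 2 + 2 * (conj B * z).re + C ≤ 0} :=
    isClosed_le (by fun_prop) continuous_const
  rw [← isOpen_compl_iff, OnePoint.isOpen_def]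
  refine ⟨fun h => ?_, ?_⟩
  · have hA : 0 < A := not_le.mp h
    refine IsCompact.of_isClosed_subset (isCompact_closedBall (0 : ℂ) ((2 * ‖B‖ + |C|) / A + 1))
      (by rw [← preimage_compl, compl_compl]; exact hcl) ?_
    intro z hz
    rw [← preimage_compl, compl_compl] at hz
    have hz' : A * ‖z‖ ^ 2 + 2 * (conj B * z).re + C ≤ 0 := hz
    rw [mem_closedBall_zero_iff]
    by_contra! hlt
    have h1 : -(‖B‖ * ‖z‖) ≤ (conj B * z).re := by
      have := Complex.abs_re_le_norm (conj B * z)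
      rw [norm_mul, RCLike.norm_conj] at this
      exact (abs_le.mp this).1
    have h2 := neg_abs_le C
    have h3 : 2 * ‖B‖ + |C| < A * ‖z‖ := by
      have : (2 * ‖B‖ + |C|) / A < ‖z‖ := by linarith
      rw [div_lt_iff₀ hA] at this
      linarith
    have h4 : 1 < ‖z‖ := by
      have : 0 ≤ (2 * ‖B‖ + |C|) / A := by positivity
      linarith
    nlinarith [abs_nonneg C]
  · rw [preimage_compl, isOpen_compl_iff]
    exact hcl

/-- On the opposite shifted disk the form is at least `δ (|x|² + |y|²)`, so the closed set lies in
the open complement of the original disk. -/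
lemma notMem_idealDisk_of_mem_shift {A : ℝ} {B : ℂ} {C δ : ℝ} (hδ : 0 < δ) {p : OnePoint ℂ}
    (hp : p ∈ idealDisk (-(A - δ)) (-B) (-(C - δ))) : p ∉ idealDisk A B C := by
  obtain ⟨x, y, hxy, rfl⟩ := exists_eq_proj p
  rw [proj_mem_idealDisk_iff hxy, sesq_self_re] at hp
  rw [proj_mem_idealDisk_iff hxy, sesq_self_re, not_le]
  rw [map_neg, neg_mul (conj B), Complex.neg_re] at hp
  have h1 : 0 < ‖x‖ ^ 2 + ‖y‖ ^ 2 := by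
    rcases hxy with h | h
    · have := norm_pos_iff.mpr h; positivity
    · have := norm_pos_iff.mpr h; positivity
  nlinarith

/-! ### Openness of conformal maps -/

lemma map_sphereInv_nhds (p : OnePoint ℂ) : map sphereInv (𝓝 p) = 𝓝 (sphereInv p) :=
  (Homeomorph.mk ⟨sphereInv, sphereInv, sphereInv_sphereInv, sphereInv_sphereInv⟩
    continuous_sphereInv continuous_sphereInv).map_nhds_eq p

lemma IsLift.map_nhds_eq_of_ne {f : ℂ → OnePoint ℂ} {a b : ℂ → ℂ} (h : IsLift f a b) {z : ℂ}
    (hz : z ∈ ball (0 : ℂ) 1) (hb : b z ≠ 0) : map f (𝓝 z) = 𝓝 (f z) := by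
  have hball := isOpen_ball.mem_nhds hz
  have hbc := (h.right.continuousOn.continuousAt hball)
  have hdiff : ∀ᶠ w in 𝓝 z, DifferentiableAt ℂ (fun w => a w / b w) w := by
    filter_upwards [hball, hbc.eventually_ne hb] with w hw hbw
    exact (h.hasDerivAt_div hw hbw).differentiableAt
  have han : AnalyticAt ℂ (fun w => a w / b w) z := by
    rw [Complex.analyticAt_iff_eventually_differentiableAt]
    exact hdiff
  have hs := han.hasStrictDerivAt
  rw [(h.hasDerivAt_div hz hb).deriv] at hs
  have h1 := hs.map_nhds_eq (one_div_ne_zero (pow_ne_zero 2 hb))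
  have h2 : f =ᶠ[𝓝 z] fun w => ((a w / b w : ℂ) : OnePoint ℂ) := by
    filter_upwards [hball, hbc.eventually_ne hb] with w hw hbw
    rw [h.eq_proj w hw, proj_of_ne hbw]
  rw [map_congr h2, h.eq_proj z hz, proj_of_ne hb, OnePoint.nhds_coe_eq, ← h1, map_map]
  rfl

lemma IsLift.map_nhds_eq {f : ℂ → OnePoint ℂ} {a b : ℂ → ℂ} (h : IsLift f a b) {z : ℂ}
    (hz : z ∈ ball (0 : ℂ) 1) : map f (𝓝 z) = 𝓝 (f z) := by
  by_cases hb : b z = 0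
  · have ha : a z ≠ 0 := (h.ne_zero hz).resolve_right (by simpa using hb)
    have h1 := h.swap.map_nhds_eq_of_ne hz (by simpa using ha)
    have h2 := congrArg (map sphereInv) h1
    rw [map_map, map_sphereInv_nhds, sphereInv_sphereInv] at h2
    convert h2 using 2
    funext w
    exact (sphereInv_sphereInv _).symm
  · exact h.map_nhds_eq_of_ne hz hb

/-- The images of smaller concentric disks are neighbourhoods that cover the image of `f`;
compactness of `S` selects one radius. -/
lemma IsLift.exists_radius {f : ℂ → OnePoint ℂ} {a b : ℂ → ℂ} (h : IsLift f a b)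
    (hi : InjOn f (ball 0 1)) {S : Set (OnePoint ℂ)} (hS : IsClosed S)
    (hSf : S ⊆ f '' ball 0 1) : ∃ r < 1, ∀ z ∈ ball (0 : ℂ) 1, f z ∈ S → ‖z‖ < r := by
  refine hS.isCompact.induction_on
    (p := fun s => ∃ r : ℝ, r < 1 ∧ ∀ z ∈ ball (0 : ℂ) 1, f z ∈ s → ‖z‖ < r) ?_ ?_ ?_ ?_
  · exact ⟨0, one_pos, fun z _ hz => hz.elim⟩
  · rintro s t hst ⟨r, hr, H⟩
    exact ⟨r, hr, fun z hz hs => H z hz (hst hs)⟩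
  · rintro s t ⟨r, hr, H⟩ ⟨r', hr', H'⟩
    refine ⟨max r r', max_lt hr hr', fun z hz hs => ?_⟩
    rcases hs with hs | hs
    · exact lt_max_of_lt_left (H z hz hs)
    · exact lt_max_of_lt_right (H' z hz hs)
  · intro p hp
    obtain ⟨z, hz, rfl⟩ := hSf hp
    have hz1 := mem_ball_zero_iff.mp hz
    refine ⟨f '' ball 0 ((1 + ‖z‖) / 2), mem_nhdsWithin_of_mem_nhds ?_, (1 + ‖z‖) / 2,
      by linarith, ?_⟩
    · rw [← h.map_nhds_eq hz]
      exact image_mem_map (isOpen_ball.mem_nhds (mem_ball_zero_iff.mpr (by linarith)))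
    · rintro w hw ⟨w', hw', hww⟩
      have : w' = w := hi (ball_subset_ball (by linarith) hw') hw hww
      rw [← this]
      exact mem_ball_zero_iff.mp hw'

/-! ### The depth of the Epstein surface in a half-space -/

lemma nonpos_of_forall_le_mul {X Y : ℝ} (h : ∀ η > 0, X ≤ η * Y) : X ≤ 0 := by
  by_contra! hX
  have h1 := h (X / (2 * (|Y| + 1))) (by positivity)
  have h2 : X / (2 * (|Y| + 1)) * Y ≤ X / (2 * (|Y| + 1)) * (|Y| + 1) :=
    mul_le_mul_of_nonneg_left (by linarith [le_abs_self Y]) (by positivity)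
  have h3 : X / (2 * (|Y| + 1)) * (|Y| + 1) = X / 2 := by field_simp
  linarith

lemma IsUnimodular.neg_discr_le {A : ℝ} {B : ℂ} {C : ℝ} {a b : ℂ → ℂ} {z : ℂ}
    (h : IsUnimodular a b) (hz : z ∈ ball (0 : ℂ) 1) :
    -(‖B‖ ^ 2 - A * C) ≤ ((epsteinDepth A B C a b z).re - (horoDepth A B C a b z).re) *
      (horoDepth A B C a b z).re := by
  rw [epsteinDepth_mul_horoDepth_re h hz]
  have : 0 ≤ ‖horoDepthD A B C a b z‖ ^ 2 * (1 - ‖z‖ ^ 2) ^ 2 := by positivity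
  linarith

/-- With `M = d`, the global estimate becomes `s + (E - 1) u ≤ (E - 1) d`. Together with `(s - u) u
≥ -d²` it confines `(u, s)` to a planar region on which `s ≤ d (E - 1 / E)`. -/
lemma IsUnimodular.epsteinDepth_le_of_inside {A : ℝ} {B : ℂ} {C : ℝ} {a b : ℂ → ℂ} {K E r₀ : ℝ}
    (h : IsUnimodular a b) (hΔ : A * C < ‖B‖ ^ 2) (hE : 1 ≤ E) (hKE : 2 * K - 1 ≤ E)
    (hK : ∀ z ∈ ball (0 : ℂ) 1, ‖potential a b z‖ * (1 - ‖z‖ ^ 2) ^ 2 ≤ 2 * K)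
    (hr₀ : r₀ < 1) (hneg : ∀ z ∈ ball (0 : ℂ) 1, r₀ ≤ ‖z‖ → (quad A B C a b z).re < 0)
    {z : ℂ} (hz : z ∈ ball (0 : ℂ) 1) :
    (epsteinDepth A B C a b z).re ≤ √(‖B‖ ^ 2 - A * C) * (E - 1 / E) := by
  have hΔ' : 0 < ‖B‖ ^ 2 - A * C := by linarith
  set d := √(‖B‖ ^ 2 - A * C) with hd
  have hdp : 0 < d := Real.sqrt_pos.mpr hΔ'
  have hd2 : d ^ 2 = ‖B‖ ^ 2 - A * C := Real.sq_sqrt hΔ'.le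
  have hE0 : 0 < E := by linarith
  have h1 := h.neg_discr_le (A := A) (B := B) (C := C) hz
  rw [← hd2] at h1
  -- The choice `c = E - 1` gives only `2 K ≤ 2 + c`; the extra `η` makes this strict and is then
  -- let go to 0.
  have h2 : ∀ η > 0, (epsteinDepth A B C a b z).re + (E - 1) * (horoDepth A B C a b z).re
      - (E - 1) * d ≤ η * (d - (horoDepth A B C a b z).re) := by
    intro η hη
    have := h.depth_le (A := A) (B := B) (C := C) (c := E - 1 + η) (M := d) (by linarith)
      (by linarith) hK hr₀ hneg (by
        intro r _ x _ s hs hsu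
        rw [← hd2] at hsu
        by_contra! hlt
        nlinarith) hz
    linarith
  have h3 := nonpos_of_forall_le_mul h2
  generalize (epsteinDepth A B C a b z).re = s at h1 h3 ⊢
  generalize (horoDepth A B C a b z).re = u at h1 h3
  by_contra! hs
  rcases eq_or_lt_of_le hE with h4 | h4
  · rw [← h4] at h3 hs
    linarith
  · have h5 : d * (E - 1 / E) = (E - 1) * (d + d / E) := by field_simp; ring
    -- If `s` exceeded the bound, then `-u > d / E` and `s - u > d E`, whose product contradicts `(s
    -- - u) (-u) ≤ d²`.
    have h6 : d / E < -u := by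
      have : (E - 1) * (d / E) < (E - 1) * (-u) := by nlinarith
      exact lt_of_mul_lt_mul_left this (by linarith)
    have h7 : d * E < s - u := by
      have : d * (E - 1 / E) = d * E - d / E := by ring
      linarith
    have h8 : d * E * (d / E) < (s - u) * (-u) :=
      mul_lt_mul'' h7 h6 (by positivity) (by positivity)
    have h9 : d * E * (d / E) = d ^ 2 := by field_simp
    linarith

/-- Here `u < 0`, so `(s - u) u = -d²` with `s ≤ 0` forces `u ≤ -d` and `M = -d`. The size of `K` is
irrelevant: any large enough `c`, such as `2 |K|`, gives the same conclusion. -/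
lemma IsUnimodular.epsteinDepth_nonpos_of_outside {A : ℝ} {B : ℂ} {C : ℝ} {a b : ℂ → ℂ} {K : ℝ}
    (h : IsUnimodular a b) (hΔ : A * C < ‖B‖ ^ 2)
    (hK : ∀ z ∈ ball (0 : ℂ) 1, ‖potential a b z‖ * (1 - ‖z‖ ^ 2) ^ 2 ≤ 2 * K)
    (hneg : ∀ z ∈ ball (0 : ℂ) 1, (quad A B C a b z).re < 0)
    {z : ℂ} (hz : z ∈ ball (0 : ℂ) 1) :
    (epsteinDepth A B C a b z).re ≤ 0 := by
  have hΔ' : 0 < ‖B‖ ^ 2 - A * C := by linarith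
  set d := √(‖B‖ ^ 2 - A * C) with hd
  have hdp : 0 < d := Real.sqrt_pos.mpr hΔ'
  have hd2 : d ^ 2 = ‖B‖ ^ 2 - A * C := Real.sq_sqrt hΔ'.le
  have h1 := h.neg_discr_le (A := A) (B := B) (C := C) hz
  rw [← hd2] at h1
  have hc : 0 ≤ 2 * |K| := by positivity
  have hu : (horoDepth A B C a b z).re < 0 := by
    rw [horoDepth, discW_eq, Complex.div_ofReal_re]
    exact div_neg_of_neg_of_pos (hneg z hz) (one_sub_norm_sq_pos hz)
  have h3 := h.depth_le (A := A) (B := B) (C := C) (c := 2 * |K|) (M := -d) (r₀ := 0) hc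
    (by linarith [le_abs_self K]) hK one_pos (fun z hz _ => hneg z hz) (by
      intro r hr x hx s hs hsu
      have hu' : (horoDepth A B C (EpsteinPoincare.dilLift r a)
          (EpsteinPoincare.dilLift r b) x).re < 0 := by
        rw [horoDepth, discW_eq, Complex.div_ofReal_re, quad_dilLift hr, Complex.div_ofReal_re]
        exact div_neg_of_neg_of_pos (div_neg_of_neg_of_pos
          (hneg _ (mul_mem_ball hr (ball_subset_closedBall hx))) hr.1) (one_sub_norm_sq_pos hx)
      rw [← hd2] at hsu
      by_contra! hlt
      nlinarith) hz
  generalize (epsteinDepth A B C a b z).re = s at h1 h3 ⊢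
  generalize (horoDepth A B C a b z).re = u at h1 h3 hu
  by_contra! hs
  have h4 : d < -u := by
    by_contra! h5
    nlinarith
  nlinarith

lemma sesq_shift (A : ℝ) (B : ℂ) (C δ : ℝ) (x y x' y' : ℂ) :
    sesq (A - δ) B (C - δ) x y x' y' = sesq A B C x y x' y' - δ * sesq 1 0 1 x y x' y' := by
  simp only [sesq]
  push_cast
  simp only [map_zero]
  ring

lemma epsteinDepth_shift (A : ℝ) (B : ℂ) (C δ : ℝ) (a b : ℂ → ℂ) (z : ℂ) :
    epsteinDepth (A - δ) B (C - δ) a b z =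
      epsteinDepth A B C a b z - δ * epsteinDepth 1 0 1 a b z := by
  simp only [epsteinDepth, quad, quadD, quadDD, sesq_shift, map_mul, map_sub, Complex.conj_ofReal]
  ring

/-- The depth of the Epstein surface of one side of `γ` in a half-space bounded away from `γ`. -/
lemma IsLift.epsteinDepth_le {f : ℂ → OnePoint ℂ} {a b : ℂ → ℂ} {γ Ω Ω' : Set (OnePoint ℂ)}
    (h : IsLift f a b) (hf : IsConformalOnto f Ω) (hΩ : AreComplementaryComponents γ Ω Ω')
    {A : ℝ} {B : ℂ} {C K E : ℝ} (hΔ : A * C < ‖B‖ ^ 2) (hγ : γ ⊆ idealDisk A B C)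
    (hE : 1 ≤ E) (hKE : 2 * K - 1 ≤ E)
    (hK : ∀ z ∈ ball (0 : ℂ) 1, ‖potential a b z‖ * (1 - ‖z‖ ^ 2) ^ 2 ≤ 2 * K)
    {z : ℂ} (hz : z ∈ ball (0 : ℂ) 1) :
    (epsteinDepth A B C a b z).re ≤ √(‖B‖ ^ 2 - A * C) * (E - 1 / E) := by
  have hE' : 0 ≤ E - 1 / E := by
    have : 1 / E ≤ 1 := (div_le_one (by linarith)).mpr hE
    linarith
  -- The open complementary disk is connected and misses `γ`, so it lies on one side: the `inside`
  -- estimate serves `Ω`, the `outside` estimate serves `Ω'`.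
  have hsides : (idealDisk A B C)ᶜ ⊆ Ω ∨ (idealDisk A B C)ᶜ ⊆ Ω' := by
    refine (isPreconnected_compl_idealDisk A B C).subset_or_subset hΩ.isOpen_left
      hΩ.isOpen_right hΩ.disjoint ?_
    rw [hΩ.union_eq]
    exact compl_subset_compl.mpr hγ
  have hquad : ∀ (A : ℝ) (B : ℂ) (C : ℝ), ∀ x ∈ ball (0 : ℂ) 1,
      (f x ∈ idealDisk A B C ↔ (quad A B C a b x).re ≤ 0) := fun A B C x hx => by
    rw [h.eq_proj x hx, proj_mem_idealDisk_iff (h.ne_zero hx), quad]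
  have hflip : ∀ δ : ℝ, ∀ x ∈ ball (0 : ℂ) 1,
      f x ∉ idealDisk (-(A - δ)) (-B) (-(C - δ)) → (quad (A - δ) B (C - δ) a b x).re < 0 := by
    intro δ x hx hn
    rw [hquad _ _ _ x hx, quad, sesq_self_re, map_neg, neg_mul (conj B), Complex.neg_re,
      not_le] at hn
    rw [quad, sesq_self_re]
    linarith
  -- `γ` may touch the boundary of the disk. Subtracting `δ` times the standard form makes `Q`
  -- strictly negative near `γ`; both sides are continuous as `δ` tends to 0.
  have hsmall : ∀ᶠ δ : ℝ in 𝓝[>] 0, (epsteinDepth A B C a b z).re -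
      δ * (epsteinDepth 1 0 1 a b z).re ≤ √(‖B‖ ^ 2 - (A - δ) * (C - δ)) * (E - 1 / E) := by
    have hc : ContinuousAt (fun δ : ℝ => (A - δ) * (C - δ)) 0 := by fun_prop
    have h1 : ∀ᶠ δ : ℝ in 𝓝[>] 0, (A - δ) * (C - δ) < ‖B‖ ^ 2 :=
      (hc.eventually_lt continuousAt_const (by simpa using hΔ)).filter_mono nhdsWithin_le_nhds
    filter_upwards [h1, self_mem_nhdsWithin] with δ hδ hδ0
    have hδ0 : 0 < δ := hδ0
    have e1 : (epsteinDepth (A - δ) B (C - δ) a b z).re =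
        (epsteinDepth A B C a b z).re - δ * (epsteinDepth 1 0 1 a b z).re := by
      rw [epsteinDepth_shift, Complex.sub_re, Complex.re_ofReal_mul]
    rw [← e1]
    rcases hsides with hs | hs
    · obtain ⟨r₀, hr₀, hr⟩ := h.exists_radius hf.bijOn.injOn
        (isClosed_idealDisk (-(A - δ)) (-B) (-(C - δ))) (by
          rw [hf.bijOn.image_eq]
          exact fun p hp => hs (notMem_idealDisk_of_mem_shift hδ0 hp))
      exact h.toIsUnimodular.epsteinDepth_le_of_inside hδ hE hKE hK hr₀
        (fun x hx hrx => hflip δ x hx fun hmem => not_lt.mpr hrx (hr x hx hmem)) hz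
    · refine (h.toIsUnimodular.epsteinDepth_nonpos_of_outside hδ hK
        (fun x hx => hflip δ x hx fun hmem => ?_) hz).trans (by positivity)
      exact hΩ.disjoint.le_bot
        ⟨hf.bijOn.mapsTo hx, hs (notMem_idealDisk_of_mem_shift hδ0 hmem)⟩
  have hl : Tendsto (fun δ : ℝ => (epsteinDepth A B C a b z).re -
      δ * (epsteinDepth 1 0 1 a b z).re) (𝓝[>] 0) (𝓝 (epsteinDepth A B C a b z).re) := by
    have : Continuous fun δ : ℝ => (epsteinDepth A B C a b z).re -
      δ * (epsteinDepth 1 0 1 a b z).re := by fun_prop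
    simpa using (this.tendsto 0).mono_left nhdsWithin_le_nhds
  have hr : Tendsto (fun δ : ℝ => √(‖B‖ ^ 2 - (A - δ) * (C - δ)) * (E - 1 / E)) (𝓝[>] 0)
      (𝓝 (√(‖B‖ ^ 2 - A * C) * (E - 1 / E))) := by
    have : Continuous fun δ : ℝ => √(‖B‖ ^ 2 - (A - δ) * (C - δ)) * (E - 1 / E) := by fun_prop
    simpa using (this.tendsto 0).mono_left nhdsWithin_le_nhds
  exact le_of_tendsto_of_tendsto hl hr hsmall

/-! ### The hyperboloid model: Hermitian matrices `(P, Z, T)` with determinant `P T - |Z|²` -/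

/-- The pairing of the half-space `(A, B, C)` with the Hermitian matrix `(P, Z, T)`. -/
def formPairing (A : ℝ) (B : ℂ) (C : ℝ) (Y : ℝ × ℂ × ℝ) : ℝ :=
  A * Y.1 + 2 * (conj B * Y.2.1).re + C * Y.2.2

/-- The determinant of the Hermitian matrix `(P, Z, T)`. -/
def hermDet (Y : ℝ × ℂ × ℝ) : ℝ := Y.1 * Y.2.2 - ‖Y.2.1‖ ^ 2

/-- The light-like matrix over `proj a b`, normalised by its pairing with the point `x`. -/
def lightVector (x : H3) (a b : ℂ) : ℝ × ℂ × ℝ :=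
  (2 * x.t / (‖a - x.z * b‖ ^ 2 + x.t ^ 2 * ‖b‖ ^ 2)) • (‖a‖ ^ 2, a * conj b, ‖b‖ ^ 2)

/-- The normalised light-like matrices over the points of `γ`. -/
def lightCone (x : H3) (γ : Set (OnePoint ℂ)) : Set (ℝ × ℂ × ℝ) :=
  {Y | ∃ a b : ℂ, (a ≠ 0 ∨ b ≠ 0) ∧ proj a b ∈ γ ∧ Y = lightVector x a b}

lemma lightVector_denom_pos (x : H3) {a b : ℂ} (h : a ≠ 0 ∨ b ≠ 0) :
    0 < ‖a - x.z * b‖ ^ 2 + x.t ^ 2 * ‖b‖ ^ 2 := by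
  have ht := x.t_pos
  by_cases hb : b = 0
  · have ha : a ≠ 0 := h.resolve_right (by simpa using hb)
    have := norm_pos_iff.mpr ha
    simp only [hb, mul_zero, sub_zero, norm_zero]
    positivity
  · have := norm_pos_iff.mpr hb
    positivity

lemma formPairing_smul (A : ℝ) (B : ℂ) (C c : ℝ) (Y : ℝ × ℂ × ℝ) :
    formPairing A B C (c • Y) = c * formPairing A B C Y := by
  simp only [formPairing, Prod.smul_fst, Prod.smul_snd, smul_eq_mul, Complex.real_smul]
  rw [mul_left_comm (conj B), Complex.re_ofReal_mul]
  ring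

lemma formPairing_add (A : ℝ) (B : ℂ) (C : ℝ) (Y Y' : ℝ × ℂ × ℝ) :
    formPairing A B C (Y + Y') = formPairing A B C Y + formPairing A B C Y' := by
  simp only [formPairing, Prod.fst_add, Prod.snd_add, mul_add, Complex.add_re]
  ring

lemma formPairing_lightVector (A : ℝ) (B : ℂ) (C : ℝ) (x : H3) (a b : ℂ) :
    formPairing A B C (lightVector x a b) =
      2 * x.t / (‖a - x.z * b‖ ^ 2 + x.t ^ 2 * ‖b‖ ^ 2) * (sesq A B C a b a b).re := by
  rw [lightVector, formPairing_smul, sesq_self_re]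
  rfl

lemma formPairing_lightVector_nonpos {A : ℝ} {B : ℂ} {C : ℝ} {γ : Set (OnePoint ℂ)}
    (hγ : γ ⊆ idealDisk A B C) (x : H3) {Y : ℝ × ℂ × ℝ} (hY : Y ∈ lightCone x γ) :
    formPairing A B C Y ≤ 0 := by
  obtain ⟨a, b, hab, hp, rfl⟩ := hY
  have h1 := (proj_mem_idealDisk_iff hab).mp (hγ hp)
  have ht := x.t_pos
  have hd := lightVector_denom_pos x hab
  rw [formPairing_lightVector]
  exact mul_nonpos_of_nonneg_of_nonpos (by positivity) h1

lemma subset_idealDisk_of_formPairing_nonpos {A : ℝ} {B : ℂ} {C : ℝ} {γ : Set (OnePoint ℂ)}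
    (x : H3) (h : ∀ Y ∈ lightCone x γ, formPairing A B C Y ≤ 0) : γ ⊆ idealDisk A B C := by
  intro p hp
  obtain ⟨a, b, hab, rfl⟩ := exists_eq_proj p
  have h1 := h _ ⟨a, b, hab, hp, rfl⟩
  have ht := x.t_pos
  have hd := lightVector_denom_pos x hab
  rw [formPairing_lightVector] at h1
  rw [proj_mem_idealDisk_iff hab]
  exact nonpos_of_mul_nonpos_right h1 (by positivity)

lemma conj_neg_div_mul_re (r : ℝ) (z w : ℂ) :
    (conj (-(z / r)) * w).re = -((conj z * w).re / r) := by
  rw [map_neg, map_div₀, Complex.conj_ofReal, neg_mul, Complex.neg_re, div_mul_eq_mul_div,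
    Complex.div_ofReal_re]

/-- The coefficients are those of the linear form dual to `x`; thus the light vectors lie in an
affine slice, which is what makes their hull bounded. -/
lemma formPairing_self_lightVector (x : H3) {Y : ℝ × ℂ × ℝ} {γ : Set (OnePoint ℂ)}
    (hY : Y ∈ lightCone x γ) :
    formPairing (1 / (2 * x.t)) (-(x.z / (2 * x.t : ℝ))) ((‖x.z‖ ^ 2 + x.t ^ 2) / (2 * x.t)) Y
      = 1 := by
  obtain ⟨a, b, hab, -, rfl⟩ := hY
  have ht := x.t_pos
  have hd := lightVector_denom_pos x hab
  have h1 : (sesq (1 / (2 * x.t)) (-(x.z / (2 * x.t : ℝ))) ((‖x.z‖ ^ 2 + x.t ^ 2) / (2 * x.t))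
      a b a b).re = (‖a - x.z * b‖ ^ 2 + x.t ^ 2 * ‖b‖ ^ 2) / (2 * x.t) := by
    have h2 : ‖a - x.z * b‖ ^ 2 = ‖a‖ ^ 2 - 2 * (conj x.z * (a * conj b)).re
        + ‖x.z‖ ^ 2 * ‖b‖ ^ 2 := by
      rw [← Complex.normSq_eq_norm_sq, Complex.normSq_sub, map_mul, map_mul,
        Complex.normSq_eq_norm_sq, Complex.normSq_eq_norm_sq, Complex.normSq_eq_norm_sq,
        mul_left_comm]
      ring
    rw [sesq_self_re, h2, conj_neg_div_mul_re]
    field_simp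
    ring
  rw [formPairing_lightVector, h1]
  field_simp

lemma lightVector_mem_bounds (x : H3) {Y : ℝ × ℂ × ℝ} {γ : Set (OnePoint ℂ)}
    (hY : Y ∈ lightCone x γ) : 0 ≤ Y.2.2 ∧ ‖Y‖ ≤ 2 / x.t + 4 * (x.t + ‖x.z‖ ^ 2 / x.t) := by
  obtain ⟨a, b, hab, -, rfl⟩ := hY
  have ht := x.t_pos
  have hd := lightVector_denom_pos x hab
  set D := ‖a - x.z * b‖ ^ 2 + x.t ^ 2 * ‖b‖ ^ 2 with hD
  have hT : 2 * x.t / D * ‖b‖ ^ 2 ≤ 2 / x.t := by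
    rw [div_mul_eq_mul_div, div_le_div_iff₀ hd ht]
    nlinarith [sq_nonneg ‖a - x.z * b‖]
  have hP : 2 * x.t / D * ‖a‖ ^ 2 ≤ 4 * (x.t + ‖x.z‖ ^ 2 / x.t) := by
    have h1 : ‖a‖ ≤ ‖a - x.z * b‖ + ‖x.z‖ * ‖b‖ := by
      rw [← norm_mul]
      simpa using norm_add_le (a - x.z * b) (x.z * b)
    have h2 : ‖a‖ ^ 2 ≤ 2 * ‖a - x.z * b‖ ^ 2 + 2 * (‖x.z‖ ^ 2 * ‖b‖ ^ 2) := by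
      nlinarith [norm_nonneg a, sq_nonneg (‖a - x.z * b‖ - ‖x.z‖ * ‖b‖)]
    have h3 : 4 * (x.t + ‖x.z‖ ^ 2 / x.t) * D = 2 * x.t * (2 * ‖a - x.z * b‖ ^ 2 +
        2 * (‖x.z‖ ^ 2 * ‖b‖ ^ 2)) + 4 * x.t ^ 3 * ‖b‖ ^ 2
        + 4 * ‖x.z‖ ^ 2 / x.t * ‖a - x.z * b‖ ^ 2 := by
      rw [hD]; field_simp; ring
    rw [div_mul_eq_mul_div, div_le_iff₀ hd, h3]
    have h4 : 0 ≤ 4 * x.t ^ 3 * ‖b‖ ^ 2 := by positivity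
    have h5 : 0 ≤ 4 * ‖x.z‖ ^ 2 / x.t * ‖a - x.z * b‖ ^ 2 := by positivity
    nlinarith
  have hT0 : 0 ≤ 2 * x.t / D * ‖b‖ ^ 2 := by positivity
  have hP0 : 0 ≤ 2 * x.t / D * ‖a‖ ^ 2 := by positivity
  refine ⟨hT0, ?_⟩
  have hZ : 2 * x.t / D * (‖a‖ * ‖b‖) ≤ 2 * x.t / D * ‖b‖ ^ 2 + 2 * x.t / D * ‖a‖ ^ 2 := by
    rw [← mul_add]
    refine mul_le_mul_of_nonneg_left ?_ (by positivity)
    nlinarith [sq_nonneg (‖a‖ - ‖b‖), sq_nonneg ‖a‖, sq_nonneg ‖b‖]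
  rw [lightVector, ← hD, norm_smul, Real.norm_of_nonneg (by positivity), Prod.norm_def,
    Prod.norm_def]
  simp only [norm_mul, RCLike.norm_conj, Real.norm_eq_abs, abs_of_nonneg (sq_nonneg ‖a‖),
    abs_of_nonneg (sq_nonneg ‖b‖)]
  rw [mul_max_of_nonneg _ _ (by positivity), mul_max_of_nonneg _ _ (by positivity)]
  exact max_le (by linarith) (max_le (by linarith) (by linarith))

/-- The compact convex hull of the normalised light vectors over `γ`. -/
def lightHull (x : H3) (γ : Set (OnePoint ℂ)) : Set (ℝ × ℂ × ℝ) :=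
  closure (convexHull ℝ (lightCone x γ))

lemma continuous_formPairing (A : ℝ) (B : ℂ) (C : ℝ) : Continuous (formPairing A B C) := by
  unfold formPairing
  fun_prop

lemma formPairing_le_of_mem_lightHull {A : ℝ} {B : ℂ} {C k : ℝ} {x : H3} {γ : Set (OnePoint ℂ)}
    (h : ∀ Y ∈ lightCone x γ, formPairing A B C Y ≤ k) {Y : ℝ × ℂ × ℝ} (hY : Y ∈ lightHull x γ) :
    formPairing A B C Y ≤ k := by
  have hconv : Convex ℝ {Y | formPairing A B C Y ≤ k} := by
    intro Y hY Y' hY' s t hs ht hst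
    have h1 : formPairing A B C Y ≤ k := hY
    have h2 : formPairing A B C Y' ≤ k := hY'
    change formPairing A B C _ ≤ k
    rw [formPairing_add, formPairing_smul, formPairing_smul]
    calc s * formPairing A B C Y + t * formPairing A B C Y' ≤ s * k + t * k := by gcongr
      _ = k := by rw [← add_mul, hst, one_mul]
  exact closure_minimal (convexHull_min h hconv)
    (isClosed_le (continuous_formPairing A B C) continuous_const) hY

lemma isCompact_lightHull (x : H3) (γ : Set (OnePoint ℂ)) : IsCompact (lightHull x γ) := by
  refine Metric.isCompact_of_isClosed_isBounded isClosed_closure (Bornology.IsBounded.closure ?_)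
  rw [isBounded_convexHull]
  exact isBounded_iff_forall_norm_le.mpr ⟨_, fun Y hY => (lightVector_mem_bounds x hY).2⟩

lemma formPairing_neg (A : ℝ) (B : ℂ) (C : ℝ) (Y : ℝ × ℂ × ℝ) :
    formPairing (-A) (-B) (-C) Y = -formPairing A B C Y := by
  simp only [formPairing, map_neg, neg_mul, Complex.neg_re]
  ring

lemma formPairing_self_of_mem_lightHull (x : H3) {Y : ℝ × ℂ × ℝ} {γ : Set (OnePoint ℂ)}
    (hY : Y ∈ lightHull x γ) :
    formPairing (1 / (2 * x.t)) (-(x.z / (2 * x.t : ℝ))) ((‖x.z‖ ^ 2 + x.t ^ 2) / (2 * x.t)) Y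
      = 1 := by
  refine le_antisymm
    (formPairing_le_of_mem_lightHull (fun Y hY => (formPairing_self_lightVector x hY).le) hY) ?_
  have h1 := formPairing_le_of_mem_lightHull (A := -(1 / (2 * x.t)))
    (B := -(-(x.z / (2 * x.t : ℝ)))) (C := -((‖x.z‖ ^ 2 + x.t ^ 2) / (2 * x.t))) (k := -1)
    (fun Y hY => by rw [formPairing_neg, formPairing_self_lightVector x hY]) hY
  rw [formPairing_neg] at h1
  linarith

/-- Twice the polarisation of `hermDet`. -/
def hermPolar (Y Y' : ℝ × ℂ × ℝ) : ℝ :=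
  Y.1 * Y'.2.2 + Y'.1 * Y.2.2 - 2 * (conj Y.2.1 * Y'.2.1).re

lemma hermDet_combo (Y Y' : ℝ × ℂ × ℝ) (s t : ℝ) :
    hermDet (s • Y + t • Y') =
      s ^ 2 * hermDet Y + s * t * hermPolar Y Y' + t ^ 2 * hermDet Y' := by
  simp only [hermDet, hermPolar, Prod.fst_add, Prod.snd_add, Prod.smul_fst, Prod.smul_snd,
    smul_eq_mul, Complex.real_smul]
  rw [← Complex.normSq_eq_norm_sq, ← Complex.normSq_eq_norm_sq, ← Complex.normSq_eq_norm_sq]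
  simp only [Complex.normSq_apply, Complex.add_re, Complex.add_im, Complex.mul_re, Complex.mul_im,
    Complex.ofReal_re, Complex.ofReal_im, Complex.conj_re, Complex.conj_im]
  ring

lemma hermDet_lightVector (x : H3) (a b : ℂ) : hermDet (lightVector x a b) = 0 := by
  simp only [hermDet, lightVector, Prod.smul_fst, Prod.smul_snd, smul_eq_mul, norm_smul, norm_mul,
    RCLike.norm_conj, mul_pow, Real.norm_eq_abs, sq_abs]
  ring

lemma hermPolar_lightVector (x : H3) (a b a' b' : ℂ) :
    hermPolar (lightVector x a b) (lightVector x a' b') =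
      2 * x.t / (‖a - x.z * b‖ ^ 2 + x.t ^ 2 * ‖b‖ ^ 2) *
      (2 * x.t / (‖a' - x.z * b'‖ ^ 2 + x.t ^ 2 * ‖b'‖ ^ 2)) * ‖a * b' - a' * b‖ ^ 2 := by
  simp only [hermPolar, lightVector, Prod.smul_fst, Prod.smul_snd, smul_eq_mul]
  generalize 2 * x.t / (‖a - x.z * b‖ ^ 2 + x.t ^ 2 * ‖b‖ ^ 2) = c
  generalize 2 * x.t / (‖a' - x.z * b'‖ ^ 2 + x.t ^ 2 * ‖b'‖ ^ 2) = c'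
  simp only [← Complex.normSq_eq_norm_sq, Complex.normSq_apply, Complex.real_smul, Complex.sub_re,
    Complex.sub_im, Complex.mul_re, Complex.mul_im, Complex.ofReal_re, Complex.ofReal_im,
    Complex.conj_re, Complex.conj_im]
  ring

/-- The midpoint of light vectors over two distinct points is time-like: its determinant is a
quarter of their positive polar pairing. -/
lemma exists_hermDet_pos (x : H3) {γ : Set (OnePoint ℂ)} (hγ : γ.Nontrivial) :
    ∃ Y ∈ lightHull x γ, 0 < hermDet Y := by
  obtain ⟨p, hp, q, hq, hpq⟩ := hγ
  obtain ⟨a, b, hab, rfl⟩ := exists_eq_proj p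
  obtain ⟨a', b', hab', rfl⟩ := exists_eq_proj q
  have ht := x.t_pos
  have hd := lightVector_denom_pos x hab
  have hd' := lightVector_denom_pos x hab'
  refine ⟨(1 / 2 : ℝ) • lightVector x a b + (1 / 2 : ℝ) • lightVector x a' b',
    subset_closure ?_, ?_⟩
  · have h1 : lightVector x a b ∈ lightCone x γ := ⟨a, b, hab, hp, rfl⟩
    have h2 : lightVector x a' b' ∈ lightCone x γ := ⟨a', b', hab', hq, rfl⟩
    exact convex_convexHull ℝ _ (subset_convexHull ℝ _ h1) (subset_convexHull ℝ _ h2)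
      (by norm_num) (by norm_num) (by norm_num)
  · rw [hermDet_combo, hermDet_lightVector, hermDet_lightVector, hermPolar_lightVector]
    have h1 : 0 < ‖a * b' - a' * b‖ := by
      rw [norm_pos_iff, sub_ne_zero]
      exact fun h => hpq ((proj_eq_proj_iff hab hab').mpr h)
    have : 0 < 2 * x.t / (‖a - x.z * b‖ ^ 2 + x.t ^ 2 * ‖b‖ ^ 2) *
      (2 * x.t / (‖a' - x.z * b'‖ ^ 2 + x.t ^ 2 * ‖b'‖ ^ 2)) * ‖a * b' - a' * b‖ ^ 2 := by
      positivity
    linarith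

/-- A point of hyperbolic space whose depth in every half-space away from `γ` is at most `ε` lies
in the `ε`-neighbourhood of the convex core. -/
theorem mem_closedNhd_convexCore {x : H3} {γ : Set (OnePoint ℂ)} {ε : ℝ} (hγ : γ.Nontrivial)
    (hε : 0 ≤ ε)
    (h : ∀ (A : ℝ) (B : ℂ) (C : ℝ), A * C < ‖B‖ ^ 2 → γ ⊆ idealDisk A B C →
      halfSpaceForm A B C x ≤ x.t * (√(‖B‖ ^ 2 - A * C) * (2 * Real.sinh ε))) :
    x ∈ closedNhd ε (convexCore γ) := by
  obtain ⟨Y₁, hY₁, hY₁p⟩ := exists_hermDet_pos x hγ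
  -- On the slice of pairing 1 with `x`, the point `Y / √m` with `m = det Y` is at distance `arcosh
  -- (1 / √m)` from `x`; maximising `det` finds the nearest point of the hull.
  obtain ⟨Y, hY, hmax⟩ := (isCompact_lightHull x γ).exists_isMaxOn ⟨Y₁, hY₁⟩
    (f := hermDet) (by unfold hermDet; fun_prop)
  have hm : 0 < hermDet Y := hY₁p.trans_le (hmax hY₁)
  -- First variation of the determinant at its maximum along the segment from `Y` to `Y'`.
  have hpol : ∀ Y' ∈ lightHull x γ, hermPolar Y Y' ≤ 2 * hermDet Y := by
    intro Y' hY'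
    have h1 : ∀ s ∈ Ioo (0 : ℝ) 1, hermPolar Y Y' - 2 * hermDet Y ≤
        s * (hermPolar Y Y' - hermDet Y - hermDet Y') := by
      intro s hs
      have h2 := hmax ((convex_convexHull ℝ (lightCone x γ)).closure hY hY'
        (a := 1 - s) (b := s) (by linarith [hs.2]) hs.1.le (by ring))
      rw [mem_ofPred_eq, hermDet_combo] at h2
      have h3 : s * (hermPolar Y Y' - 2 * hermDet Y) ≤
          s * (s * (hermPolar Y Y' - hermDet Y - hermDet Y')) := by nlinarith
      exact le_of_mul_le_mul_left h3 hs.1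
    have h4 : Tendsto (fun s : ℝ => s * (hermPolar Y Y' - hermDet Y - hermDet Y')) (𝓝[>] 0)
        (𝓝 0) := by
      have : Continuous fun s : ℝ => s * (hermPolar Y Y' - hermDet Y - hermDet Y') := by fun_prop
      simpa using (this.tendsto 0).mono_left nhdsWithin_le_nhds
    have h5 := ge_of_tendsto h4 (Filter.mem_of_superset (Ioo_mem_nhdsGT one_pos) h1)
    linarith
  have hX := formPairing_self_of_mem_lightHull x hY
  have hT0 : 0 ≤ Y.2.2 := by
    have h1 := formPairing_le_of_mem_lightHull (A := 0) (B := 0) (C := -1) (k := 0) (x := x)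
      (γ := γ) (fun Y hY => by
        have := (lightVector_mem_bounds x hY).1
        simp only [formPairing, map_zero, zero_mul, Complex.zero_re]
        linarith) hY
    simp only [formPairing, map_zero, zero_mul, Complex.zero_re] at h1
    linarith
  obtain ⟨P, Z, T⟩ := Y
  have ht := x.t_pos
  set m := hermDet (P, Z, T) with hmdef
  have hm' : m = P * T - ‖Z‖ ^ 2 := rfl
  have hT : 0 < T := by
    rcases eq_or_lt_of_le hT0 with h0 | h0
    · simp only at h0
      rw [hm', ← h0] at hm
      nlinarith [sq_nonneg ‖Z‖]
    · exact h0
  have hX' : (‖x.z‖ ^ 2 + x.t ^ 2) * T + P - 2 * (conj x.z * Z).re = 2 * x.t := by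
    simp only [formPairing] at hX
    rw [conj_neg_div_mul_re] at hX
    field_simp at hX
    linarith
  have hcosh : 1 ≤ m * Real.cosh ε ^ 2 := by
    have hch := Real.one_le_cosh ε
    by_cases hm1 : m < 1
    · set t := x.t with htdef
      -- With `X` the determinant 1 matrix of `x`, this is the half-space of `Y - m X`. Its boundary
      -- plane passes through the nearest point perpendicular to the geodesic from `x`, and `hpol`
      -- puts `γ` in it. Its depth at `x` turns the hypothesis into `1 - m ≤ √(m - m²) sinh ε`.
      set A : ℝ := (T - m / t) / 2 with hA
      set B : ℂ := -((Z - (m / t : ℝ) * x.z) / 2) with hB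
      set C : ℝ := (P - m * ((‖x.z‖ ^ 2 + t ^ 2) / t)) / 2 with hC
      have hZz : ‖Z - (m / t : ℝ) * x.z‖ ^ 2 =
          ‖Z‖ ^ 2 - 2 * (m / t) * (conj x.z * Z).re + (m / t) ^ 2 * ‖x.z‖ ^ 2 := by
        simp only [← Complex.normSq_eq_norm_sq, Complex.normSq_apply, Complex.sub_re,
          Complex.sub_im, Complex.mul_re, Complex.mul_im, Complex.ofReal_re, Complex.ofReal_im,
          Complex.conj_re, Complex.conj_im]
        ring
      have hdisc : ‖B‖ ^ 2 - A * C = (m - m ^ 2) / 4 := by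
        have e1 : ‖B‖ ^ 2 = ‖Z - (m / t : ℝ) * x.z‖ ^ 2 / 4 := by
          rw [hB, norm_neg, norm_div, div_pow]; norm_num
        have e2 : P = 2 * t - (‖x.z‖ ^ 2 + t ^ 2) * T + 2 * (conj x.z * Z).re := by linarith
        rw [e1, hZz, hA, hC]
        have e3 : ‖Z‖ ^ 2 = P * T - m := by linarith
        rw [e3]
        have e4 : (conj x.z * Z).re = (P - 2 * t + (‖x.z‖ ^ 2 + t ^ 2) * T) / 2 := by linarith
        rw [e4]
        field_simp
        ring
      have hpos : 0 < m - m ^ 2 := by nlinarith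
      have hsub : γ ⊆ idealDisk A B C := by
        refine subset_idealDisk_of_formPairing_nonpos x fun Y' hY' => ?_
        have h1 := hpol Y' (subset_closure (subset_convexHull ℝ _ hY'))
        have h2 := formPairing_self_lightVector x hY'
        have h3 : formPairing A B C Y' = hermPolar (P, Z, T) Y' / 2 - m * formPairing
            (1 / (2 * t)) (-(x.z / (2 * t : ℝ))) ((‖x.z‖ ^ 2 + t ^ 2) / (2 * t)) Y' := by
          have e1 : conj B = -((conj Z - (m / t : ℝ) * conj x.z) / 2) := by
            rw [hB]
            simp only [map_neg, map_div₀, map_sub, map_mul, Complex.conj_ofReal, map_ofNat]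
          have e2 : (conj B * Y'.2.1).re =
              -((conj Z * Y'.2.1).re - m / t * (conj x.z * Y'.2.1).re) / 2 := by
            rw [e1, show -((conj Z - (m / t : ℝ) * conj x.z) / 2) * Y'.2.1 =
              (-(conj Z * Y'.2.1 - (m / t : ℝ) * (conj x.z * Y'.2.1))) / (2 : ℝ) by
                push_cast; ring, Complex.div_ofReal_re, Complex.neg_re, Complex.sub_re,
                Complex.re_ofReal_mul]
          have e3 : (conj (-(x.z / (2 * t : ℝ))) * Y'.2.1).re =
              -((conj x.z * Y'.2.1).re / (2 * t)) := conj_neg_div_mul_re _ _ _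
          rw [formPairing, formPairing, hermPolar, e2, e3, hA, hC]
          field_simp
          ring
        rw [h3, h2]
        linarith
      have h1 := h A B C (by linarith) hsub
      have h2 : halfSpaceForm A B C x = t * (1 - m) := by
        have e1 : (conj B * x.z).re = -((conj x.z * Z).re - m / t * ‖x.z‖ ^ 2) / 2 := by
          rw [hB]
          simp only [← Complex.normSq_eq_norm_sq, Complex.normSq_apply]
          rw [← Complex.conj_re]
          simp only [map_mul, Complex.conj_conj]
          rw [show -((Z - (m / t : ℝ) * x.z) / 2) * conj x.z =
            (-(conj x.z * Z - (m / t : ℝ) * (x.z * conj x.z))) / (2 : ℝ) by push_cast; ring,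
            Complex.div_ofReal_re, Complex.neg_re, Complex.sub_re, Complex.re_ofReal_mul,
            Complex.mul_conj, Complex.ofReal_re, Complex.normSq_apply]
        rw [halfSpaceForm, e1, hA, hC]
        have e4 : (conj x.z * Z).re = (P - 2 * t + (‖x.z‖ ^ 2 + t ^ 2) * T) / 2 := by linarith
        rw [e4]
        field_simp
        ring
      rw [h2, hdisc] at h1
      have h3 : 1 - m ≤ √((m - m ^ 2) / 4) * (2 * Real.sinh ε) := le_of_mul_le_mul_left h1 ht
      have h4 : (1 - m) ^ 2 ≤ (√((m - m ^ 2) / 4) * (2 * Real.sinh ε)) ^ 2 :=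
        pow_le_pow_left₀ (by linarith) h3 2
      rw [mul_pow, Real.sq_sqrt (by linarith)] at h4
      have h5 : (1 - m) * (1 - m) ≤ (1 - m) * (m * Real.sinh ε ^ 2) := by nlinarith
      have h6 := le_of_mul_le_mul_left h5 (by linarith)
      rw [Real.cosh_sq]
      linarith
    · nlinarith [sq_nonneg (Real.cosh ε - 1)]
  have hsm : 0 < √m := Real.sqrt_pos.mpr hm
  have hsq : √m ^ 2 = m := Real.sq_sqrt hm.le
  have hcosh' : 1 ≤ √m * Real.cosh ε := by
    have : 1 ≤ (√m * Real.cosh ε) ^ 2 := by rw [mul_pow, hsq]; exact hcosh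
    have hc0 := Real.cosh_pos ε
    by_contra! hlt
    have : 0 ≤ √m * Real.cosh ε := by positivity
    nlinarith
  -- The point represented by `Y / √m`; every half-space functional nonpositive on the light vectors
  -- over `γ` is nonpositive at it.
  refine ⟨⟨Z / T, √m / T, by positivity⟩, ?_, ?_⟩
  · intro A B C _ hsub
    have h1 := formPairing_le_of_mem_lightHull
      (fun Y' hY' => formPairing_lightVector_nonpos hsub x hY') hY
    simp only [formPairing] at h1
    change A * (‖Z / T‖ ^ 2 + (√m / T) ^ 2) + 2 * (conj B * (Z / T)).re + C ≤ 0
    rw [← mul_div_assoc, Complex.div_ofReal_re, norm_div, Complex.norm_real,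
      Real.norm_of_nonneg hT.le, div_pow, div_pow, hsq, ← add_div, hm',
      show A * ((‖Z‖ ^ 2 + (P * T - ‖Z‖ ^ 2)) / T ^ 2) + 2 * ((conj B * Z).re / T) + C =
        (A * P + 2 * (conj B * Z).re + C * T) / T by field_simp; ring]
    exact div_nonpos_of_nonpos_of_nonneg h1 hT.le
  · have hN : ‖x.z - Z / T‖ ^ 2 + (x.t - √m / T) ^ 2 = 2 * x.t / T - 2 * x.t * (√m / T) := by
      have e1 : ‖x.z - Z / T‖ ^ 2 = ‖x.z‖ ^ 2 - 2 * (conj x.z * Z).re / T + ‖Z‖ ^ 2 / T ^ 2 := by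
        have : x.z - Z / T = x.z - ((1 / T : ℝ) : ℂ) * Z := by push_cast; ring
        rw [this]
        simp only [← Complex.normSq_eq_norm_sq, Complex.normSq_apply, Complex.sub_re,
          Complex.sub_im, Complex.mul_re, Complex.mul_im, Complex.ofReal_re, Complex.ofReal_im,
          Complex.conj_re, Complex.conj_im]
        field_simp
        ring
      have e3 : ‖Z‖ ^ 2 = P * T - √m ^ 2 := by rw [hsq]; linarith
      have e4 : (conj x.z * Z).re = (P - 2 * x.t + (‖x.z‖ ^ 2 + x.t ^ 2) * T) / 2 := by linarith
      rw [e1, e3, e4]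
      field_simp
      ring
    have hsinh : Real.cosh ε = 2 * Real.sinh (ε / 2) ^ 2 + 1 := by
      have h1 := Real.cosh_two_mul (ε / 2)
      rw [mul_div_cancel₀ _ (two_ne_zero), Real.cosh_sq] at h1
      linarith
    have hs0 : 0 ≤ Real.sinh (ε / 2) := Real.sinh_nonneg_iff.mpr (by linarith)
    rw [hypDist]
    simp only [hN]
    have hle : √(2 * x.t / T - 2 * x.t * (√m / T)) / (2 * √(x.t * (√m / T))) ≤
        Real.sinh (ε / 2) := by
      have hq : 0 < x.t * (√m / T) := by positivity
      rw [div_le_iff₀ (by positivity)]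
      refine Real.sqrt_le_iff.mpr ⟨by positivity, ?_⟩
      rw [mul_pow, mul_pow, Real.sq_sqrt hq.le]
      have : 2 * x.t / T * 1 ≤ 2 * x.t / T * (√m * Real.cosh ε) :=
        mul_le_mul_of_nonneg_left hcosh' (by positivity)
      rw [hsinh] at this
      have e : Real.sinh (ε / 2) ^ 2 * (2 ^ 2 * (x.t * (√m / T))) =
        2 * x.t / T * (√m * (2 * Real.sinh (ε / 2) ^ 2 + 1)) - 2 * x.t * (√m / T) := by
        field_simp; ring
      linarith
    have := Real.arsinh_le_arsinh.mpr hle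
    rw [Real.arsinh_sinh] at this
    linarith

/-! ### The Epstein–Poincaré surfaces of a Jordan curve -/

lemma IsJordanCurve.nontrivial {γ : Set (OnePoint ℂ)} (h : IsJordanCurve γ) : γ.Nontrivial := by
  obtain ⟨c, -, hc, rfl⟩ := h
  refine ⟨c 1, mem_range_self _, c (-1), mem_range_self _, fun h => ?_⟩
  have h1 := congrArg (Subtype.val) (hc h)
  norm_num at h1

lemma AreComplementaryComponents.symm {γ Ω Ω' : Set (OnePoint ℂ)}
    (h : AreComplementaryComponents γ Ω Ω') : AreComplementaryComponents γ Ω' Ω where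
  isOpen_left := h.isOpen_right
  isOpen_right := h.isOpen_left
  isConnected_left := h.isConnected_right
  isConnected_right := h.isConnected_left
  disjoint := h.disjoint.symm
  union_eq := by rw [union_comm, h.union_eq]

lemma AreComplementaryComponents.notMem_left {γ Ω Ω' : Set (OnePoint ℂ)}
    (h : AreComplementaryComponents γ Ω Ω') {p : OnePoint ℂ} (hp : p ∈ γ) : p ∉ Ω := by
  intro hpΩ
  have : p ∈ γᶜ := h.union_eq ▸ Or.inl hpΩ
  exact this hp

/-- The Schwarzian derivative of a conformal map of the disk is bounded. -/
theorem IsConformalOnto.bddAbove_schwarzianSize {f : ℂ → OnePoint ℂ} {Ω : Set (OnePoint ℂ)}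
    (hf : IsConformalOnto f Ω) {p : OnePoint ℂ} (hp : p ∉ Ω) :
    BddAbove (schwarzianSize f '' ball 0 1) := by
  obtain ⟨a, b, h⟩ := hf.exists_lift hp
  obtain ⟨M, hM⟩ := exists_norm_potential_le
  refine ⟨M / 2, ?_⟩
  rintro _ ⟨z, hz, rfl⟩
  have h1 := hM f a b h hf.bijOn.injOn p (by rwa [hf.bijOn.image_eq]) z hz
  rw [h.schwarzianSize_eq hz]
  linarith

lemma hypDist_eq_of_nonpos {x y : H3} (h : hypDist x y ≤ 0) : x = y := by
  have ht := x.t_pos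
  have ht' := y.t_pos
  have h1 : Real.arsinh (√(‖x.z - y.z‖ ^ 2 + (x.t - y.t) ^ 2) / (2 * √(x.t * y.t))) ≤ 0 := by
    unfold hypDist at h
    linarith
  rw [Real.arsinh_nonpos_iff] at h1
  have h2 : 0 < 2 * √(x.t * y.t) := by positivity
  have h3 : √(‖x.z - y.z‖ ^ 2 + (x.t - y.t) ^ 2) ≤ 0 := by
    rw [div_le_iff₀ h2, zero_mul] at h1
    exact h1
  have h4 := Real.sqrt_eq_zero'.mp (le_antisymm h3 (Real.sqrt_nonneg _))
  have h5 : ‖x.z - y.z‖ ^ 2 = 0 := by nlinarith [sq_nonneg ‖x.z - y.z‖, sq_nonneg (x.t - y.t)]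
  have h6 : (x.t - y.t) ^ 2 = 0 := by nlinarith [sq_nonneg ‖x.z - y.z‖, sq_nonneg (x.t - y.t)]
  ext1
  · exact sub_eq_zero.mp (norm_eq_zero.mp (pow_eq_zero_iff two_ne_zero |>.mp h5))
  · exact sub_eq_zero.mp (pow_eq_zero_iff two_ne_zero |>.mp h6)

lemma closedNhd_zero_subset (C : Set H3) : closedNhd 0 C ⊆ C := by
  rintro x ⟨y, hy, h⟩
  rwa [hypDist_eq_of_nonpos h]

/-- The Epstein–Poincaré surface of one side of `γ` is close to the convex core. -/
theorem AreComplementaryComponents.epsteinPoincareSurface_subset {γ Ω Ω' : Set (OnePoint ℂ)}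
    (hγ : γ.Nontrivial) (hΩ : AreComplementaryComponents γ Ω Ω') {f : ℂ → OnePoint ℂ}
    (hf : IsConformalOnto f Ω) {E : ℝ} (hE : 1 ≤ E) (hKE : 2 * schwarzianNorm f - 1 ≤ E) :
    epsteinPoincareSurface Ω ⊆ closedNhd (Real.log E) (convexCore γ) := by
  obtain ⟨p, hpγ⟩ := hγ.nonempty
  have hp := hΩ.notMem_left hpγ
  obtain ⟨a, b, h⟩ := hf.exists_lift hp
  have hK : ∀ z ∈ ball (0 : ℂ) 1, ‖potential a b z‖ * (1 - ‖z‖ ^ 2) ^ 2 ≤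
      2 * schwarzianNorm f := by
    intro z hz
    -- Boundedness is needed for the real supremum to be an upper bound rather than its default
    -- value 0.
    have hbdd := hf.bddAbove_schwarzianSize hp
    rw [image_eq_range] at hbdd
    have h1 : schwarzianSize f z ≤ schwarzianNorm f := le_ciSup hbdd ⟨z, hz⟩
    rw [h.schwarzianSize_eq hz] at h1
    linarith
  rintro _ ⟨q, hq, rfl⟩
  obtain ⟨z, hz, rfl⟩ := hf.bijOn.surjOn hq
  -- The radius fits because `2 sinh (log E) = E - 1 / E`, exactly the factor in
  -- `IsLift.epsteinDepth_le`.
  refine mem_closedNhd_convexCore hγ (Real.log_nonneg hE) fun A B C hΔ hsub => ?_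
  rw [epsteinPoincareMap_depth hf h hp hz, Real.sinh_log (by linarith)]
  refine mul_le_mul_of_nonneg_left ?_ (H3.t_pos _).le
  have h1 := h.epsteinDepth_le hf hΩ hΔ hsub hE hKE hK hz
  rwa [mul_div_cancel₀ _ (two_ne_zero), ← one_div]

end EpsteinPoincare

end

theorem mainTheorem12 (γ Ω Ω' : Set (OnePoint ℂ)) (hγ : IsJordanCurve γ)
    (hΩ : AreComplementaryComponents γ Ω Ω') (f g : ℂ → OnePoint ℂ)
    (hf : IsConformalOnto f Ω) (hg : IsConformalOnto g Ω')
    (ε : ℝ)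
    (hε : ε = Real.log (max 1 (max (2 * schwarzianNorm f - 1) (2 * schwarzianNorm g - 1)))) :
    (BddAbove (schwarzianSize f '' Metric.ball 0 1) ∧
      BddAbove (schwarzianSize g '' Metric.ball 0 1)) ∧
    (epsteinPoincareSurface Ω ⊆ closedNhd ε (convexCore γ) ∧
      epsteinPoincareSurface Ω' ⊆ closedNhd ε (convexCore γ)) ∧
    (schwarzianNorm f < 1 → schwarzianNorm g < 1 →
      epsteinPoincareSurface Ω ⊆ convexCore γ ∧ epsteinPoincareSurface Ω' ⊆ convexCore γ) := by
  have hn := hγ.nontrivial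
  obtain ⟨p, hp⟩ := hn.nonempty
  refine ⟨⟨hf.bddAbove_schwarzianSize (hΩ.notMem_left hp),
    hg.bddAbove_schwarzianSize (hΩ.symm.notMem_left hp)⟩, ⟨?_, ?_⟩, fun hf1 hg1 => ⟨?_, ?_⟩⟩
  · rw [hε]
    exact hΩ.epsteinPoincareSurface_subset hn hf (le_max_left _ _)
      ((le_max_left _ _).trans (le_max_right _ _))
  · rw [hε]
    exact hΩ.symm.epsteinPoincareSurface_subset hn hg (le_max_left _ _)
      ((le_max_right _ _).trans (le_max_right _ _))
  -- A norm below 1 allows `E = 1`, that is, radius `log 1 = 0`.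
  · have h1 := hΩ.epsteinPoincareSurface_subset hn hf le_rfl (by linarith)
    rw [Real.log_one] at h1
    exact h1.trans (closedNhd_zero_subset _)
  · have h1 := hΩ.symm.epsteinPoincareSurface_subset hn hg le_rfl (by linarith)
    rw [Real.log_one] at h1
    exact h1.trans (closedNhd_zero_subset _)
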